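/- **Setting.** Let $J\ge 0$ be a horizon, $\mathcal X\subset\mathbb R^{d_x}$ and $\mathcal A\subset\mathbb R^{d_a}$ finite non-empty sets, $K=|\mathcal A|$, $d=d_x+d_a$; write $(x,a)\in\mathbb R^d$ for the concatenation of $x\in\mathcal X$ and $a\in\mathcal A$. Let $p(z\mid x,a)$ be a transition function on $\mathcal X$, $r(j,x,a)$ ($0\le j<J$) and $r(J,x)$ real rewards, $\gamma\in(0,1]$, and $\pi_0$ a probability on $\mathcal X$. An *episode* is a random sequence $x_0,a_0,x_1,\dots,a_{J-1},x_J$ with $x_0\sim\pi_0$, $a_j$ uniform on $\mathcal A$ and $x_{j+1}\sim p(\cdot\mid x_j,a_j)$; $\pi_j(x,a)$ denotes $\frac1K\,\mathbb P[x_j=x]$, the law of (state, action) at time $j$. The Bellman equation is $$V(j,x,a)=r(j,x,a)+\gamma\sum_z\max_{a'}V(j+1,z,a')\,p(z\mid x,a)\quad(0\le j<J),\qquad V(J,x,a)=r(J,x),$$ and $V$ denotes its (unique) solution. For parameters $\theta=(C^i,W^i)_{i=1}^N$ with $C^i=(C^{i,0},\dots,C^{i,J-1})\in\mathbb R^J$,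 $W^i\in\mathbb R^d$, the Q-network is $Q^N(j,x,a;\theta)=\frac1{\sqrt N}\sum_{i=1}^N C^{i,j}\sigma(W^i\cdot(x,a))$ for $0\le j<J$, and $Q^N(J,x,a;\theta)=r(J,x)$. Given i.i.d. episodes $(x_{k,j},a_{k,j})$, $k=0,1,\dots$, independent of the initial parameters, the parameters are updated, with $\alpha^N=\alpha/N$, by $$C^{i,j}_{k+1}=C^{i,j}_k+\tfrac{\alpha^N}{\sqrt N}\,\delta_{k,j}\,\sigma(W^i_k\cdot\zeta_{k,j}),\qquad W^i_{k+1}=W^i_k+\tfrac{\alpha^N}{\sqrt N}\sum_{j=0}^{J-1}\delta_{k,j}\,C^{i,j}_k\,\sigma'(W^i_k\cdot\zeta_{k,j})\,\zeta_{k,j},$$ where $\zeta_{k,j}=(x_{k,j},a_{k,j})$ and $\delta_{k,j}=r(j,x_{k,j},a_{k,j})+\gamma\max_{a'}Q^N(j+1,x_{k,j+1},a';\theta_k)-Q^N(j,x_{k,j},a_{k,j};\theta_k)$. Put $$\mu^N_t=\frac1N\sum_{i=1}^N\delta_{(C^i_{\lfloor Nt\rfloor},W^i_{\lfloor Nt\rfloor})},\qquad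 h^N_t(j,x,a)=Q^N(j,x,a;\theta_{\lfloor Nt\rfloor})\quad(0\le j<J),$$ $E=\mathcal M(\mathbb R^{J+d})\times\mathbb R^{\{0,\dots,J-1\}\times\mathcal X\times\mathcal A}$, where $\mathcal M(S)$ is the space of probability measures on $S$ with the weak topology, and let $D_E([0,T])$ be the Skorokhod space. (The empirical measure of the pairs $(C^{i,j},W^i)$ is the image of $\mu^N_t$ under $(c,w)\mapsto(c_j,w)$.) **Theorem.** Let $0<\alpha<\infty$. Assume that * $\sigma\in C^2_b(\mathbb R)$, that is, $\sigma$ is $C^2$ and $\sigma,\sigma',\sigma''$ are bounded; * $(C^i_0,W^i_0)$, $i\ge1$, are i.i.d. with law $\mu_0$ absolutely continuous with respect to Lebesgue measure; under $\mu_0$ the variables $C^{0},\dots,C^{J-1},W$ are independent and mean-zero, $C$ is bounded, and $\int\|w\|\,\mu_0(dc,dw)<\infty$; * $\pi_j(x,a)>0$ for all $j=0,\dots,J$ and $(x,a)\in\mathcal X\times\mathcal A$. Let $\mathcal G$ be the mean-zero Gaussian vector indexed by $(j,x,a)$, $0\le j<J$, with covariance $\mathbb E[\mathcal G(j,x,a)\mathcal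 G(j',x',a')]=\langle c_j\,\sigma(w\cdot(x,a))\,c_{j'}\,\sigma(w\cdot(x',a')),\mu_0\rangle$. For every initial value the random ODE system, $0\le j<J$, $$h_t(j,x,a)=h_0(j,x,a)+\int_0^t\sum_{(x',a')}\pi_j(x',a')A^{(j)}_{x,a,x',a'}\Big(r(j,x',a')+\gamma\sum_z\max_{a''}h_s(j+1,z,a'')p(z\mid x',a')-h_s(j,x',a')\Big)ds,$$ with $h_t(J,x,a)=r(J,x)$ and $$A^{(j)}_{x,a,x',a'}=\alpha\langle\sigma(w\cdot(x',a'))\sigma(w\cdot(x,a)),\mu_0\rangle+\alpha\langle c_j^2\,\sigma'(w\cdot(x',a'))\sigma'(w\cdot(x,a))\,(x',a')\cdot(x,a),\mu_0\rangle,$$ has a unique continuous solution on $[0,\infty)$. Let $h$ be the solution with $h_0=\mathcal G$ and let $\mu_t=\mu_0$ for all $t$. Then for every $T>0$ the process $(\mu^N_t,h^N_t)_{0\le t\le T}$ converges in distribution in $D_E([0,T])$ to $(\mu_t,h_t)_{0\le t\le T}$ as $N\to\infty$. If, furthermore, $\sigma$ is non-polynomial and slowly increasing ($\lim_{u\to\infty}\sigma(u)/u^b=0$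 for every $b>0$), for some $B$ one has $C_0^i\in[-B,B]^J$ almost surely and $\mu_0(\Gamma)>0$ for every measurable $\Gamma\subset[-B,B]^J\times\mathbb R^d$ of positive Lebesgue measure, and the points $(x,a)\in\mathcal X\times\mathcal A$ are in distinct directions (they are non-zero and no two of them are parallel), then for every $\gamma\in(0,1]$ and every initial value $$\lim_{t\to\infty}\ \sup_{0\le j\le J,\ x,\ a}|h_t(j,x,a)-V(j,x,a)|=0.$$ -/

import Mathlib

open MeasureTheory ProbabilityTheory Filter Topology Set
open scoped ENNReal NNReal

namespace QLearn

noncomputable section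

/-! ### Skorokhod space -/

/-- A path on `[0,T]` is càdlàg: right-continuous with left limits. -/
def IsCadlag {T : ℝ} {E : Type*} [TopologicalSpace E] (f : Icc (0 : ℝ) T → E) : Prop :=
  ∀ t, ContinuousWithinAt f (Ici t) t ∧ ∃ l, Tendsto f (𝓝[<] t) (𝓝 l)

/-- The Skorokhod space `D_E([0,T])` of càdlàg paths `[0,T] → E`. -/
def Skorokhod (T : ℝ) (E : Type*) [TopologicalSpace E] : Type _ :=
  {f : Icc (0 : ℝ) T → E // IsCadlag f}

instance {T : ℝ} {E : Type*} [TopologicalSpace E] :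
    CoeFun (Skorokhod T E) (fun _ => Icc (0 : ℝ) T → E) :=
  ⟨Subtype.val⟩

/-- The cost of matching `f` with `g` through the time change `l`. -/
def skorokhodCost {T : ℝ} {E : Type*} [PseudoEMetricSpace E] (f g : Icc (0 : ℝ) T → E)
    (l : Icc (0 : ℝ) T ≃o Icc (0 : ℝ) T) : ℝ≥0∞ :=
  max (⨆ t, edist (l t) t) (⨆ t, edist (f (l t)) (g t))

/-- Skorokhod's `J₁` distance: the infimum, over all increasing bijections `l` of `[0,T]`, of
`max (sup |l t - t|) (sup d(f (l t), g t))`. -/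
instance {T : ℝ} {E : Type*} [PseudoEMetricSpace E] : PseudoEMetricSpace (Skorokhod T E) where
  edist f g := ⨅ l : Icc (0 : ℝ) T ≃o Icc (0 : ℝ) T, skorokhodCost f g l
  edist_self f := by
    refine le_antisymm (iInf_le_of_le (OrderIso.refl _) ?_) bot_le
    simp [skorokhodCost]
  edist_comm := by
    have key : ∀ (f g : Skorokhod T E) (l : Icc (0 : ℝ) T ≃o Icc (0 : ℝ) T),
        skorokhodCost g f l.symm ≤ skorokhodCost f g l := by
      intro f g l
      refine max_le ?_ ?_
      · refine le_trans (iSup_le fun t => ?_) (le_max_left _ _)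
        refine le_trans ?_ (le_iSup (fun t => edist (l t) t) (l.symm t))
        simp [edist_comm]
      · refine le_trans (iSup_le fun t => ?_) (le_max_right _ _)
        refine le_trans ?_ (le_iSup (fun t => edist (f.1 (l t)) (g.1 t)) (l.symm t))
        simp [edist_comm]
    intro f g
    refine le_antisymm (le_iInf fun l => ?_) (le_iInf fun l => ?_)
    · exact iInf_le_of_le l.symm (key g f l)
    · exact iInf_le_of_le l.symm (key f g l)
  edist_triangle f g h := by
    refine ENNReal.le_iInf_add_iInf fun l m => ?_
    refine iInf_le_of_le (m.trans l) (max_le (iSup_le fun t => ?_) (iSup_le fun t => ?_))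
    · refine (edist_triangle (l (m t)) (m t) t).trans (add_le_add ?_ ?_)
      · exact (le_iSup (fun t => edist (l t) t) (m t)).trans (le_max_left _ _)
      · exact (le_iSup (fun t => edist (m t) t) t).trans (le_max_left _ _)
    · refine (edist_triangle (f.1 (l (m t))) (g.1 (m t)) (h.1 t)).trans (add_le_add ?_ ?_)
      · exact (le_iSup (fun t => edist (f.1 (l t)) (g.1 t)) (m t)).trans (le_max_right _ _)
      · exact (le_iSup (fun t => edist (g.1 (m t)) (h.1 t)) t).trans (le_max_right _ _)

/-- Random elements of `D_E([0,T])` are taken with respect to its Borel σ-algebra. -/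
instance {T : ℝ} {E : Type*} [PseudoEMetricSpace E] : MeasurableSpace (Skorokhod T E) :=
  borel _

instance {T : ℝ} {E : Type*} [PseudoEMetricSpace E] : BorelSpace (Skorokhod T E) :=
  ⟨rfl⟩

/-- A sequence `e`, read on the time scale `t ↦ ⌊N t⌋`, is a càdlàg path. -/
theorem isCadlag_comp_floor {T : ℝ} {E : Type*} [TopologicalSpace E] (e : ℕ → E) (N : ℕ) :
    IsCadlag (fun t : Icc (0 : ℝ) T => e ⌊(N : ℝ) * t⌋₊) := by
  intro t
  have ht : 0 ≤ (N : ℝ) * t := mul_nonneg (Nat.cast_nonneg _) t.2.1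
  have hc : Continuous fun s : Icc (0 : ℝ) T => (N : ℝ) * s := by fun_prop
  constructor
  · have h1 : ∀ᶠ s : Icc (0 : ℝ) T in 𝓝[≥] t,
        e ⌊(N : ℝ) * s⌋₊ = e ⌊(N : ℝ) * t⌋₊ := by
      have h2 : ∀ᶠ s : Icc (0 : ℝ) T in 𝓝[≥] t, (N : ℝ) * s < ⌊(N : ℝ) * t⌋₊ + 1 :=
        (hc.continuousAt.eventually_lt_const (Nat.lt_floor_add_one _)).filter_mono
          nhdsWithin_le_nhds
      filter_upwards [h2, self_mem_nhdsWithin] with s hs hts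
      have hle : (N : ℝ) * t ≤ (N : ℝ) * s :=
        mul_le_mul_of_nonneg_left (Subtype.coe_le_coe.2 hts) (Nat.cast_nonneg _)
      congr 1
      exact (Nat.floor_eq_iff (ht.trans hle)).2 ⟨(Nat.floor_le ht).trans hle, hs⟩
    exact (tendsto_const_nhds (x := e ⌊(N : ℝ) * t⌋₊)).congr' (h1.mono fun s hs => hs.symm)
  · refine ⟨e (⌈(N : ℝ) * t⌉₊ - 1), ?_⟩
    have h1 : ∀ᶠ s : Icc (0 : ℝ) T in 𝓝[<] t,
        e ⌊(N : ℝ) * s⌋₊ = e (⌈(N : ℝ) * t⌉₊ - 1) := by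
      rcases Nat.eq_zero_or_pos N with hN | hN
      · subst hN
        simp
      have hN' : (0 : ℝ) < N := Nat.cast_pos.2 hN
      rcases ht.eq_or_lt with h0 | h0
      · filter_upwards [self_mem_nhdsWithin] with s hs
        exfalso
        have : (N : ℝ) * s < N * t := mul_lt_mul_of_pos_left (Subtype.coe_lt_coe.2 hs) hN'
        have : 0 ≤ (N : ℝ) * s := mul_nonneg hN'.le s.2.1
        linarith
      · have hpos : 0 < ⌈(N : ℝ) * t⌉₊ := Nat.ceil_pos.2 h0
        have hcast : ((⌈(N : ℝ) * t⌉₊ - 1 : ℕ) : ℝ) = (⌈(N : ℝ) * t⌉₊ : ℝ) - 1 := by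
          rw [Nat.cast_sub hpos]
          simp
        have hlt : (⌈(N : ℝ) * t⌉₊ : ℝ) - 1 < (N : ℝ) * t := by
          have := Nat.ceil_lt_add_one h0.le
          linarith
        have h2 : ∀ᶠ s : Icc (0 : ℝ) T in 𝓝[<] t,
            (⌈(N : ℝ) * t⌉₊ : ℝ) - 1 < (N : ℝ) * s :=
          (hc.continuousAt.eventually_const_lt hlt).filter_mono nhdsWithin_le_nhds
        filter_upwards [h2, self_mem_nhdsWithin] with s hs hst
        have hst' : (N : ℝ) * s < N * t :=
          mul_lt_mul_of_pos_left (Subtype.coe_lt_coe.2 hst) hN'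
        congr 1
        refine (Nat.floor_eq_iff (mul_nonneg hN'.le s.2.1)).2 ⟨?_, ?_⟩
        · rw [hcast]
          exact hs.le
        · rw [hcast]
          have := Nat.le_ceil ((N : ℝ) * t)
          linarith
    exact (tendsto_const_nhds (x := e (⌈(N : ℝ) * t⌉₊ - 1))).congr' (h1.mono fun s hs => hs.symm)

/-! ### The finite-horizon decision problem -/

/-- A Markov decision problem with horizon `J`, finite state space in `ℝ^dx`, finite action space
in `ℝ^da`, homogeneous transition function `p(z | x, a) = trans x a z`, rewards `r(j,x,a)` for
`j < J` and `r(J,x) = terminal x`, discount factor `γ ∈ (0,1]`, and a law `init` of the initial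
state. -/
structure DecisionProblem (dx da J : ℕ) where
  states : Finset (EuclideanSpace ℝ (Fin dx))
  actions : Finset (EuclideanSpace ℝ (Fin da))
  states_nonempty : states.Nonempty
  actions_nonempty : actions.Nonempty
  trans : states → actions → states → ℝ
  trans_nonneg : ∀ x a z, 0 ≤ trans x a z
  trans_sum : ∀ x a, ∑ z, trans x a z = 1
  reward : Fin J → states → actions → ℝ
  terminal : states → ℝ
  γ : ℝ
  γ_pos : 0 < γ
  γ_le_one : γ ≤ 1
  init : states → ℝ
  init_nonneg : ∀ x, 0 ≤ init x
  init_sum : ∑ x, init x = 1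

/-- The parameters of one hidden unit: output weights `c ∈ ℝ^J` (one for each time index) and a
hidden weight `w ∈ ℝ^(dx+da)`, shared by all time indices. -/
abbrev Param (dx da J : ℕ) : Type := (Fin J → ℝ) × EuclideanSpace ℝ (Fin dx ⊕ Fin da)

namespace DecisionProblem

variable {dx da J : ℕ} (M : DecisionProblem dx da J)

instance : Nonempty M.states := M.states_nonempty.to_subtype

instance : Nonempty M.actions := M.actions_nonempty.to_subtype

/-- Values `h(j,x,a)` at the times `j = 0, …, J-1`. -/
abbrev QValues : Type := Fin J → M.states → M.actions → ℝ

/-- Values `h(j,x,a)`, extended to `j = J` by `h(J,x,a) = r(J,x)`. -/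
def withTerminal (h : M.QValues) : Fin (J + 1) → M.states → M.actions → ℝ :=
  Fin.snoc (α := fun _ => M.states → M.actions → ℝ) h (fun x _ => M.terminal x)

/-- The vector `(x,a) ∈ ℝ^(dx+da)`, the concatenation of `x` and `a`. -/
def pt (x : M.states) (a : M.actions) : EuclideanSpace ℝ (Fin dx ⊕ Fin da) :=
  WithLp.toLp 2 (Sum.elim x.1 a.1)

/-- `V : {0,…,J} × 𝒳 × 𝒜 → ℝ` solves the Bellman equation. -/
def IsBellmanSolution (V : Fin (J + 1) → M.states → M.actions → ℝ) : Prop :=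
  (∀ (j : Fin J) x a, V j.castSucc x a
      = M.reward j x a + M.γ * ∑ z, (⨆ a', V j.succ z a') * M.trans x a z) ∧
  ∀ x a, V (Fin.last J) x a = M.terminal x

/-- The solution of the Bellman equation, by backward recursion. -/
def bellmanValue (j : Fin (J + 1)) : M.states → M.actions → ℝ :=
  Fin.reverseInduction (motive := fun _ => M.states → M.actions → ℝ)
    (fun x _ => M.terminal x)
    (fun j V x a => M.reward j x a + M.γ * ∑ z, (⨆ a', V z a') * M.trans x a z) j

theorem isBellmanSolution_iff (V : Fin (J + 1) → M.states → M.actions → ℝ) :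
    M.IsBellmanSolution V ↔ V = M.bellmanValue := by
  constructor
  · rintro ⟨h1, h2⟩
    funext j
    induction j using Fin.reverseInduction with
    | last =>
      funext x a
      simp [h2, bellmanValue]
    | cast j ih =>
      funext x a
      rw [h1, ih]
      simp [bellmanValue]
  · rintro rfl
    exact ⟨fun j x a => by simp [bellmanValue], fun x a => by simp [bellmanValue]⟩

/-- The law of the state at time `j` when the actions are uniform on `𝒜`. -/
def stateProb : ℕ → M.states → ℝ
  | 0 => M.init
  | j + 1 => fun z => ∑ x, ∑ a, stateProb j x * (1 / (M.actions.card : ℝ)) * M.trans x a z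

/-- `π_j(x,a)`: the law of (state, action) at time `j` when the actions are uniform on `𝒜`. -/
def visitProb (j : ℕ) (x : M.states) (a : M.actions) : ℝ :=
  M.stateProb j x * (1 / (M.actions.card : ℝ))

/-! ### The Q-network and its training -/

/-- The Q-network `Q^N(j,x,a;θ) = N^{-1/2} ∑ᵢ C^{i,j} σ(Wⁱ · (x,a))`, for `j < J`. -/
def qNet (σ : ℝ → ℝ) {N : ℕ} (θ : Fin N → Param dx da J) : M.QValues := fun j x a =>
  (1 / √(N : ℝ)) * ∑ i, (θ i).1 j * σ (inner ℝ (θ i).2 (M.pt x a))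

/-- `r_j + γ max_{a'} Q(j+1,x_{j+1},a') - Q(j,x_j,a_j)` along an episode
`x_0, a_0, …, a_{J-1}, x_J`. -/
def tdError (q : M.QValues) (s : Fin (J + 1) → M.states) (act : Fin J → M.actions)
    (j : Fin J) : ℝ :=
  M.reward j (s j.castSucc) (act j) + M.γ * (⨆ a', M.withTerminal q j.succ (s j.succ) a')
    - q j (s j.castSucc) (act j)

/-- One Q-learning update with learning rate `lr`, using one episode. -/
def step (σ : ℝ → ℝ) (lr : ℝ) {N : ℕ} (s : Fin (J + 1) → M.states) (act : Fin J → M.actions)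
    (θ : Fin N → Param dx da J) : Fin N → Param dx da J := fun i =>
  (fun j => (θ i).1 j + lr / √(N : ℝ) * M.tdError (M.qNet σ θ) s act j
      * σ (inner ℝ (θ i).2 (M.pt (s j.castSucc) (act j))),
   (θ i).2 + (lr / √(N : ℝ)) • ∑ j, (M.tdError (M.qNet σ θ) s act j * (θ i).1 j
      * deriv σ (inner ℝ (θ i).2 (M.pt (s j.castSucc) (act j)))) • M.pt (s j.castSucc) (act j))

/-- The parameters `θ_k` after `k` updates; the `k`-th update uses the `k`-th episode. -/
def train (σ : ℝ → ℝ) (lr : ℝ) {N : ℕ} (s : ℕ → Fin (J + 1) → M.states)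
    (act : ℕ → Fin J → M.actions) (θ₀ : Fin N → Param dx da J) : ℕ → Fin N → Param dx da J
  | 0 => θ₀
  | k + 1 => M.step σ lr (s k) (act k) (train σ lr s act θ₀ k)

/-- The random input of the algorithm: the initial parameters `θ₀ i = (C₀ⁱ, W₀ⁱ)` are i.i.d. with
law `μ₀`, the episodes `(s k, act k)` are i.i.d. with `x_{k,0} ∼ init`, `a_{k,j}` uniform on `𝒜`
and `x_{k,j+1} ∼ p(· | x_{k,j}, a_{k,j})`, and episodes and initial parameters are independent. -/
structure IsTrainingInput {Ω : Type*} [MeasurableSpace Ω] (P : Measure Ω)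
    (μ₀ : ProbabilityMeasure (Param dx da J)) (θ₀ : ℕ → Ω → Param dx da J)
    (s : ℕ → Ω → Fin (J + 1) → M.states) (act : ℕ → Ω → Fin J → M.actions) : Prop where
  measurable_param : ∀ i, Measurable (θ₀ i)
  measurable_states : ∀ k, Measurable (s k)
  measurable_actions : ∀ k, Measurable (act k)
  law_param : ∀ i, P.map (θ₀ i) = μ₀
  law_episode : ∀ k (y : Fin (J + 1) → M.states) (b : Fin J → M.actions),
    P {ω | s k ω = y ∧ act k ω = b} = ENNReal.ofReal (M.init (y 0) *
      ∏ j : Fin J, 1 / (M.actions.card : ℝ) * M.trans (y j.castSucc) (b j) (y j.succ))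
  indep_param : iIndepFun θ₀ P
  indep_episode : iIndepFun (fun k ω => (s k ω, act k ω)) P
  indep : IndepFun (fun ω i => θ₀ i ω) (fun ω k => (s k ω, act k ω)) P

end DecisionProblem

/-- The empirical measure `N⁻¹ ∑ᵢ δ_{θ i}`. -/
def empirical {S : Type*} [MeasurableSpace S] {N : ℕ} [NeZero N] (θ : Fin N → S) :
    ProbabilityMeasure S :=
  ⟨(N : ℝ≥0∞)⁻¹ • ∑ i, Measure.dirac (θ i), ⟨by
    simp [ENNReal.inv_mul_cancel (Nat.cast_ne_zero.2 (NeZero.ne N)) (ENNReal.natCast_ne_top N)]⟩⟩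

namespace DecisionProblem

variable {dx da J : ℕ} (M : DecisionProblem dx da J)

/-- The space `E = 𝓜(ℝ^(J+dx+da)) × ℝ^(J × 𝒳 × 𝒜)`. The probability measures carry the
Lévy-Prokhorov metric, which metrizes weak convergence. -/
abbrev PathState : Type :=
  LevyProkhorov (ProbabilityMeasure (Param dx da J)) × M.QValues

/-- The rescaled process `t ↦ (μ_t^N, h_t^N)` on `[0,T]`, a random element of `D_E([0,T])`:
`μ_t^N` is the empirical measure of the parameters, and `h_t^N` the Q-network, after `⌊N t⌋`
updates with learning rate `α / N`. -/
def scaledPath {Ω : Type*} (σ : ℝ → ℝ) (α T : ℝ) (θ₀ : ℕ → Ω → Param dx da J)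
    (s : ℕ → Ω → Fin (J + 1) → M.states) (act : ℕ → Ω → Fin J → M.actions) (N : ℕ) [NeZero N]
    (ω : Ω) : Skorokhod T M.PathState :=
  ⟨fun t =>
    (fun θ : Fin N → Param dx da J => (LevyProkhorov.ofMeasure (empirical θ), M.qNet σ θ))
      (M.train σ (α / N) (fun k => s k ω) (fun k => act k ω) (fun i => θ₀ i ω) ⌊(N : ℝ) * t⌋₊),
    isCadlag_comp_floor (fun k =>
      (fun θ : Fin N → Param dx da J => (LevyProkhorov.ofMeasure (empirical θ), M.qNet σ θ))
        (M.train σ (α / N) (fun k => s k ω) (fun k => act k ω) (fun i => θ₀ i ω) k)) N⟩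

/-! ### The limit equation -/

/-- The tensor `A`, which depends on the time index through `c_j`:
`A_{x,a,x',a'} = α ⟨σ(w·(x',a')) σ(w·(x,a)), μ₀⟩
  + α ⟨c_j² σ'(w·(x',a')) σ'(w·(x,a)) (x',a')·(x,a), μ₀⟩`. -/
def tensorA (σ : ℝ → ℝ) (α : ℝ) (μ₀ : ProbabilityMeasure (Param dx da J)) (j : Fin J)
    (x : M.states) (a : M.actions) (x' : M.states) (a' : M.actions) : ℝ :=
  α * ∫ θ : Param dx da J, σ (inner ℝ θ.2 (M.pt x' a')) * σ (inner ℝ θ.2 (M.pt x a))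
      ∂(μ₀ : Measure (Param dx da J))
  + α * ∫ θ : Param dx da J, θ.1 j ^ 2 * deriv σ (inner ℝ θ.2 (M.pt x' a'))
      * deriv σ (inner ℝ θ.2 (M.pt x a)) * inner ℝ (M.pt x' a') (M.pt x a)
      ∂(μ₀ : Measure (Param dx da J))

/-- `h : [0,∞) → ℝ^(J × 𝒳 × 𝒜)` is a (continuous) solution of the limit ODE, in integral form,
with initial value `g`. -/
structure IsLimitSolution (σ : ℝ → ℝ) (α : ℝ) (μ₀ : ProbabilityMeasure (Param dx da J))
    (g : M.QValues) (h : ℝ → M.QValues) : Prop where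
  continuousOn : ContinuousOn h (Ici 0)
  integral_eq : ∀ t, 0 ≤ t → ∀ (j : Fin J) x a, h t j x a = g j x a +
    ∫ u in (0 : ℝ)..t, ∑ x', ∑ a', M.visitProb j x' a' * M.tensorA σ α μ₀ j x a x' a' *
      (M.reward j x' a' + M.γ * (∑ z, (⨆ a'', M.withTerminal (h u) j.succ z a'') * M.trans x' a' z)
        - h u j x' a')

end DecisionProblem

/-! ### Assumptions -/

/-- `σ ∈ C²_b(ℝ)`: twice continuously differentiable, bounded with its first two derivatives. -/
def IsC2b (σ : ℝ → ℝ) : Prop :=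
  ContDiff ℝ 2 σ ∧ ∃ B, ∀ u, |σ u| ≤ B ∧ |deriv σ u| ≤ B ∧ |deriv (deriv σ) u| ≤ B

/-- The law `μ₀` of `(C^0,…,C^{J-1},W)` is absolutely continuous; `C^0,…,C^{J-1},W` are
independent and mean-zero, `C` is bounded and `W` has a finite first moment. -/
structure InitAssumption {dx da J : ℕ} (μ₀ : ProbabilityMeasure (Param dx da J)) : Prop where
  absolutelyContinuous : (μ₀ : Measure (Param dx da J)) ≪ volume
  indep_output : iIndepFun (fun (j : Fin J) (θ : Param dx da J) => θ.1 j) (μ₀ : Measure _)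
  indep_hidden : IndepFun (fun θ : Param dx da J => θ.1) (fun θ => θ.2) (μ₀ : Measure _)
  bounded : ∃ B, ∀ᵐ θ : Param dx da J ∂(μ₀ : Measure _), ∀ j, |θ.1 j| ≤ B
  integrable : Integrable (fun θ : Param dx da J => ‖θ.2‖) (μ₀ : Measure _)
  mean_output : ∀ j, ∫ θ : Param dx da J, θ.1 j ∂(μ₀ : Measure _) = 0
  mean_hidden : ∫ θ : Param dx da J, θ.2 ∂(μ₀ : Measure _) = 0

/-- The additional assumptions for positive definiteness: `σ` is non-polynomial and slowly
increasing, `C ∈ [-B,B]^J`, `μ₀` charges every subset of `[-B,B]^J × ℝ^(dx+da)` of positive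
Lebesgue measure, and the points `(x,a)` lie in distinct directions (they are non-zero and no two
of them are parallel). -/
structure PosDefAssumption {dx da J : ℕ} (M : DecisionProblem dx da J) (σ : ℝ → ℝ)
    (μ₀ : ProbabilityMeasure (Param dx da J)) : Prop where
  not_polynomial : ¬ ∃ p : Polynomial ℝ, ∀ u, σ u = p.eval u
  slowly_increasing : ∀ b : ℝ, 0 < b → Tendsto (fun u => σ u / u ^ b) atTop (𝓝 0)
  full_support : ∃ B : ℝ, (∀ᵐ θ : Param dx da J ∂(μ₀ : Measure _), ∀ j, |θ.1 j| ≤ B) ∧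
    ∀ Γ : Set (Param dx da J), MeasurableSet Γ → (∀ θ ∈ Γ, ∀ j, |θ.1 j| ≤ B) →
      0 < volume Γ → 0 < (μ₀ : Measure _) Γ
  point_ne_zero : ∀ x a, M.pt x a ≠ 0
  distinct_directions : ∀ x a x' a', (x, a) ≠ (x', a') →
    LinearIndependent ℝ ![M.pt x a, M.pt x' a']

end

end QLearn

/-! At time zero the network is a sum of i.i.d. centred vectors divided by `√N`, so its finitely
many values satisfy the central limit theorem and become Gaussian (`exists_gaussian_limit`).

One update moves each hidden unit by `O(N^(-3/2))` (`norm_step_sub_le`) and the network by `O(1/N)`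
(`norm_qNet_sub_le`). Over the `O(N)` updates of `[0,T]` a unit therefore travels only
`O(N^(-1/2))`. Two things follow. The empirical measure stays near its initial value, which tends to
`μ₀` by the law of large numbers (`ae_tendsto_empirical`, `edist_empirical_le`). The averages of
`unitKernel` that drive the network stay near their `μ₀`-means (`exists_trajectory_bound`). The time
levels share the hidden weights, but the mean of a cross term vanishes because distinct output
weights are independent and centred, so only the tensor `A` survives (`integral_unitKernel`).

Hence the network is an Euler scheme of step `1/N` for a Lipschitz vector field, perturbed by a
small systematic error and by the sampling noise of the episodes. The noise of a single episode is
not small, but its partial sums are `o(N)` uniformly over `k ≤ N T` (`tendsto_measure_noise`): noise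
terms are orthogonal, and a maximal inequality follows from the second moments because the
increments are bounded. `norm_euler_sub_flow_le` then compares the network with the flow.

Convergence in distribution is obtained by coupling, without a tightness argument in the Skorokhod
space. The trained process is close, in probability and uniformly in time, to the limit flow started
from the random initial network of the same size `N`. That flow depends continuously on its starting
point, so it converges in law by the continuous mapping theorem.

For large times one argues backwards in `j`. Once level `j + 1` has converged, the error at level
`j` solves a linear equation with vanishing forcing, whose matrix is the product of the positive
definite `A` and a positive diagonal. The quadratic form of `A⁻¹` is a Lyapunov function
(`tendsto_zero_of_posDef`). Positive definiteness (`posDef_tensorA`) rests on the linear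
independence of bounded non-constant ridge functions in distinct directions
(`ridge_constant_of_sum_eq_zero`). -/

namespace QLearn

/-! ### Global flow of a Lipschitz vector field -/

section Flow

variable {V : Type*} [NormedAddCommGroup V] [NormedSpace ℝ V] {F : V → V} {K : ℝ≥0}

theorem integral_exp_mul_le (K' l s : ℝ) (hl : 0 < l) (hK : 0 ≤ K') :
    ∫ r in (0 : ℝ)..s, K' * Real.exp (l * r) ≤ K' / l * Real.exp (l * s) := by
  have h : ∀ r ∈ uIcc 0 s, HasDerivAt (fun r => K' / l * Real.exp (l * r))
      (K' * Real.exp (l * r)) r := by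
    intro r _
    have h1 := (((hasDerivAt_id r).const_mul l).exp).const_mul (K' / l)
    refine h1.congr_deriv ?_
    simp only [id, mul_one]
    field_simp
  rw [intervalIntegral.integral_eq_sub_of_hasDerivAt h
    ((Continuous.intervalIntegrable (by fun_prop) _ _))]
  have : 0 ≤ K' / l * Real.exp (l * 0) := by positivity
  linarith

/-- Picard iteration with an exponential weight: in the unknown `u t = exp (-l t) • h t` with `l = K
+ 1`, the integral operator is a contraction of ratio `K / (K + 1)` on bounded continuous functions,
so one fixed point covers all times and no local solutions have to be glued. -/
theorem exists_global_solution [CompleteSpace V] (hF : LipschitzWith K F) (g : V) :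
    ∃ h : ℝ → V, Continuous h ∧ ∀ t, 0 ≤ t → h t = g + ∫ u in (0 : ℝ)..t, F (h u) := by
  set l : ℝ := K + 1 with hl
  have hlpos : 0 < l := by positivity
  have hFc := hF.continuous
  -- `max · 0` stops the weight from varying at negative times, so that the operator acts on bounded
  -- continuous functions on all of `ℝ`; only times `≥ 0` matter.
  let w : (ℝ → V) → ℝ → V := fun u r => F (Real.exp (l * max r 0) • u r)
  have hw : ∀ u : ℝ → V, Continuous u → Continuous (w u) := fun u hu => by
    simp only [w]; fun_prop
  let T : (ℝ → V) → ℝ → V := fun u t =>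
    Real.exp (-(l * max t 0)) • (g + ∫ r in (0 : ℝ)..(max t 0), w u r)
  have hT : ∀ u : ℝ → V, Continuous u → Continuous (T u) := fun u hu => by
    have h1 : Continuous fun t : ℝ => ∫ r in (0 : ℝ)..t, w u r :=
      intervalIntegral.continuous_primitive (fun a b => (hw u hu).intervalIntegrable a b) 0
    have h2 : Continuous fun t : ℝ => ∫ r in (0 : ℝ)..(max t 0), w u r :=
      h1.comp (continuous_id.max continuous_const)
    simp only [T]
    fun_prop
  have key : ∀ (f : ℝ → V) (C s : ℝ), 0 ≤ C → 0 ≤ s → (∀ r, 0 ≤ r → ‖f r‖ ≤ C * Real.exp (l * r)) →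
      ‖∫ r in (0 : ℝ)..s, f r‖ ≤ C / l * Real.exp (l * s) := by
    intro f C s hC hs hf
    refine (intervalIntegral.norm_integral_le_of_norm_le hs (g := fun r => C * Real.exp (l * r))
      (ae_of_all _ fun r hr => hf r hr.1.le) ?_).trans (integral_exp_mul_le C l s hlpos hC)
    exact Continuous.intervalIntegrable (by fun_prop) _ _
  have hTb : ∀ u : BoundedContinuousFunction ℝ V, ∀ t,
      ‖T u t‖ ≤ ‖g‖ + (‖F 0‖ + K * ‖u‖) / l := by
    intro u t
    have hs : 0 ≤ max t 0 := le_max_right _ _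
    set s := max t 0
    have h1 := key (w u) (‖F 0‖ + K * ‖u‖) s (by positivity) hs (fun r hr => by
      have h2 := hF.dist_le_mul (Real.exp (l * max r 0) • u r) 0
      rw [dist_zero_right, dist_eq_norm, norm_smul, Real.norm_of_nonneg (Real.exp_pos _).le,
        max_eq_left hr] at h2
      have h3 : ‖w u r‖ ≤ ‖F (Real.exp (l * r) • u r) - F 0‖ + ‖F 0‖ := by
        simp only [w, max_eq_left hr]
        simpa using norm_add_le (F (Real.exp (l * r) • u r) - F 0) (F 0)
      have h4 : 1 ≤ Real.exp (l * r) := Real.one_le_exp (by positivity)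
      have h5 : ‖u r‖ ≤ ‖u‖ := u.norm_coe_le_norm r
      calc ‖w u r‖ ≤ K * (Real.exp (l * r) * ‖u r‖) + ‖F 0‖ := by linarith
        _ ≤ K * (Real.exp (l * r) * ‖u‖) + ‖F 0‖ * Real.exp (l * r) := by
            gcongr
            exact le_mul_of_one_le_right (norm_nonneg _) h4
        _ = _ := by ring)
    simp only [T]
    rw [norm_smul, Real.norm_of_nonneg (Real.exp_pos _).le, Real.exp_neg]
    have h4 : 1 ≤ Real.exp (l * s) := Real.one_le_exp (by positivity)
    rw [inv_mul_le_iff₀ (Real.exp_pos _)]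
    calc _ ≤ ‖g‖ + (‖F 0‖ + K * ‖u‖) / l * Real.exp (l * s) :=
          (norm_add_le _ _).trans (by gcongr)
      _ ≤ Real.exp (l * s) * ‖g‖ + (‖F 0‖ + K * ‖u‖) / l * Real.exp (l * s) := by
          gcongr
          exact le_mul_of_one_le_left (norm_nonneg _) h4
      _ = _ := by ring
  let Φ : BoundedContinuousFunction ℝ V → BoundedContinuousFunction ℝ V := fun u =>
    BoundedContinuousFunction.ofNormedAddCommGroup (T u) (hT u u.continuous) _ (hTb u)
  have hc : ContractingWith (K / (K + 1)) Φ := by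
    refine ⟨by rw [div_lt_one (by positivity)]; exact lt_add_one K,
      LipschitzWith.of_dist_le_mul fun u v => ?_⟩
    refine (BoundedContinuousFunction.dist_le (by positivity)).2 fun t => ?_
    have hs : 0 ≤ max t 0 := le_max_right _ _
    change dist (T u t) (T v t) ≤ _
    rw [dist_eq_norm]
    simp only [T]
    rw [← smul_sub, add_sub_add_left_eq_sub, ← intervalIntegral.integral_sub
      ((hw u u.continuous).intervalIntegrable _ _) ((hw v v.continuous).intervalIntegrable _ _),
      norm_smul, Real.norm_of_nonneg (Real.exp_pos _).le, Real.exp_neg,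
      inv_mul_le_iff₀ (Real.exp_pos _)]
    have h1 := key (fun r => w u r - w v r) (K * dist u v) (max t 0) (by positivity) hs
      (fun r hr => by
        have h2 := hF.dist_le_mul (Real.exp (l * max r 0) • u r) (Real.exp (l * max r 0) • v r)
        rw [dist_smul₀, Real.norm_of_nonneg (Real.exp_pos _).le, max_eq_left hr] at h2
        simp only [w, max_eq_left hr]
        rw [← dist_eq_norm]
        calc _ ≤ _ := h2
          _ ≤ K * (Real.exp (l * r) * dist u v) := by
              gcongr
              exact BoundedContinuousFunction.dist_coe_le_dist r
          _ = _ := by ring)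
    refine h1.trans (le_of_eq ?_)
    push_cast
    rw [hl]
    ring
  have : Nonempty (BoundedContinuousFunction ℝ V) := ⟨0⟩
  obtain ⟨u, hu⟩ : ∃ u, Φ u = u := ⟨hc.fixedPoint, hc.fixedPoint_isFixedPt⟩
  have hu' : ∀ t, T u t = u t := fun t => by
    conv_rhs => rw [← hu]
    rfl
  refine ⟨fun t => Real.exp (l * max t 0) • u t, by fun_prop, fun t ht => ?_⟩
  simp only
  rw [← hu' t]
  simp only [T]
  rw [smul_smul, ← Real.exp_add]
  simp [max_eq_left ht, w]

theorem hasDerivWithinAt_of_integral_eq [CompleteSpace V] (hF : Continuous F) {g : V} {h : ℝ → V}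
    (hc : ContinuousOn h (Ici 0))
    (hi : ∀ t, 0 ≤ t → h t = g + ∫ u in (0 : ℝ)..t, F (h u)) {t : ℝ} (ht : 0 ≤ t) :
    HasDerivWithinAt h (F (h t)) (Ici t) t := by
  -- `h` is controlled only on `[0,∞)`. Freezing it at negative times gives a continuous integrand
  -- on `ℝ`, so the fundamental theorem of calculus applies at `t = 0` as well.
  have hpc : Continuous fun u => F (h (max u 0)) :=
    hF.comp (hc.comp_continuous (by fun_prop) fun u => mem_Ici.2 (le_max_right u 0))
  have h1 : HasDerivAt (fun s => g + ∫ u in (0 : ℝ)..s, F (h (max u 0))) (F (h (max t 0))) t :=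
    (intervalIntegral.integral_hasDerivAt_right (hpc.intervalIntegrable _ _)
      hpc.aestronglyMeasurable.stronglyMeasurableAtFilter hpc.continuousAt).const_add g
  have h2 : ∀ s, 0 ≤ s → h s = g + ∫ u in (0 : ℝ)..s, F (h (max u 0)) := by
    intro s hs
    rw [hi s hs]
    congr 1
    refine intervalIntegral.integral_congr fun u hu => ?_
    rw [uIcc_of_le hs] at hu
    simp [max_eq_left hu.1]
  rw [max_eq_left ht] at h1
  exact h1.hasDerivWithinAt.congr (fun s hs => h2 s (ht.trans hs)) (h2 t ht)

/-- Grönwall. With `g = g'` this is uniqueness; in general it makes the limit path a Lipschitz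
function of its initial value, as the continuous mapping theorem requires. -/
theorem dist_le_of_integral_eq [CompleteSpace V] (hF : LipschitzWith K F) {g g' : V} {h h' : ℝ → V}
    (hc : ContinuousOn h (Ici 0))
    (hi : ∀ t, 0 ≤ t → h t = g + ∫ u in (0 : ℝ)..t, F (h u))
    (hc' : ContinuousOn h' (Ici 0))
    (hi' : ∀ t, 0 ≤ t → h' t = g' + ∫ u in (0 : ℝ)..t, F (h' u)) {t : ℝ} (ht : 0 ≤ t) :
    dist (h t) (h' t) ≤ dist g g' * Real.exp (K * t) := by
  have h0 : h 0 = g := by simpa using hi 0 le_rfl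
  have h0' : h' 0 = g' := by simpa using hi' 0 le_rfl
  have := dist_le_of_trajectories_ODE (v := fun _ => F) (K := K) (f := h) (g := h') (a := 0)
    (b := t) (δ := dist g g') (fun _ => hF) (hc.mono Icc_subset_Ici_self)
    (fun s hs => hasDerivWithinAt_of_integral_eq hF.continuous hc hi hs.1)
    (hc'.mono Icc_subset_Ici_self)
    (fun s hs => hasDerivWithinAt_of_integral_eq hF.continuous hc' hi' hs.1)
    (by rw [h0, h0']) t ⟨ht, le_rfl⟩
  simpa using this

/-- Growth of a solution. -/
theorem norm_le_of_integral_eq [CompleteSpace V] (hF : LipschitzWith K F) {g : V} {h : ℝ → V}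
    (hc : ContinuousOn h (Ici 0))
    (hi : ∀ t, 0 ≤ t → h t = g + ∫ u in (0 : ℝ)..t, F (h u)) {T : ℝ} :
    ∀ t ∈ Icc 0 T, ‖h t‖ ≤ gronwallBound ‖g‖ K ‖F 0‖ T := by
  have h0 : h 0 = g := by simpa using hi 0 le_rfl
  intro t ht
  have := norm_le_gronwallBound_of_norm_deriv_right_le (f := h) (f' := fun s => F (h s))
    (δ := ‖g‖) (K := K) (ε := ‖F 0‖) (a := 0) (b := T) (hc.mono Icc_subset_Ici_self)
    (fun s hs => hasDerivWithinAt_of_integral_eq hF.continuous hc hi hs.1) (by rw [h0])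
    (fun s _ => by
      have h2 := hF.dist_le_mul (h s) 0
      rw [dist_zero_right, dist_eq_norm] at h2
      have h3 := norm_add_le (F (h s) - F 0) (F 0)
      rw [sub_add_cancel] at h3
      linarith) t ht
  refine this.trans (gronwallBound_mono (norm_nonneg _) (norm_nonneg _) K.2 ?_)
  linarith [ht.2]

/-- Modulus of continuity of a solution. -/
theorem norm_sub_le_of_integral_eq [CompleteSpace V] (hF : LipschitzWith K F) {g : V} {h : ℝ → V}
    (hc : ContinuousOn h (Ici 0))
    (hi : ∀ t, 0 ≤ t → h t = g + ∫ u in (0 : ℝ)..t, F (h u)) {R s t : ℝ}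
    (hs : 0 ≤ s) (hst : s ≤ t) (hR : ∀ u ∈ Icc s t, ‖h u‖ ≤ R) :
    ‖h t - h s‖ ≤ (‖F 0‖ + K * R) * (t - s) ∧
      ‖h t - h s - (t - s) • F (h s)‖ ≤ K * ((‖F 0‖ + K * R) * (t - s)) * (t - s) := by
  have hFb : ∀ x, ‖F x‖ ≤ ‖F 0‖ + K * ‖x‖ := fun x => by
    have h2 := hF.dist_le_mul x 0
    rw [dist_zero_right, dist_eq_norm] at h2
    have h3 := norm_add_le (F x - F 0) (F 0)
    rw [sub_add_cancel] at h3
    linarith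
  have hcF : ContinuousOn (fun u => F (h u)) (Ici 0) := hF.continuous.comp_continuousOn hc
  have hint : ∀ a b, 0 ≤ a → 0 ≤ b → IntervalIntegrable (fun u => F (h u)) volume a b := by
    intro a b ha hb
    refine (hcF.mono fun u hu => ?_).intervalIntegrable
    exact (le_min ha hb).trans hu.1
  have hsub : ∀ r, s ≤ r → h r - h s = ∫ u in s..r, F (h u) := by
    intro r hr
    rw [hi r (hs.trans hr), hi s hs, add_sub_add_left_eq_sub,
      intervalIntegral.integral_interval_sub_left (hint _ _ le_rfl (hs.trans hr))
        (hint _ _ le_rfl hs)]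
  have h1 : ∀ r ∈ Icc s t, ‖h r - h s‖ ≤ (‖F 0‖ + K * R) * (r - s) := by
    intro r hr
    rw [hsub r hr.1]
    have := intervalIntegral.norm_integral_le_of_norm_le_const (a := s) (b := r)
      (f := fun u => F (h u)) (C := ‖F 0‖ + K * R) (fun u hu => by
        rw [uIoc_of_le hr.1] at hu
        refine (hFb _).trans ?_
        gcongr
        exact hR u ⟨hu.1.le, hu.2.trans hr.2⟩)
    rwa [abs_of_nonneg (by linarith [hr.1])] at this
  refine ⟨h1 t ⟨hst, le_rfl⟩, ?_⟩
  have hRnn : 0 ≤ R := (norm_nonneg _).trans (hR s ⟨le_rfl, hst⟩)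
  have h2 : h t - h s - (t - s) • F (h s) = ∫ u in s..t, (F (h u) - F (h s)) := by
    rw [intervalIntegral.integral_sub (hint s t hs (hs.trans hst)) (by simp), ← hsub t hst,
      intervalIntegral.integral_const]
  rw [h2]
  have := intervalIntegral.norm_integral_le_of_norm_le_const (a := s) (b := t)
    (f := fun u => F (h u) - F (h s)) (C := K * ((‖F 0‖ + K * R) * (t - s))) (fun u hu => by
      rw [uIoc_of_le hst] at hu
      have h3 := hF.dist_le_mul (h u) (h s)
      rw [dist_eq_norm, dist_eq_norm] at h3
      refine h3.trans ?_
      gcongr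
      refine (h1 u ⟨hu.1.le, hu.2⟩).trans ?_
      gcongr
      exact hu.2)
  rwa [abs_of_nonneg (by linarith)] at this

end Flow

end QLearn


namespace QLearn

/-! ### Marginals of a finite Markov chain -/

section Chain

variable {S A : Type*} (ν : S → ℝ) (q : S → A → S → ℝ)

/-- The weight of a trajectory of length `n`. -/
def pathWeight (n : ℕ) (y : Fin (n + 1) → S) (b : Fin n → A) : ℝ :=
  ν (y 0) * ∏ i : Fin n, q (y i.castSucc) (b i) (y i.succ)

theorem pathWeight_snoc (n : ℕ) (y : Fin (n + 1) → S) (b : Fin n → A) (z : S) (a : A) :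
    pathWeight ν q (n + 1) (Fin.snoc (α := fun _ => S) y z) (Fin.snoc (α := fun _ => A) b a)
      = pathWeight ν q n y b * q (y (Fin.last n)) a z := by
  have h0 : (Fin.snoc (α := fun _ => S) y z : Fin (n + 2) → S) 0 = y 0 := by
    rw [← Fin.castSucc_zero, Fin.snoc_castSucc]
  have hs : ∀ i : Fin n, (Fin.snoc (α := fun _ => S) y z : Fin (n + 2) → S) i.castSucc.succ
      = y i.succ := fun i => by
    rw [Fin.succ_castSucc, Fin.snoc_castSucc]
  simp only [pathWeight, Fin.prod_univ_castSucc, Fin.snoc_castSucc, Fin.snoc_last, h0, hs,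
    Fin.succ_last]
  ring

theorem sum_snoc {n : ℕ} {B : Type*} [Fintype B] (f : (Fin (n + 1) → B) → ℝ) :
    ∑ y, f y = ∑ y : Fin n → B, ∑ z, f (Fin.snoc (α := fun _ => B) y z) := by
  rw [← (Fin.snocEquiv fun _ => B).sum_comp, Fintype.sum_prod_type, Finset.sum_comm]
  rfl

variable [Fintype S] [Fintype A]

/-- The Markov property in summed form: given the first `n` steps, the last one is averaged with the
kernel `q` at the current end point. -/
theorem sum_pathWeight_succ (n : ℕ) (f : (Fin (n + 2) → S) → (Fin (n + 1) → A) → ℝ) :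
    ∑ y, ∑ b, pathWeight ν q (n + 1) y b * f y b = ∑ y, ∑ b, pathWeight ν q n y b *
      ∑ a, ∑ z, q (y (Fin.last n)) a z *
        f (Fin.snoc (α := fun _ => S) y z) (Fin.snoc (α := fun _ => A) b a) := by
  rw [sum_snoc]
  refine Finset.sum_congr rfl fun y _ => ?_
  simp_rw [sum_snoc (B := A), pathWeight_snoc]
  rw [Finset.sum_comm]
  refine Finset.sum_congr rfl fun b _ => ?_
  rw [Finset.sum_comm, Finset.mul_sum]
  refine Finset.sum_congr rfl fun a _ => ?_
  rw [Finset.mul_sum]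
  refine Finset.sum_congr rfl fun z _ => ?_
  ring

variable {ν q} {p : ℕ → S → ℝ}

theorem sum_pathWeight_last (h0 : p 0 = ν)
    (hp : ∀ n z, p (n + 1) z = ∑ x, ∑ a, p n x * q x a z) (n : ℕ) (f : S → ℝ) :
    ∑ y, ∑ b, pathWeight ν q n y b * f (y (Fin.last n)) = ∑ x, p n x * f x := by
  induction n generalizing f with
  | zero =>
    rw [← (Equiv.funUnique (Fin 1) S).symm.sum_comp]
    simp [pathWeight, h0]
  | succ n ih =>
    rw [sum_pathWeight_succ ν q n (fun y _ => f (y (Fin.last (n + 1))))]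
    simp only [Fin.snoc_last]
    rw [ih (fun x => ∑ a, ∑ z, q x a z * f z)]
    simp_rw [hp, Finset.sum_mul, Finset.mul_sum]
    symm
    rw [Finset.sum_comm]
    refine Finset.sum_congr rfl fun x _ => ?_
    rw [Finset.sum_comm]
    refine Finset.sum_congr rfl fun a _ => Finset.sum_congr rfl fun z _ => ?_
    ring

/-- Transitions after step `j` sum to one by `hq` and are peeled off one at a time, until step `j`
is the last and `sum_pathWeight_last` gives the law of its starting state. -/
theorem sum_pathWeight_transition (h0 : p 0 = ν)
    (hp : ∀ n z, p (n + 1) z = ∑ x, ∑ a, p n x * q x a z) (hq : ∀ x, ∑ a, ∑ z, q x a z = 1)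
    (n : ℕ) (j : Fin n) (f : S → A → S → ℝ) :
    ∑ y, ∑ b, pathWeight ν q n y b * f (y j.castSucc) (b j) (y j.succ)
      = ∑ x, ∑ a, ∑ z, p j x * q x a z * f x a z := by
  induction n with
  | zero => exact j.elim0
  | succ n ih =>
    rw [sum_pathWeight_succ ν q n (fun y b => f (y j.castSucc) (b j) (y j.succ))]
    induction j using Fin.lastCases with
    | last =>
      simp only [Fin.snoc_last, Fin.snoc_castSucc, Fin.succ_last, Fin.val_last]
      rw [sum_pathWeight_last h0 hp n (fun x => ∑ a, ∑ z, q x a z * f x a z)]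
      simp_rw [Finset.mul_sum, mul_assoc]
    | cast j =>
      have hs : ∀ (y : Fin (n + 1) → S) (z : S),
          (Fin.snoc (α := fun _ => S) y z : Fin (n + 2) → S) j.castSucc.succ = y j.succ :=
        fun y z => by rw [Fin.succ_castSucc, Fin.snoc_castSucc]
      simp only [Fin.snoc_castSucc, hs]
      simp_rw [← Finset.sum_mul, hq, one_mul]
      rw [ih j, Fin.val_castSucc]

end Chain

namespace DecisionProblem

variable {dx da J : ℕ} (M : DecisionProblem dx da J)

/-- A trajectory `x_0, a_0, …, a_{J-1}, x_J`. -/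
abbrev Episode : Type := (Fin (J + 1) → M.states) × (Fin J → M.actions)

noncomputable section

/-- The probability of an episode. -/
def episodeProb (e : M.Episode) : ℝ :=
  M.init (e.1 0) * ∏ j : Fin J, 1 / (M.actions.card : ℝ)
    * M.trans (e.1 j.castSucc) (e.2 j) (e.1 j.succ)

theorem card_actions_pos : (0 : ℝ) < M.actions.card :=
  Nat.cast_pos.2 M.actions_nonempty.card_pos

theorem episodeProb_nonneg (e : M.Episode) : 0 ≤ M.episodeProb e :=
  mul_nonneg (M.init_nonneg _) (Finset.prod_nonneg fun _ _ =>
    mul_nonneg (by positivity) (M.trans_nonneg _ _ _))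

theorem sum_uniform_trans (x : M.states) :
    ∑ a, ∑ z, 1 / (M.actions.card : ℝ) * M.trans x a z = 1 := by
  simp_rw [← Finset.mul_sum, M.trans_sum]
  have := M.card_actions_pos
  simp
  field_simp

theorem stateProb_succ (n : ℕ) (z : M.states) : M.stateProb (n + 1) z
    = ∑ x, ∑ a, M.stateProb n x * (1 / (M.actions.card : ℝ) * M.trans x a z) := by
  simp only [stateProb, mul_assoc]

theorem sum_stateProb (n : ℕ) : ∑ x, M.stateProb n x = 1 := by
  induction n with
  | zero => exact M.init_sum
  | succ n ih =>
    simp_rw [stateProb_succ]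
    rw [Finset.sum_comm]
    refine (Finset.sum_congr rfl fun x _ => ?_).trans ih
    rw [Finset.sum_comm]
    simp_rw [← Finset.mul_sum (a := M.stateProb n x)]
    rw [M.sum_uniform_trans x, mul_one]

theorem sum_episodeProb : ∑ e, M.episodeProb e = 1 := by
  have := sum_pathWeight_last (ν := M.init)
    (q := fun x a z => 1 / (M.actions.card : ℝ) * M.trans x a z) (p := M.stateProb) rfl
    M.stateProb_succ J (fun _ => 1)
  simp only [mul_one] at this
  rw [M.sum_stateProb] at this
  rw [Fintype.sum_prod_type]
  exact this

theorem sum_episodeProb_transition (j : Fin J) (f : M.states → M.actions → M.states → ℝ) :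
    ∑ e, M.episodeProb e * f (e.1 j.castSucc) (e.2 j) (e.1 j.succ)
      = ∑ x, ∑ a, M.visitProb j x a * ∑ z, M.trans x a z * f x a z := by
  have := sum_pathWeight_transition (ν := M.init)
    (q := fun x a z => 1 / (M.actions.card : ℝ) * M.trans x a z) (p := M.stateProb) rfl
    M.stateProb_succ M.sum_uniform_trans J j f
  rw [Fintype.sum_prod_type]
  refine Eq.trans this ?_
  refine Finset.sum_congr rfl fun x _ => Finset.sum_congr rfl fun a _ => ?_
  rw [Finset.mul_sum]
  refine Finset.sum_congr rfl fun z _ => ?_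
  rw [visitProb]
  ring

/-! ### Lipschitz bounds -/

theorem norm_apply_le (q : M.QValues) (j : Fin J) (x : M.states) (a : M.actions) :
    |q j x a| ≤ ‖q‖ :=
  ((norm_le_pi_norm (q j x) a).trans (norm_le_pi_norm (q j) x)).trans (norm_le_pi_norm q j)

theorem norm_le_of_apply {q : M.QValues} {r : ℝ} (hr : 0 ≤ r)
    (h : ∀ j x a, |q j x a| ≤ r) : ‖q‖ ≤ r :=
  (pi_norm_le_iff_of_nonneg hr).2 fun j => (pi_norm_le_iff_of_nonneg hr).2 fun x =>
    (pi_norm_le_iff_of_nonneg hr).2 fun a => h j x a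

/-- Evaluation at `(j,x,a)`. -/
def evalCLM (j : Fin J) (x : M.states) (a : M.actions) : M.QValues →L[ℝ] ℝ :=
  (ContinuousLinearMap.proj (R := ℝ) (φ := fun _ : M.actions => ℝ) a).comp
    ((ContinuousLinearMap.proj (R := ℝ) (φ := fun _ : M.states => M.actions → ℝ) x).comp
      (ContinuousLinearMap.proj (R := ℝ) (φ := fun _ : Fin J => M.states → M.actions → ℝ) j))

theorem abs_withTerminal_sub_le (q q' : M.QValues) (i : Fin (J + 1)) (x : M.states)
    (a : M.actions) : |M.withTerminal q i x a - M.withTerminal q' i x a| ≤ ‖q - q'‖ := by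
  induction i using Fin.lastCases with
  | last => simp [withTerminal]
  | cast j => simpa [withTerminal] using M.norm_apply_le (q - q') j x a

theorem abs_iSup_sub_iSup_le {A : Type*} [Finite A] [Nonempty A] {f g : A → ℝ} {r : ℝ}
    (h : ∀ a, |f a - g a| ≤ r) : |(⨆ a, f a) - ⨆ a, g a| ≤ r := by
  rw [abs_sub_le_iff]
  constructor
  · rw [sub_le_iff_le_add]
    refine ciSup_le fun a => ?_
    have h1 := (abs_sub_le_iff.1 (h a)).1
    have h2 := le_ciSup (f := g) (Set.finite_range g).bddAbove a
    linarith
  · rw [sub_le_iff_le_add]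
    refine ciSup_le fun a => ?_
    have h1 := (abs_sub_le_iff.1 (h a)).2
    have h2 := le_ciSup (f := f) (Set.finite_range f).bddAbove a
    linarith

theorem abs_tdError_sub_le (q q' : M.QValues) (s : Fin (J + 1) → M.states)
    (act : Fin J → M.actions) (j : Fin J) :
    |M.tdError q s act j - M.tdError q' s act j| ≤ 2 * ‖q - q'‖ := by
  have h1 : |(⨆ a', M.withTerminal q j.succ (s j.succ) a')
      - ⨆ a', M.withTerminal q' j.succ (s j.succ) a'| ≤ ‖q - q'‖ :=
    abs_iSup_sub_iSup_le fun a => M.abs_withTerminal_sub_le q q' _ _ a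
  have h2 := M.norm_apply_le (q - q') j (s j.castSucc) (act j)
  simp only [Pi.sub_apply] at h2
  have h3 : |M.γ * ((⨆ a', M.withTerminal q j.succ (s j.succ) a')
      - ⨆ a', M.withTerminal q' j.succ (s j.succ) a')| ≤ ‖q - q'‖ := by
    rw [abs_mul, abs_of_pos M.γ_pos]
    nlinarith [M.γ_le_one, M.γ_pos, abs_nonneg ((⨆ a', M.withTerminal q j.succ (s j.succ) a')
      - ⨆ a', M.withTerminal q' j.succ (s j.succ) a')]
  have h4 : M.tdError q s act j - M.tdError q' s act j
      = M.γ * ((⨆ a', M.withTerminal q j.succ (s j.succ) a')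
        - ⨆ a', M.withTerminal q' j.succ (s j.succ) a')
        - (q j (s j.castSucc) (act j) - q' j (s j.castSucc) (act j)) := by
    simp only [tdError]
    ring
  rw [h4]
  refine (abs_sub _ _).trans ?_
  linarith

/-- Linear growth: the error is 2-Lipschitz in `q`, and there are finitely many episodes, so it is
bounded at `q = 0`. -/
theorem exists_abs_tdError_le : ∃ R, 0 ≤ R ∧ ∀ (q : M.QValues) (e : M.Episode) (j : Fin J),
    |M.tdError q e.1 e.2 j| ≤ R * (1 + ‖q‖) := by
  obtain ⟨R, hR⟩ : ∃ R, ∀ i : M.Episode × Fin J, |M.tdError 0 i.1.1 i.1.2 i.2| ≤ R :=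
    (Set.finite_range fun i : M.Episode × Fin J => |M.tdError 0 i.1.1 i.1.2 i.2|).bddAbove.imp
      fun R hR i => hR ⟨i, rfl⟩
  refine ⟨max R 2, by positivity, fun q e j => ?_⟩
  have h1 := M.abs_tdError_sub_le q 0 e.1 e.2 j
  rw [sub_zero] at h1
  have h2 := hR (e, j)
  have h3 := abs_sub_abs_le_abs_sub (M.tdError q e.1 e.2 j) (M.tdError 0 e.1 e.2 j)
  have h4 := le_max_left R 2
  have h5 := le_max_right R 2
  have h6 := norm_nonneg q
  simp only at h2
  nlinarith

/-! ### The vector field of the limit equation -/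

variable (σ : ℝ → ℝ) (α : ℝ) (μ₀ : ProbabilityMeasure (Param dx da J))

/-- The right-hand side of the limit equation. -/
def vectorField (h : M.QValues) : M.QValues := fun j x a =>
  ∑ x', ∑ a', M.visitProb j x' a' * M.tensorA σ α μ₀ j x a x' a' *
    (M.reward j x' a' + M.γ * (∑ z, (⨆ a'', M.withTerminal h j.succ z a'') * M.trans x' a' z)
      - h j x' a')

/-- The contribution of one episode to the drift. -/
def episodeField (e : M.Episode) (q : M.QValues) : M.QValues := fun j x a =>
  M.tdError q e.1 e.2 j * M.tensorA σ α μ₀ j x a (e.1 j.castSucc) (e.2 j)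

/-- This is where the limit equation comes from: an episode enters the drift at level `j` only
through its transition at time `j`, and averaging over that transition produces `π_j` and the
expected maximum. -/
theorem sum_episodeProb_smul_episodeField (q : M.QValues) :
    ∑ e, M.episodeProb e • M.episodeField σ α μ₀ e q = M.vectorField σ α μ₀ q := by
  funext j x a
  simp only [Finset.sum_apply, Pi.smul_apply, smul_eq_mul, episodeField, vectorField, tdError]
  rw [M.sum_episodeProb_transition j (fun x' a' z =>
    (M.reward j x' a' + M.γ * (⨆ a'', M.withTerminal q j.succ z a'') - q j x' a')
      * M.tensorA σ α μ₀ j x a x' a')]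
  refine Finset.sum_congr rfl fun x' _ => Finset.sum_congr rfl fun a' _ => ?_
  rw [mul_assoc]
  congr 1
  have h1 : ∀ z, M.trans x' a' z * ((M.reward j x' a'
      + M.γ * (⨆ a'', M.withTerminal q j.succ z a'') - q j x' a') * M.tensorA σ α μ₀ j x a x' a')
      = (M.trans x' a' z * (M.reward j x' a' - q j x' a')
        + M.γ * ((⨆ a'', M.withTerminal q j.succ z a'') * M.trans x' a' z))
        * M.tensorA σ α μ₀ j x a x' a' := fun z => by ring
  simp_rw [h1]
  rw [← Finset.sum_mul, Finset.sum_add_distrib, ← Finset.sum_mul, M.trans_sum, ← Finset.mul_sum]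
  ring

theorem exists_lipschitzWith_episodeField : ∃ K : ℝ≥0, ∀ e,
    LipschitzWith K (M.episodeField σ α μ₀ e) := by
  obtain ⟨R, hR⟩ : ∃ R, ∀ i : Fin J × M.states × M.actions × M.states × M.actions,
      |M.tensorA σ α μ₀ i.1 i.2.1 i.2.2.1 i.2.2.2.1 i.2.2.2.2| ≤ R :=
    (Set.finite_range fun i : Fin J × M.states × M.actions × M.states × M.actions =>
      |M.tensorA σ α μ₀ i.1 i.2.1 i.2.2.1 i.2.2.2.1 i.2.2.2.2|).bddAbove.imp
      fun R hR i => hR ⟨i, rfl⟩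
  refine ⟨Real.toNNReal (2 * max R 0), fun e => LipschitzWith.of_dist_le_mul fun q q' => ?_⟩
  rw [dist_eq_norm, dist_eq_norm, Real.coe_toNNReal _ (by positivity)]
  refine M.norm_le_of_apply (by positivity) fun j x a => ?_
  simp only [Pi.sub_apply, episodeField]
  rw [← sub_mul, abs_mul]
  have h1 := M.abs_tdError_sub_le q q' e.1 e.2 j
  have h2 := (hR (j, x, a, e.1 j.castSucc, e.2 j)).trans (le_max_left R 0)
  calc _ ≤ (2 * ‖q - q'‖) * max R 0 := by gcongr
    _ = _ := by ring

theorem lipschitzWith_vectorField {K : ℝ≥0}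
    (hK : ∀ e, LipschitzWith K (M.episodeField σ α μ₀ e)) :
    LipschitzWith K (M.vectorField σ α μ₀) := by
  refine LipschitzWith.of_dist_le_mul fun q q' => ?_
  rw [← M.sum_episodeProb_smul_episodeField, ← M.sum_episodeProb_smul_episodeField,
    dist_eq_norm, ← Finset.sum_sub_distrib]
  calc _ ≤ ∑ e, M.episodeProb e * (K * dist q q') := by
        refine norm_sum_le_of_le _ fun e _ => ?_
        rw [← smul_sub, norm_smul, Real.norm_of_nonneg (M.episodeProb_nonneg e), ← dist_eq_norm]
        exact mul_le_mul_of_nonneg_left ((hK e).dist_le_mul q q') (M.episodeProb_nonneg e)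
    _ = _ := by rw [← Finset.sum_mul, M.sum_episodeProb, one_mul]

/-- Evaluation at `(j,x,a)` is a continuous linear map and commutes with the integral, so the
coordinatewise system is one vector-valued equation to which the general flow results apply. -/
theorem isLimitSolution_iff (g : M.QValues) (h : ℝ → M.QValues) :
    M.IsLimitSolution σ α μ₀ g h ↔ ContinuousOn h (Ici 0) ∧
      ∀ t, 0 ≤ t → h t = g + ∫ u in (0 : ℝ)..t, M.vectorField σ α μ₀ (h u) := by
  obtain ⟨K, hK⟩ := M.exists_lipschitzWith_episodeField σ α μ₀
  have hF := (M.lipschitzWith_vectorField σ α μ₀ hK).continuous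
  have key : ContinuousOn h (Ici 0) → ∀ t, 0 ≤ t → ∀ j x a,
      (∫ u in (0 : ℝ)..t, M.vectorField σ α μ₀ (h u)) j x a
        = ∫ u in (0 : ℝ)..t, M.vectorField σ α μ₀ (h u) j x a := by
    intro hc t ht j x a
    have hint : IntervalIntegrable (fun u => M.vectorField σ α μ₀ (h u)) volume 0 t := by
      refine ContinuousOn.intervalIntegrable ?_
      rw [uIcc_of_le ht]
      exact hF.comp_continuousOn (hc.mono Icc_subset_Ici_self)
    exact ((M.evalCLM j x a).intervalIntegral_comp_comm hint).symm
  constructor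
  · rintro ⟨hc, hi⟩
    refine ⟨hc, fun t ht => ?_⟩
    funext j x a
    rw [hi t ht j x a, Pi.add_apply, Pi.add_apply, Pi.add_apply, key hc t ht]
    rfl
  · rintro ⟨hc, hi⟩
    refine ⟨hc, fun t ht j x a => ?_⟩
    rw [hi t ht, Pi.add_apply, Pi.add_apply, Pi.add_apply, key hc t ht]
    rfl

end

end DecisionProblem

end QLearn


namespace QLearn

/-! ### Ridge functions with distinct directions are linearly independent -/

section Ridge

variable {E : Type*} [NormedAddCommGroup E] [InnerProductSpace ℝ E]

theorem exists_inner_eq_zero_and_one {u v : E} (h : LinearIndependent ℝ ![u, v]) :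
    ∃ w : E, inner ℝ w v = 0 ∧ inner ℝ w u = 1 := by
  have hv : v ≠ 0 := h.ne_zero 1
  have hvv : inner ℝ v v ≠ 0 := inner_self_ne_zero.2 hv
  set w := u - (inner ℝ u v / inner ℝ v v) • v with hw
  have hw0 : w ≠ 0 := fun h0 => by
    have := LinearIndependent.pair_iff.1 h 1 (-(inner ℝ u v / inner ℝ v v))
      (by rw [one_smul, neg_smul, ← sub_eq_add_neg]; exact h0)
    exact one_ne_zero this.1
  have hwv : inner ℝ w v = 0 := by
    rw [hw, inner_sub_left, real_inner_smul_left]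
    field_simp
    ring
  have hwu : inner ℝ w u = inner ℝ w w := by
    conv_rhs => rw [hw, inner_sub_right, ← hw, real_inner_smul_right, hwv, mul_zero, sub_zero]
  have hww : inner ℝ w w ≠ 0 := inner_self_ne_zero.2 hw0
  refine ⟨(inner ℝ w w)⁻¹ • w, ?_, ?_⟩
  · rw [real_inner_smul_left, hwv, mul_zero]
  · rw [real_inner_smul_left, hwu, inv_mul_cancel₀ hww]

/-- Differencing along a vector orthogonal to one of the other directions removes that ridge
function and turns `f` into `f (· + l) - f`. By induction every such difference is constant in `u`;
a bounded function with constant differences has zero differences. The functions `g i` are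
arbitrary, so that the induction can replace them by their own differences. -/
theorem ridge_constant_of_sum_eq_zero {ι : Type*} [DecidableEq ι] (p : E) (hp : p ≠ 0)
    (pts : ι → E) (s : Finset ι) (hs : ∀ i ∈ s, LinearIndependent ℝ ![p, pts i])
    (f : ℝ → ℝ) (g : ι → ℝ → ℝ) (hb : ∃ B, ∀ u, |f u| ≤ B)
    (h : ∀ w : E, f (inner ℝ w p) + ∑ i ∈ s, g i (inner ℝ w (pts i)) = 0) :
    ∃ c, ∀ u, f u = c := by
  induction s using Finset.induction_on generalizing f g with
  | empty =>
    refine ⟨0, fun u => ?_⟩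
    have := h ((u / inner ℝ p p) • p)
    rwa [Finset.sum_empty, add_zero, real_inner_smul_left,
      div_mul_cancel₀ _ (inner_self_ne_zero.2 hp)] at this
  | insert i s hi ih =>
    obtain ⟨B, hB⟩ := hb
    -- `v` is orthogonal to `pts i`, hence invisible to `g i`, while it moves the argument of `f` at
    -- unit speed.
    obtain ⟨v, hv1, hv2⟩ := exists_inner_eq_zero_and_one (hs i (Finset.mem_insert_self i s))
    have hstep : ∀ l : ℝ, ∃ c, ∀ u, f (u + l) - f u = c := by
      intro l
      refine ih (fun k hk => hs k (Finset.mem_insert_of_mem hk)) (fun u => f (u + l) - f u)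
        (fun k u => g k (u + l * inner ℝ v (pts k)) - g k u)
        ⟨B + B, fun u => (abs_sub _ _).trans (add_le_add (hB _) (hB _))⟩ fun w => ?_
      have h1 := h (w + l • v)
      have h2 := h w
      rw [Finset.sum_insert hi] at h1 h2
      simp only [inner_add_left, real_inner_smul_left, hv1, hv2, mul_one, mul_zero,
        add_zero] at h1
      rw [Finset.sum_sub_distrib]
      linarith
    have hper : ∀ l u, f (u + l) = f u := by
      intro l u
      obtain ⟨c, hc⟩ := hstep l
      have hn : ∀ n : ℕ, f (u + n * l) = f u + n * c := by
        intro n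
        induction n with
        | zero => simp
        | succ n ihn =>
          have := hc (u + n * l)
          push_cast
          rw [show u + (n + 1 : ℝ) * l = u + n * l + l by ring]
          linarith
      -- Otherwise `f (u + n * l) = f u + n * c` would be unbounded in `n`.
      have hc0 : c = 0 := by
        by_contra hne
        obtain ⟨n, hn'⟩ := exists_nat_gt ((B + B) / |c|)
        rw [div_lt_iff₀ (abs_pos.2 hne)] at hn'
        have h1 := hB (u + n * l)
        have h2 := hB u
        have h3 : |(n : ℝ) * c| ≤ B + B := by
          rw [show (n : ℝ) * c = f (u + n * l) - f u by rw [hn n]; ring]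
          exact (abs_sub _ _).trans (add_le_add h1 h2)
        rw [abs_mul, Nat.abs_cast] at h3
        linarith
      have := hc u
      linarith
    exact ⟨f 0, fun u => by simpa using hper u 0⟩

end Ridge

/-! ### A linear system with positive definite coefficients and vanishing forcing -/

section Lyapunov

variable {ι : Type*} [Fintype ι]

open Matrix

theorem exists_pos_mul_sq_norm_le {B : Matrix ι ι ℝ} (hB : B.PosDef) :
    ∃ c, 0 < c ∧ ∀ y : ι → ℝ, c * ‖y‖ ^ 2 ≤ y ⬝ᵥ B *ᵥ y := by
  have hcont : Continuous fun y : ι → ℝ => y ⬝ᵥ B *ᵥ y := by fun_prop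
  have hpos : ∀ y : ι → ℝ, y ≠ 0 → 0 < y ⬝ᵥ B *ᵥ y := fun y hy => by
    simpa using hB.dotProduct_mulVec_pos hy
  by_cases hne : (Metric.sphere (0 : ι → ℝ) 1).Nonempty
  · obtain ⟨y₀, hy₀, hmin⟩ := (isCompact_sphere (0 : ι → ℝ) 1).exists_isMinOn hne hcont.continuousOn
    have hy0 : y₀ ≠ 0 := fun h => by simp [h] at hy₀
    refine ⟨_, hpos y₀ hy0, fun y => ?_⟩
    rcases eq_or_ne y 0 with rfl | hy
    · simp
    have hn : ‖y‖ ≠ 0 := norm_ne_zero_iff.2 hy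
    have h1 : ‖y‖⁻¹ • y ∈ Metric.sphere (0 : ι → ℝ) 1 := by
      simp [norm_smul, hn]
    have h2 := hmin h1
    simp only [mem_ofPred_eq, mulVec_smul, dotProduct_smul, smul_dotProduct, smul_eq_mul] at h2
    have h3 : 0 < ‖y‖ := norm_pos_iff.2 hy
    calc _ ≤ (‖y‖⁻¹ * (‖y‖⁻¹ * (y ⬝ᵥ B *ᵥ y))) * ‖y‖ ^ 2 := by gcongr
      _ = _ := by field_simp
  -- The unit sphere is empty: then the space is trivial and any positive constant works.
  · refine ⟨1, one_pos, fun y => ?_⟩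
    rcases eq_or_ne y 0 with rfl | hy
    · simp
    · exact absurd ⟨‖y‖⁻¹ • y, by simp [norm_smul, norm_ne_zero_iff.2 hy]⟩ hne

/-- Grönwall with the negative rate `-c`, started at a time after which the forcing is at most `c *
(ε / 2)`: the comparison solution relaxes to the level `ε / 2`, and the memory of `f a` dies out
exponentially. -/
theorem tendsto_zero_of_deriv_le {f f' e : ℝ → ℝ} {c : ℝ} (hc : 0 < c)
    (hf : ContinuousOn f (Ici 0)) (hf' : ∀ t, 0 ≤ t → HasDerivWithinAt f (f' t) (Ici t) t)
    (h0 : ∀ t, 0 ≤ t → 0 ≤ f t)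
    (hle : ∀ t, 0 ≤ t → f' t ≤ -c * f t + e t) (he : Tendsto e atTop (𝓝 0)) :
    Tendsto f atTop (𝓝 0) := by
  rw [Metric.tendsto_atTop]
  intro ε hε
  obtain ⟨t₀, ht₀⟩ := (Metric.tendsto_atTop.1 he) (c * (ε / 2)) (by positivity)
  set a := max t₀ 0
  have hexp : Tendsto (fun t => f a * Real.exp (-c * (t - a))) atTop (𝓝 (f a * 0)) := by
    refine Tendsto.const_mul _ (Real.tendsto_exp_atBot.comp ?_)
    exact (tendsto_atTop_add_const_right _ _ tendsto_id).const_mul_atTop_of_neg (by linarith)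
  rw [mul_zero] at hexp
  obtain ⟨t₁, ht₁⟩ := (Metric.tendsto_atTop.1 hexp) (ε / 2) (by positivity)
  refine ⟨max t₁ a, fun t ht => ?_⟩
  have hat : a ≤ t := (le_max_right _ _).trans ht
  have ha0 : 0 ≤ a := le_max_right _ _
  have h1 := le_gronwallBound_of_liminf_deriv_right_le (f := f) (f' := f') (δ := f a) (K := -c)
    (ε := c * (ε / 2)) (a := a) (b := t) (hf.mono fun s hs => ha0.trans hs.1)
    (fun s hs r hr => (hf' s (ha0.trans hs.1)).liminf_right_slope_le hr) le_rfl
    (fun s hs => by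
      have h2 := hle s (ha0.trans hs.1)
      have h3 := ht₀ s ((le_max_left _ _).trans hs.1)
      rw [Real.dist_eq, sub_zero] at h3
      linarith [le_abs_self (e s)]) t ⟨hat, le_rfl⟩
  rw [gronwallBound_of_K_ne_0 (by linarith)] at h1
  have h4 := ht₁ t ((le_max_left _ _).trans ht)
  rw [Real.dist_eq, sub_zero] at h4
  rw [Real.dist_eq, sub_zero, abs_of_nonneg (h0 t (ha0.trans hat))]
  have h5 : c * (ε / 2) / -c * (Real.exp (-c * (t - a)) - 1)
      = ε / 2 - ε / 2 * Real.exp (-c * (t - a)) := by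
    field_simp
    ring
  simp only [h5] at h1
  have h6 : 0 < ε / 2 * Real.exp (-c * (t - a)) := by positivity
  linarith [le_abs_self (f a * Real.exp (-c * (t - a)))]

/-- The energy `y ⬝ᵥ A⁻¹ *ᵥ y` is chosen so that `A` cancels in its derivative. What remains is
diagonal, `-2 ∑ p i (y i - e i) y i`, and completing the square bounds it by `-∑ p i (y i)² + ∑ p i
(e i)²`. The first sum dominates a multiple of the energy and the second tends to zero. -/
theorem tendsto_zero_of_posDef [DecidableEq ι] {A : Matrix ι ι ℝ} (hA : A.PosDef) {p : ι → ℝ}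
    (hp : ∀ i, 0 < p i) {y e : ℝ → ι → ℝ} (hy : ContinuousOn y (Ici 0))
    (hy' : ∀ t, 0 ≤ t →
      HasDerivWithinAt y (-(A *ᵥ fun i => p i * (y t i - e t i))) (Ici t) t)
    (he : Tendsto e atTop (𝓝 0)) : Tendsto y atTop (𝓝 0) := by
  set B := A⁻¹ with hBdef
  have hB : B.PosDef := hA.inv
  have hAs : Aᵀ = A := by simpa using hA.isHermitian.eq
  have hAu : IsUnit A.det := (Matrix.isUnit_iff_isUnit_det A).1 hA.isUnit
  have hBA : B * A = 1 := Matrix.nonsing_inv_mul A hAu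
  have hAB : A * B = 1 := Matrix.mul_nonsing_inv A hAu
  obtain ⟨c, hc, hcB⟩ := exists_pos_mul_sq_norm_le hB
  have hder : ∀ t, 0 ≤ t → HasDerivWithinAt (fun t => y t ⬝ᵥ B *ᵥ y t)
      (-2 * ∑ i, p i * (y t i - e t i) * y t i) (Ici t) t := by
    intro t ht
    set z : ι → ℝ := fun i => p i * (y t i - e t i) with hz
    have h1 := hy' t ht
    have h2 : HasDerivWithinAt (fun t => B *ᵥ y t) (B *ᵥ (-(A *ᵥ z))) (Ici t) t :=
      (LinearMap.toContinuousLinearMap (Matrix.mulVecLin B)).hasFDerivAt.comp_hasDerivWithinAt t h1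
    have h3 : HasDerivWithinAt (fun t => ∑ i, y t i * (B *ᵥ y t) i) _ (Ici t) t :=
      HasDerivWithinAt.fun_sum fun i _ =>
        ((hasDerivWithinAt_pi.1 h1) i).mul ((hasDerivWithinAt_pi.1 h2) i)
    refine h3.congr_deriv ?_
    rw [Finset.sum_add_distrib]
    change -(A *ᵥ z) ⬝ᵥ B *ᵥ y t + y t ⬝ᵥ B *ᵥ -(A *ᵥ z) = _
    rw [mulVec_neg, mulVec_mulVec, hBA, one_mulVec, dotProduct_neg, neg_dotProduct,
      ← vecMul_transpose, ← dotProduct_mulVec, hAs, mulVec_mulVec, hAB, one_mulVec]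
    have h4 : z ⬝ᵥ y t = ∑ i, p i * (y t i - e t i) * y t i := rfl
    rw [dotProduct_comm (y t) z, h4]
    ring
  obtain ⟨m, hm, hmp⟩ : ∃ m, 0 < m ∧ ∀ y : ι → ℝ, m * (y ⬝ᵥ B *ᵥ y) ≤ ∑ i, p i * y i ^ 2 := by
    obtain ⟨c', hc', hcp⟩ := exists_pos_mul_sq_norm_le (B := Matrix.diagonal p)
      (Matrix.PosDef.diagonal hp)
    obtain ⟨C, hC0, hC⟩ : ∃ C, 0 < C ∧ ∀ y : ι → ℝ, y ⬝ᵥ B *ᵥ y ≤ C * ‖y‖ ^ 2 := by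
      refine ⟨∑ i, ∑ j, |B i j| + 1, by positivity, fun y => ?_⟩
      have h1 : y ⬝ᵥ B *ᵥ y = ∑ i, ∑ j, y i * B i j * y j := by
        simp [dotProduct, mulVec, Finset.mul_sum, mul_assoc]
      rw [h1]
      calc _ ≤ ∑ i, ∑ j, |B i j| * ‖y‖ ^ 2 := by
            refine Finset.sum_le_sum fun i _ => Finset.sum_le_sum fun j _ => ?_
            refine (le_abs_self _).trans ?_
            rw [abs_mul, abs_mul]
            have h2 : |y i| ≤ ‖y‖ := norm_le_pi_norm y i
            have h3 : |y j| ≤ ‖y‖ := norm_le_pi_norm y j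
            calc _ ≤ ‖y‖ * |B i j| * ‖y‖ := by gcongr
              _ = _ := by ring
        _ = (∑ i, ∑ j, |B i j|) * ‖y‖ ^ 2 := by simp_rw [Finset.sum_mul]
        _ ≤ _ := by gcongr; linarith
    refine ⟨c' / C, by positivity, fun y => ?_⟩
    have h1 := hcp y
    have h2 : y ⬝ᵥ Matrix.diagonal p *ᵥ y = ∑ i, p i * y i ^ 2 := by
      simp only [dotProduct, mulVec_diagonal]
      exact Finset.sum_congr rfl fun i _ => by ring
    rw [h2] at h1
    refine le_trans ?_ h1
    calc _ ≤ c' / C * (C * ‖y‖ ^ 2) := by gcongr; exact hC y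
      _ = _ := by field_simp
  have hE : Tendsto (fun t => y t ⬝ᵥ B *ᵥ y t) atTop (𝓝 0) := by
    refine tendsto_zero_of_deriv_le (e := fun t => ∑ i, p i * e t i ^ 2) hm ?_ hder
      (fun t _ => le_trans (by positivity) (hcB (y t))) (fun t _ => ?_) ?_
    · have : Continuous fun y : ι → ℝ => y ⬝ᵥ B *ᵥ y := by fun_prop
      exact this.comp_continuousOn hy
    · have h1 := hmp (y t)
      have h2 : -2 * ∑ i, p i * (y t i - e t i) * y t i
          ≤ -(∑ i, p i * y t i ^ 2) + ∑ i, p i * e t i ^ 2 := by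
        rw [Finset.mul_sum, ← Finset.sum_neg_distrib, ← Finset.sum_add_distrib]
        refine Finset.sum_le_sum fun i _ => ?_
        -- `2 (y - e) y = y² + (y - e)² - e²`.
        nlinarith [mul_nonneg (hp i).le (sq_nonneg (y t i - e t i))]
      linarith
    · have h1 : Continuous fun e : ι → ℝ => ∑ i, p i * e i ^ 2 := by fun_prop
      have h2 := (h1.tendsto 0).comp he
      simpa [Function.comp_def] using h2
  rw [tendsto_zero_iff_norm_tendsto_zero]
  have h1 : Tendsto (fun t => √(c⁻¹ * (y t ⬝ᵥ B *ᵥ y t))) atTop (𝓝 0) := by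
    have := (hE.const_mul c⁻¹).sqrt
    simpa using this
  refine squeeze_zero (fun t => norm_nonneg _) (fun t => ?_) h1
  refine Real.le_sqrt_of_sq_le ?_
  rw [inv_mul_eq_div, le_div_iff₀ hc]
  linarith [hcB (y t)]

end Lyapunov

end QLearn


/-! ### Positive definiteness of the tensor and convergence to the Bellman solution -/

namespace QLearn

theorem IsC2b.continuous {σ : ℝ → ℝ} (h : IsC2b σ) : Continuous σ := h.1.continuous

theorem IsC2b.differentiable {σ : ℝ → ℝ} (h : IsC2b σ) : Differentiable ℝ σ :=
  h.1.differentiable (by norm_num)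

theorem IsC2b.contDiff_deriv {σ : ℝ → ℝ} (h : IsC2b σ) : ContDiff ℝ 1 (deriv σ) :=
  ((contDiff_succ_iff_deriv (n := 1)).1 h.1).2.2

theorem IsC2b.continuous_deriv {σ : ℝ → ℝ} (h : IsC2b σ) : Continuous (deriv σ) :=
  h.contDiff_deriv.continuous

namespace DecisionProblem

variable {dx da J : ℕ} (M : DecisionProblem dx da J)

variable {σ : ℝ → ℝ} (α : ℝ) {μ₀ : ProbabilityMeasure (Param dx da J)}

theorem integrable_sigma_mul_sigma (hσ : IsC2b σ) (u v : EuclideanSpace ℝ (Fin dx ⊕ Fin da)) :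
    Integrable (fun θ : Param dx da J => σ (inner ℝ θ.2 u) * σ (inner ℝ θ.2 v))
      (μ₀ : Measure (Param dx da J)) := by
  obtain ⟨B, hB⟩ := hσ.2
  have hc := hσ.continuous
  refine Integrable.of_bound (C := B * B) (Continuous.aestronglyMeasurable (by fun_prop))
    (ae_of_all _ fun θ => ?_)
  rw [Real.norm_eq_abs, abs_mul]
  exact mul_le_mul (hB _).1 (hB _).1 (abs_nonneg _) ((abs_nonneg _).trans (hB 0).1)

theorem integrable_output_mul_deriv (hσ : IsC2b σ) (hμ₀ : InitAssumption μ₀) (i j : Fin J)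
    (u v : EuclideanSpace ℝ (Fin dx ⊕ Fin da)) :
    Integrable (fun θ : Param dx da J => θ.1 i * θ.1 j * deriv σ (inner ℝ θ.2 u)
      * deriv σ (inner ℝ θ.2 v) * inner ℝ u v) (μ₀ : Measure (Param dx da J)) := by
  obtain ⟨B, hB⟩ := hσ.2
  obtain ⟨C, hC⟩ := hμ₀.bounded
  have hc := hσ.continuous_deriv
  refine Integrable.of_bound (C := C * C * B * B * |inner ℝ u v|)
    (Continuous.aestronglyMeasurable (by fun_prop)) ?_
  filter_upwards [hC] with θ hθ
  have h1 := (hB (inner ℝ θ.2 u)).2.1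
  have h2 := (hB (inner ℝ θ.2 v)).2.1
  have h3 := hθ i
  have h4 := hθ j
  have h5 : 0 ≤ B := (abs_nonneg _).trans h1
  have h6 : 0 ≤ C := (abs_nonneg _).trans h3
  rw [Real.norm_eq_abs, abs_mul, abs_mul, abs_mul, abs_mul]
  gcongr

/-- The tensor is a sum of two Gram matrices, one of the features `σ (w · ζ)` and one of the vectors
`c_j σ' (w · ζ) ζ`. Positivity can thus be read off the first alone. -/
theorem sum_mul_tensorA_mul (hσ : IsC2b σ) (hμ₀ : InitAssumption μ₀) (j : Fin J)
    (y : M.states × M.actions → ℝ) :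
    ∑ p, ∑ p', y p * M.tensorA σ α μ₀ j p.1 p.2 p'.1 p'.2 * y p'
      = α * ∫ θ, (∑ p, y p * σ (inner ℝ θ.2 (M.pt p.1 p.2))) ^ 2
          ∂(μ₀ : Measure (Param dx da J))
        + α * ∫ θ, θ.1 j ^ 2 * ‖∑ p, (y p * deriv σ (inner ℝ θ.2 (M.pt p.1 p.2)))
          • M.pt p.1 p.2‖ ^ 2 ∂(μ₀ : Measure (Param dx da J)) := by
  have h1 : ∀ θ : Param dx da J, (∑ p, y p * σ (inner ℝ θ.2 (M.pt p.1 p.2))) ^ 2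
      = ∑ p, ∑ p', y p * y p' *
        (σ (inner ℝ θ.2 (M.pt p'.1 p'.2)) * σ (inner ℝ θ.2 (M.pt p.1 p.2))) := fun θ => by
    rw [sq, Finset.sum_mul_sum]
    refine Finset.sum_congr rfl fun p _ => Finset.sum_congr rfl fun p' _ => ?_
    ring
  have h2 : ∀ θ : Param dx da J, θ.1 j ^ 2 * ‖∑ p, (y p * deriv σ (inner ℝ θ.2 (M.pt p.1 p.2)))
          • M.pt p.1 p.2‖ ^ 2 = ∑ p, ∑ p', y p * y p' *
        (θ.1 j * θ.1 j * deriv σ (inner ℝ θ.2 (M.pt p'.1 p'.2))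
          * deriv σ (inner ℝ θ.2 (M.pt p.1 p.2)) * inner ℝ (M.pt p'.1 p'.2) (M.pt p.1 p.2)) :=
    fun θ => by
    rw [← real_inner_self_eq_norm_sq, sum_inner, Finset.mul_sum]
    simp_rw [inner_sum, Finset.mul_sum, real_inner_smul_left, real_inner_smul_right]
    refine Finset.sum_congr rfl fun p _ => Finset.sum_congr rfl fun p' _ => ?_
    rw [real_inner_comm (M.pt p.1 p.2) (M.pt p'.1 p'.2)]
    ring
  simp_rw [h1, h2]
  rw [integral_finsetSum _ fun p _ => integrable_finsetSum _ fun p' _ =>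
      (integrable_sigma_mul_sigma hσ _ _).const_mul _,
    integral_finsetSum _ fun p _ => integrable_finsetSum _ fun p' _ =>
      (integrable_output_mul_deriv hσ hμ₀ j j _ _).const_mul _,
    Finset.mul_sum, Finset.mul_sum, ← Finset.sum_add_distrib]
  refine Finset.sum_congr rfl fun p _ => ?_
  rw [integral_finsetSum _ fun p' _ => (integrable_sigma_mul_sigma hσ _ _).const_mul _,
    integral_finsetSum _ fun p' _ => (integrable_output_mul_deriv hσ hμ₀ j j _ _).const_mul _,
    Finset.mul_sum, Finset.mul_sum, ← Finset.sum_add_distrib]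
  refine Finset.sum_congr rfl fun p' _ => ?_
  rw [integral_const_mul, integral_const_mul, tensorA]
  simp_rw [sq]
  ring

/-- If `B ≤ 0`, the law would live on the hyperplane `c_j = 0`, which is Lebesgue-null. Positivity
of `B` is what makes the box of output weights have interior. -/
theorem exists_output_bound_pos (hμ₀ : InitAssumption μ₀) (j : Fin J) {B : ℝ}
    (hB : ∀ᵐ θ : Param dx da J ∂(μ₀ : Measure _), ∀ j, |θ.1 j| ≤ B) : 0 < B := by
  by_contra hB0
  have hzero : ∀ᵐ θ : Param dx da J ∂(μ₀ : Measure _), θ ∈ {θ : Param dx da J | θ.1 j = 0} := by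
    filter_upwards [hB] with θ hθ
    exact abs_nonpos_iff.1 ((hθ j).trans (not_lt.1 hB0))
  have hvol : volume {θ : Param dx da J | θ.1 j = 0} = 0 := by
    have h1 : {θ : Param dx da J | θ.1 j = 0}
        = {c : Fin J → ℝ | c j = 0} ×ˢ (univ : Set (EuclideanSpace ℝ (Fin dx ⊕ Fin da))) := by
      ext θ
      simp
    rw [h1, Measure.volume_eq_prod, Measure.prod_prod, volume_pi, Measure.pi_hyperplane, zero_mul]
  have h2 := hμ₀.absolutelyContinuous hvol
  have h3 : (μ₀ : Measure (Param dx da J)) univ = 0 := by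
    refine measure_mono_null (t := {θ : Param dx da J | θ.1 j = 0} ∪
      {θ : Param dx da J | θ.1 j = 0}ᶜ) (by simp) (measure_union_null h2 ?_)
    exact hzero
  simp at h3

theorem posDef_tensorA (hσ : IsC2b σ) (hα : 0 < α) (hμ₀ : InitAssumption μ₀)
    (hpd : PosDefAssumption M σ μ₀) (j : Fin J) :
    (Matrix.of fun p p' : M.states × M.actions =>
      M.tensorA σ α μ₀ j p.1 p.2 p'.1 p'.2).PosDef := by
  classical
  refine Matrix.PosDef.of_dotProduct_mulVec_pos ?_ fun y hy => ?_
  · ext p p'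
    simp only [Matrix.conjTranspose_apply, Matrix.of_apply, star_trivial, tensorA]
    congr 3
    · ext θ
      ring
    · ext θ
      rw [real_inner_comm (M.pt p.1 p.2) (M.pt p'.1 p'.2)]
      ring
  · have h0 : star y ⬝ᵥ (Matrix.of fun p p' : M.states × M.actions =>
        M.tensorA σ α μ₀ j p.1 p.2 p'.1 p'.2).mulVec y
        = ∑ p, ∑ p', y p * M.tensorA σ α μ₀ j p.1 p.2 p'.1 p'.2 * y p' := by
      simp [dotProduct, Matrix.mulVec, Finset.mul_sum, mul_assoc]
    rw [h0, M.sum_mul_tensorA_mul α hσ hμ₀]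
    have hcont := hσ.continuous
    refine add_pos_of_pos_of_nonneg (mul_pos hα ?_)
      (mul_nonneg hα.le (integral_nonneg fun θ => by positivity))
    obtain ⟨p₀, hp₀⟩ : ∃ p, y p ≠ 0 := by
      by_contra h
      push Not at h
      exact hy (funext h)
    -- If the ridge sum vanished identically, the term with `y p₀ ≠ 0` would make the bounded `σ`
    -- constant, hence a polynomial.
    have hw : ∃ w, ∑ p, y p * σ (inner ℝ w (M.pt p.1 p.2)) ≠ 0 := by
      by_contra h
      push Not at h
      obtain ⟨Bσ, hBσ⟩ := hσ.2
      obtain ⟨c, hc⟩ := ridge_constant_of_sum_eq_zero (M.pt p₀.1 p₀.2)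
        (hpd.point_ne_zero _ _) (fun p : M.states × M.actions => M.pt p.1 p.2)
        (Finset.univ.erase p₀) (fun p hp => hpd.distinct_directions _ _ _ _
          (Finset.ne_of_mem_erase hp).symm)
        (fun u => y p₀ * σ u) (fun p u => y p * σ u)
        ⟨|y p₀| * Bσ, fun u => by
          rw [abs_mul]
          exact mul_le_mul_of_nonneg_left (hBσ u).1 (abs_nonneg _)⟩
        (fun w => by
          rw [Finset.add_sum_erase _ (fun p : M.states × M.actions =>
            y p * σ (inner ℝ w (M.pt p.1 p.2))) (Finset.mem_univ p₀)]
          exact h w)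
      refine hpd.not_polynomial ⟨Polynomial.C ((y p₀)⁻¹ * c), fun u => ?_⟩
      rw [Polynomial.eval_C, ← hc u, inv_mul_cancel_left₀ hp₀]
    obtain ⟨w, hw⟩ := hw
    have hf : Continuous fun θ : Param dx da J =>
        (∑ p, y p * σ (inner ℝ θ.2 (M.pt p.1 p.2))) ^ 2 := by fun_prop
    have hfb : Integrable (fun θ : Param dx da J =>
        (∑ p, y p * σ (inner ℝ θ.2 (M.pt p.1 p.2))) ^ 2) (μ₀ : Measure (Param dx da J)) := by
      obtain ⟨Bσ, hBσ⟩ := hσ.2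
      refine Integrable.of_bound (C := (∑ p, |y p| * Bσ) ^ 2) hf.aestronglyMeasurable
        (ae_of_all _ fun θ => ?_)
      rw [Real.norm_eq_abs, abs_pow]
      gcongr
      refine (Finset.abs_sum_le_sum_abs _ _).trans (Finset.sum_le_sum fun p _ => ?_)
      rw [abs_mul]
      exact mul_le_mul_of_nonneg_left (hBσ _).1 (abs_nonneg _)
    rw [integral_pos_iff_support_of_nonneg (fun θ => by positivity) hfb]
    obtain ⟨B, hB, hfull⟩ := hpd.full_support
    have hBpos := exists_output_bound_pos hμ₀ j hB
    set U : Set (EuclideanSpace ℝ (Fin dx ⊕ Fin da)) :=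
      {w | ∑ p, y p * σ (inner ℝ w (M.pt p.1 p.2)) ≠ 0} with hU
    have hUo : IsOpen U := isOpen_ne_fun (by fun_prop) continuous_const
    -- By continuity the ridge sum is nonzero on an open set of hidden weights. Its product with the
    -- ball (sup norm, so inside the box) is open and nonempty, hence charged by `μ₀`.
    have hΓo : IsOpen (Metric.ball (0 : Fin J → ℝ) B ×ˢ U) := Metric.isOpen_ball.prod hUo
    refine lt_of_lt_of_le (hfull (Metric.ball (0 : Fin J → ℝ) B ×ˢ U) hΓo.measurableSet ?_ ?_)
      (measure_mono ?_)
    · rintro θ ⟨h1, -⟩ i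
      rw [mem_ball_zero_iff] at h1
      exact (norm_le_pi_norm θ.1 i).trans h1.le
    · exact hΓo.measure_pos volume ⟨(0, w), Metric.mem_ball_self hBpos, hw⟩
    · rintro θ ⟨-, h2⟩
      exact pow_ne_zero 2 h2

/-- Backward induction on the time level. The maximum couples level `j` only to level `j + 1`, which
has already converged, so it enters the linear equation for `h_j - V_j` as a vanishing forcing. -/
theorem tendsto_withTerminal (hπ : ∀ j : ℕ, j ≤ J → ∀ x a, 0 < M.visitProb j x a)
    (hσ : IsC2b σ) (hα : 0 < α) (hμ₀ : InitAssumption μ₀) (hpd : PosDefAssumption M σ μ₀)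
    {g : M.QValues} {h : ℝ → M.QValues} (hh : M.IsLimitSolution σ α μ₀ g h) (i : Fin (J + 1)) :
    ∀ x a, Tendsto (fun t => M.withTerminal (h t) i x a) atTop (𝓝 (M.bellmanValue i x a)) := by
  classical
  have hV := (M.isBellmanSolution_iff M.bellmanValue).2 rfl
  obtain ⟨hc, hi⟩ := (M.isLimitSolution_iff σ α μ₀ g h).1 hh
  obtain ⟨K, hK⟩ := M.exists_lipschitzWith_episodeField σ α μ₀
  have hF := (M.lipschitzWith_vectorField σ α μ₀ hK).continuous
  induction i using Fin.reverseInduction with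
  | last =>
    intro x a
    simp only [withTerminal, Fin.snoc_last, hV.2]
    exact tendsto_const_nhds
  | cast j ih =>
    -- Subtracting the Bellman equation for `V_j` turns the bracket of the vector field into `e - y`
    -- with `y = h_j - V_j`.
    set e : ℝ → M.states × M.actions → ℝ := fun t p => M.γ * ∑ z,
      ((⨆ a', M.withTerminal (h t) j.succ z a') - ⨆ a', M.bellmanValue j.succ z a')
        * M.trans p.1 p.2 z with he
    have hsup : ∀ z, Tendsto (fun t => (⨆ a', M.withTerminal (h t) j.succ z a')
        - ⨆ a', M.bellmanValue j.succ z a') atTop (𝓝 0) := by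
      intro z
      have h1 : Tendsto (fun t => ∑ a', |M.withTerminal (h t) j.succ z a'
          - M.bellmanValue j.succ z a'|) atTop (𝓝 0) := by
        rw [show (0 : ℝ) = ∑ a' : M.actions, |M.bellmanValue j.succ z a'
          - M.bellmanValue j.succ z a'| by simp]
        exact tendsto_finsetSum _ fun a' _ => ((ih z a').sub_const _).abs
      refine squeeze_zero_norm (fun t => ?_) h1
      exact abs_iSup_sub_iSup_le fun a' => Finset.single_le_sum
        (f := fun a' => |M.withTerminal (h t) j.succ z a' - M.bellmanValue j.succ z a'|)
        (fun _ _ => abs_nonneg _) (Finset.mem_univ a')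
    have he0 : Tendsto e atTop (𝓝 0) := by
      rw [tendsto_pi_nhds]
      intro p
      have : Tendsto (fun t => e t p) atTop (𝓝 (M.γ * ∑ z, 0 * M.trans p.1 p.2 z)) :=
        (tendsto_finsetSum _ fun z _ => (hsup z).mul_const _).const_mul _
      simpa using this
    have hmain := tendsto_zero_of_posDef (M.posDef_tensorA α hσ hα hμ₀ hpd j)
      (p := fun p => M.visitProb j p.1 p.2) (fun p => hπ j j.2.le p.1 p.2)
      (y := fun t p => h t j p.1 p.2 - M.bellmanValue j.castSucc p.1 p.2) (e := e)
      (by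
        rw [continuousOn_pi]
        intro p
        exact ((M.evalCLM j p.1 p.2).continuous.comp_continuousOn hc).sub continuousOn_const)
      (fun t ht => by
        rw [hasDerivWithinAt_pi]
        intro p
        have h1 := hasDerivWithinAt_of_integral_eq hF hc hi ht
        have h2 : HasDerivWithinAt (fun t => h t j p.1 p.2)
            (M.vectorField σ α μ₀ (h t) j p.1 p.2) (Ici t) t :=
          (M.evalCLM j p.1 p.2).hasFDerivAt.comp_hasDerivWithinAt t h1
        refine (h2.sub_const _).congr_deriv ?_
        simp only [vectorField, Pi.neg_apply, Matrix.mulVec, dotProduct, Matrix.of_apply]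
        rw [Fintype.sum_prod_type, ← Finset.sum_neg_distrib]
        refine Finset.sum_congr rfl fun x' _ => ?_
        rw [← Finset.sum_neg_distrib]
        refine Finset.sum_congr rfl fun a' _ => ?_
        simp only [he]
        rw [hV.1 j x' a']
        simp_rw [sub_mul]
        rw [Finset.sum_sub_distrib]
        ring)
      he0
    intro x a
    have h1 := (tendsto_pi_nhds.1 hmain (x, a)).add_const (M.bellmanValue j.castSucc x a)
    simpa [withTerminal] using h1

theorem tendsto_iSup_abs_sub_bellmanValue (hπ : ∀ j : ℕ, j ≤ J → ∀ x a, 0 < M.visitProb j x a)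
    (hσ : IsC2b σ) (hα : 0 < α) (hμ₀ : InitAssumption μ₀) (hpd : PosDefAssumption M σ μ₀)
    {g : M.QValues} {h : ℝ → M.QValues} (hh : M.IsLimitSolution σ α μ₀ g h) :
    Tendsto (fun t => ⨆ i : Fin (J + 1) × M.states × M.actions,
      |M.withTerminal (h t) i.1 i.2.1 i.2.2 - M.bellmanValue i.1 i.2.1 i.2.2|) atTop (𝓝 0) := by
  have h1 : Tendsto (fun t => ∑ i : Fin (J + 1) × M.states × M.actions,
      |M.withTerminal (h t) i.1 i.2.1 i.2.2 - M.bellmanValue i.1 i.2.1 i.2.2|) atTop (𝓝 0) := by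
    rw [show (0 : ℝ) = ∑ i : Fin (J + 1) × M.states × M.actions,
      |M.bellmanValue i.1 i.2.1 i.2.2 - M.bellmanValue i.1 i.2.1 i.2.2| by simp]
    exact tendsto_finsetSum _ fun i _ =>
      ((M.tendsto_withTerminal α hπ hσ hα hμ₀ hpd hh i.1 i.2.1 i.2.2).sub_const _).abs
  refine squeeze_zero (fun t => Real.iSup_nonneg fun i => abs_nonneg _) (fun t => ?_) h1
  exact ciSup_le fun i => Finset.single_le_sum
    (f := fun i : Fin (J + 1) × M.states × M.actions =>
      |M.withTerminal (h t) i.1 i.2.1 i.2.2 - M.bellmanValue i.1 i.2.1 i.2.2|)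
    (fun _ _ => abs_nonneg _) (Finset.mem_univ i)

end DecisionProblem

end QLearn


namespace QLearn

/-! ### The central limit theorem in finite dimension -/

section CLT

variable {Ω : Type*} [MeasurableSpace Ω] {P : Measure Ω}

theorem posSemidef_secondMoment {ι : Type*} [Fintype ι] {X : Ω → EuclideanSpace ℝ ι}
    (hX : MemLp X 2 P) : (Matrix.of fun k l => ∫ ω, X ω k * X ω l ∂P).PosSemidef ∧
    ∀ t : EuclideanSpace ℝ ι, ∫ ω, (inner ℝ (X ω) t) ^ 2 ∂P
      = t.ofLp ⬝ᵥ (Matrix.of fun k l => ∫ ω, X ω k * X ω l ∂P).mulVec t.ofLp := by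
  have hk : ∀ k, MemLp (fun ω => X ω k) 2 P := fun k =>
    (EuclideanSpace.proj k : EuclideanSpace ℝ ι →L[ℝ] ℝ).comp_memLp' hX
  have hint : ∀ k l, Integrable (fun ω => X ω k * X ω l) P := fun k l =>
    (hk k).integrable_mul (hk l)
  have key : ∀ t : ι → ℝ, ∫ ω, (∑ k, X ω k * t k) ^ 2 ∂P
      = t ⬝ᵥ (Matrix.of fun k l => ∫ ω, X ω k * X ω l ∂P).mulVec t := by
    intro t
    have h1 : ∀ ω, (∑ k, X ω k * t k) ^ 2 = ∑ k, ∑ l, t k * t l * (X ω k * X ω l) := fun ω => by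
      rw [sq, Finset.sum_mul_sum]
      refine Finset.sum_congr rfl fun k _ => Finset.sum_congr rfl fun l _ => by ring
    simp_rw [h1]
    rw [integral_finsetSum _ fun k _ => integrable_finsetSum _ fun l _ => (hint k l).const_mul _]
    simp only [dotProduct, Matrix.mulVec, Matrix.of_apply]
    refine Finset.sum_congr rfl fun k _ => ?_
    rw [integral_finsetSum _ fun l _ => (hint k l).const_mul _, Finset.mul_sum]
    refine Finset.sum_congr rfl fun l _ => ?_
    rw [integral_const_mul]
    ring
  refine ⟨Matrix.PosSemidef.of_dotProduct_mulVec_nonneg ?_ fun t => ?_, fun t => ?_⟩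
  · ext k l
    simp [mul_comm]
  · rw [star_trivial, ← key]
    exact integral_nonneg fun ω => sq_nonneg _
  · rw [← key]
    simp [PiLp.inner_apply, mul_comm]

/-- Cramér–Wold through characteristic functions: a vector tested at frequency `t` is its projection
on `t` tested at frequency `1`, and the one-dimensional theorem applies to the projections. -/
theorem tendstoInDistribution_inv_sqrt_smul_sum [IsProbabilityMeasure P] {ι : Type*} [Fintype ι] [DecidableEq ι]
    {X : ℕ → Ω → EuclideanSpace ℝ ι} (hX : MemLp (X 0) 2 P) (h0 : ∫ ω, X 0 ω ∂P = 0)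
    (hindep : iIndepFun X P) (hident : ∀ i, IdentDistrib (X i) (X 0) P P) :
    TendstoInDistribution (fun (n : ℕ) ω => (√(n : ℝ))⁻¹ • ∑ i ∈ Finset.range n, X i ω) atTop id
      (fun _ => P) (multivariateGaussian 0 (Matrix.of fun k l => ∫ ω, X 0 ω k * X 0 ω l ∂P)) := by
  obtain ⟨hS, hquad⟩ := posSemidef_secondMoment hX
  set S := Matrix.of fun k l => ∫ ω, X 0 ω k * X 0 ω l ∂P
  have hmeas : ∀ n : ℕ, AEMeasurable
      (fun ω => (√(n : ℝ))⁻¹ • ∑ i ∈ Finset.range n, X i ω) P := fun n =>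
    (Finset.aemeasurable_fun_sum (Finset.range n)
      fun i _ => (hident i).aemeasurable_fst).const_smul (√(n : ℝ))⁻¹
  refine ⟨hmeas, aemeasurable_id, ?_⟩
  refine ProbabilityMeasure.tendsto_iff_tendsto_charFun.2 fun t => ?_
  have hin : ∀ x : EuclideanSpace ℝ ι, innerSL ℝ t x = inner ℝ x t := fun x => by
    rw [innerSL_apply_apply, real_inner_comm]
  set Y : ℕ → Ω → ℝ := fun i ω => inner ℝ (X i ω) t with hY
  have hYm : Measurable fun x : EuclideanSpace ℝ ι => inner ℝ x t := by fun_prop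
  have hY2 : MemLp (Y 0) 2 P := by
    have := (innerSL ℝ t).comp_memLp' hX
    simpa only [Function.comp_def, hin] using this
  have hYmean : ∫ ω, Y 0 ω ∂P = 0 := by
    have h1 := (innerSL ℝ t).integral_comp_comm (hX.integrable (by norm_num))
    simp only [hin, h0] at h1
    simpa using h1
  have hvar : Var[Y 0; P] = t.ofLp ⬝ᵥ S.mulVec t.ofLp := by
    rw [variance_of_integral_eq_zero hY2.aemeasurable hYmean]
    exact hquad t
  have hclt := tendstoInDistribution_inv_sqrt_mul_sum_sub (X := Y) (P := P)
    (P' := gaussianReal 0 Var[Y 0; P].toNNReal) (Y := id)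
    ⟨aemeasurable_id, Measure.map_id⟩ hY2
    (hindep.comp (fun _ x => inner ℝ x t) fun _ => hYm)
    (fun i => (hident i).comp hYm)
  have h1 := ProbabilityMeasure.tendsto_iff_tendsto_charFun.1 hclt.tendsto 1
  have hvar0 : 0 ≤ Var[Y 0; P] := variance_nonneg _ _
  have hgauss : charFun (multivariateGaussian 0 S) t
      = charFun (gaussianReal 0 Var[Y 0; P].toNNReal) 1 := by
    rw [charFun_multivariateGaussian hS, charFun_gaussianReal, Real.coe_toNNReal _ hvar0, hvar]
    simp
  have hseq : ∀ n : ℕ, charFun (P.map fun ω => (√(n : ℝ))⁻¹ • ∑ i ∈ Finset.range n, X i ω) t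
      = charFun (P.map fun ω => (√(n : ℝ))⁻¹ * (∑ i ∈ Finset.range n, Y i ω - n * P[Y 0])) 1 := by
    intro n
    have h2 : AEMeasurable (fun ω => (√(n : ℝ))⁻¹ *
        (∑ i ∈ Finset.range n, Y i ω - n * P[Y 0])) P := hclt.forall_aemeasurable n
    rw [charFun_apply, charFun_apply, integral_map (hmeas n) (by fun_prop),
      integral_map h2 (by fun_prop)]
    refine integral_congr_ae (ae_of_all _ fun ω => ?_)
    simp only [hYmean, mul_zero, sub_zero]
    simp [hY, sum_inner, real_inner_smul_left]
  simp only [ProbabilityMeasure.coe_mk, Measure.map_id] at h1 ⊢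
  rw [hgauss]
  exact h1.congr fun n => (hseq n).symm

end CLT

/-! ### Gaussian limit of the network at initialisation -/

namespace DecisionProblem

variable {dx da J : ℕ} (M : DecisionProblem dx da J)

variable {σ : ℝ → ℝ} {μ₀ : ProbabilityMeasure (Param dx da J)}
  {Ω : Type*} [MeasurableSpace Ω] {P : Measure Ω} {θ₀ : ℕ → Ω → Param dx da J} {s : ℕ → Ω → Fin (J + 1) → M.states}
  {act : ℕ → Ω → Fin J → M.actions}

theorem IsTrainingInput.identDistrib (hin : M.IsTrainingInput P μ₀ θ₀ s act) (i : ℕ) :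
    IdentDistrib (θ₀ i) (θ₀ 0) P P :=
  ⟨(hin.measurable_param i).aemeasurable, (hin.measurable_param 0).aemeasurable,
    by rw [hin.law_param, hin.law_param]⟩

/-- The values of a single hidden unit. -/
noncomputable def unitValue (σ : ℝ → ℝ) (θ : Param dx da J) :
    EuclideanSpace ℝ (Fin J × M.states × M.actions) :=
  WithLp.toLp 2 fun i => θ.1 i.1 * σ (inner ℝ θ.2 (M.pt i.2.1 i.2.2))

/-- Currying. -/
noncomputable def curryCLM :
    EuclideanSpace ℝ (Fin J × M.states × M.actions) →L[ℝ] M.QValues :=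
  ContinuousLinearMap.pi fun j => ContinuousLinearMap.pi fun x => ContinuousLinearMap.pi fun a =>
    (EuclideanSpace.proj (j, x, a) :
      EuclideanSpace ℝ (Fin J × M.states × M.actions) →L[ℝ] ℝ)

theorem curryCLM_apply (v : EuclideanSpace ℝ (Fin J × M.states × M.actions)) (j : Fin J)
    (x : M.states) (a : M.actions) : M.curryCLM v j x a = v (j, x, a) := rfl

theorem continuous_unitValue (hσ : Continuous σ) : Continuous (M.unitValue σ) := by
  unfold unitValue
  fun_prop

theorem qNet_eq_curryCLM (N : ℕ) (θ : ℕ → Param dx da J) :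
    M.qNet σ (fun i : Fin N => θ i)
      = M.curryCLM ((√(N : ℝ))⁻¹ • ∑ i ∈ Finset.range N, M.unitValue σ (θ i)) := by
  funext j x a
  rw [curryCLM_apply, PiLp.smul_apply, ← Fin.sum_univ_eq_sum_range (fun i => M.unitValue σ (θ i)),
    WithLp.ofLp_sum, Finset.sum_apply, qNet, one_div, smul_eq_mul]
  rfl

/-- Output and hidden weights are independent, so the mean factors, and the output factor is
centred. Without this the `N^(-1/2)` scaling would diverge. -/
theorem integral_unitValue (hσ : IsC2b σ) (hμ₀ : InitAssumption μ₀) :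
    MemLp (M.unitValue σ) 2 (μ₀ : Measure (Param dx da J)) ∧
      ∫ θ, M.unitValue σ θ ∂(μ₀ : Measure (Param dx da J)) = 0 := by
  obtain ⟨B, hB⟩ := hσ.2
  obtain ⟨C, hC⟩ := hμ₀.bounded
  have hcont := hσ.continuous
  have hmem : MemLp (M.unitValue σ) 2 (μ₀ : Measure (Param dx da J)) := by
    refine MemLp.of_eval_piLp fun i => ?_
    refine MemLp.of_bound (C := C * B) (Continuous.aestronglyMeasurable ?_) ?_
    · unfold unitValue
      fun_prop
    · filter_upwards [hC] with θ hθ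
      have h1 := hθ i.1
      have h2 := (hB (inner ℝ θ.2 (M.pt i.2.1 i.2.2))).1
      simp only [unitValue, Real.norm_eq_abs, abs_mul]
      exact mul_le_mul h1 h2 (abs_nonneg _) ((abs_nonneg _).trans h1)
  refine ⟨hmem, ?_⟩
  ext i
  have h1 := (EuclideanSpace.proj i :
    EuclideanSpace ℝ (Fin J × M.states × M.actions) →L[ℝ] ℝ).integral_comp_comm (hmem.integrable (by norm_num))
  refine h1.symm.trans ?_
  have h2 := (hμ₀.indep_hidden.comp (φ := fun c : Fin J → ℝ => c i.1)
    (ψ := fun w => σ (inner ℝ w (M.pt i.2.1 i.2.2))) (by fun_prop)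
    (Continuous.measurable (by fun_prop))).integral_fun_mul_eq_mul_integral
    (Continuous.aestronglyMeasurable (by fun_prop))
    (Continuous.aestronglyMeasurable (by fun_prop))
  simp only [Function.comp_def] at h2
  refine h2.trans ?_
  rw [hμ₀.mean_output, zero_mul]
  rfl

theorem exists_gaussian_limit [IsProbabilityMeasure P] (hσ : IsC2b σ) (hμ₀ : InitAssumption μ₀)
    (hin : M.IsTrainingInput P μ₀ θ₀ s act) :
    ∃ (𝒢 : Measure M.QValues) (_ : IsGaussian 𝒢),
      (∀ j x a, ∫ g, g j x a ∂𝒢 = 0) ∧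
      (∀ j x a j' x' a', ∫ g, g j x a * g j' x' a' ∂𝒢
        = ∫ θ, (θ.1 j * σ (inner ℝ θ.2 (M.pt x a))) * (θ.1 j' * σ (inner ℝ θ.2 (M.pt x' a')))
            ∂(μ₀ : Measure (Param dx da J))) ∧
      TendstoInDistribution (fun (N : ℕ+) ω => M.qNet σ (fun i : Fin N => θ₀ i ω)) atTop id
        (fun _ => P) 𝒢 := by
  classical
  obtain ⟨hmem, hmean⟩ := M.integral_unitValue hσ hμ₀
  have hum := (M.continuous_unitValue hσ.continuous).measurable
  set X : ℕ → Ω → EuclideanSpace ℝ (Fin J × M.states × M.actions) :=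
    fun i ω => M.unitValue σ (θ₀ i ω) with hX
  have hX2 : MemLp (X 0) 2 P := by
    refine MemLp.comp_of_map (g := M.unitValue σ) ?_ (hin.measurable_param 0).aemeasurable
    rwa [hin.law_param]
  have hX0 : ∫ ω, X 0 ω ∂P = 0 := by
    rw [← hmean, ← hin.law_param 0, integral_map (hin.measurable_param 0).aemeasurable
      hum.aestronglyMeasurable]
  have hclt := tendstoInDistribution_inv_sqrt_smul_sum hX2 hX0
    (hin.indep_param.comp (fun _ => M.unitValue σ) fun _ => hum)
    (fun i => (hin.identDistrib M i).comp hum)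
  obtain ⟨hS, -⟩ := posSemidef_secondMoment hX2
  set S := Matrix.of fun k l => ∫ ω, X 0 ω k * X 0 ω l ∂P with hSdef
  have hcurry : Measurable M.curryCLM := M.curryCLM.continuous.measurable
  have hgauss : IsGaussian ((multivariateGaussian 0 S).map M.curryCLM) := isGaussian_map _
  have hmean0 : ∀ k, ∫ v : EuclideanSpace ℝ (Fin J × M.states × M.actions), v k
      ∂(multivariateGaussian 0 S) = 0 := by
    intro k
    have h1 := (EuclideanSpace.proj k :
      EuclideanSpace ℝ (Fin J × M.states × M.actions) →L[ℝ] ℝ).integral_comp_comm (μ := multivariateGaussian 0 S) (φ := fun v => v)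
      IsGaussian.integrable_fun_id
    simp only [integral_id_multivariateGaussian] at h1
    simpa using h1
  refine ⟨(multivariateGaussian 0 S).map M.curryCLM, hgauss, ?_, ?_, ?_⟩
  · intro j x a
    rw [integral_map hcurry.aemeasurable (Continuous.aestronglyMeasurable (by fun_prop))]
    exact hmean0 (j, x, a)
  · intro j x a j' x' a'
    rw [integral_map hcurry.aemeasurable (Continuous.aestronglyMeasurable (by fun_prop))]
    have h1 := covariance_eval_multivariateGaussian (μ := 0) hS (j, x, a) (j', x', a')
    rw [covariance] at h1
    simp only [hmean0, sub_zero] at h1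
    simp only [curryCLM_apply]
    rw [h1, hSdef, Matrix.of_apply, ← hin.law_param 0,
      integral_map (hin.measurable_param 0).aemeasurable]
    · rfl
    · have hc := hσ.continuous
      exact Continuous.aestronglyMeasurable (by fun_prop)
  · have h1 := hclt.continuous_comp M.curryCLM.continuous
    have h2 : ∀ N : ℕ, (fun ω => M.qNet σ (fun i : Fin N => θ₀ i ω)) = M.curryCLM ∘
        fun ω => (√(N : ℝ))⁻¹ • ∑ i ∈ Finset.range N, X i ω := fun N => by
      funext ω
      exact M.qNet_eq_curryCLM N fun i => θ₀ i ω
    refine ⟨fun N => ?_, aemeasurable_id, ?_⟩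
    · rw [h2]
      exact h1.forall_aemeasurable N
    · have h3 := h1.tendsto.comp tendsto_PNat_val_atTop_atTop
      have h4 : (⟨((multivariateGaussian 0 S).map M.curryCLM).map id,
          Measure.isProbabilityMeasure_map aemeasurable_id⟩ : ProbabilityMeasure M.QValues)
          = ⟨(multivariateGaussian 0 S).map (M.curryCLM ∘ id),
            Measure.isProbabilityMeasure_map h1.aemeasurable_limit⟩ := Subtype.ext (by simp)
      rw [h4]
      refine h3.congr fun N => Subtype.ext ?_
      exact congrArg (fun f => P.map f) (h2 N).symm

end DecisionProblem

end QLearn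


namespace QLearn

/-! ### Empirical measures -/

theorem empirical_apply {S : Type*} [MeasurableSpace S] {N : ℕ} [NeZero N] (θ : Fin N → S)
    {B : Set S} (hB : MeasurableSet B) :
    (empirical θ : Measure S) B = (N : ℝ≥0∞)⁻¹ * ∑ i, B.indicator 1 (θ i) := by
  simp [empirical, Measure.dirac_apply' _ hB]

/-- Atoms of equal weight are matched one to one: if each moves by at most `δ`, any atom in `B` has
its partner in every thickening of `B` of radius larger than `δ`. -/
theorem edist_empirical_le {S : Type*} [MeasurableSpace S] [PseudoMetricSpace S]
    [OpensMeasurableSpace S] {N : ℕ} [NeZero N] {θ θ' : Fin N → S} {δ : ℝ}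
    (h : ∀ i, dist (θ i) (θ' i) ≤ δ) :
    edist (LevyProkhorov.ofMeasure (empirical θ)) (LevyProkhorov.ofMeasure (empirical θ'))
      ≤ ENNReal.ofReal δ := by
  rw [LevyProkhorov.edist_probabilityMeasure_def]
  refine levyProkhorovEDist_le_of_forall_le _ _ _ fun ε B hε hε' hB => ?_
  refine le_add_right ?_
  change (empirical θ : Measure S) B ≤ (empirical θ' : Measure S) _
  rw [empirical_apply θ hB, empirical_apply θ' Metric.isOpen_thickening.measurableSet]
  gcongr with i
  by_cases hi : θ i ∈ B
  · have : θ' i ∈ Metric.thickening ε.toReal B := by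
      refine Metric.mem_thickening_iff.2 ⟨θ i, hi, ?_⟩
      rw [dist_comm]
      refine (h i).trans_lt ?_
      rcases lt_or_ge δ 0 with hδ | hδ
      · exact absurd (dist_nonneg.trans (h i)) (not_le.2 hδ)
      · exact (ENNReal.ofReal_lt_iff_lt_toReal hδ hε'.ne).1 hε
    simp [hi, this]
  · simp [hi]

theorem continuous_empirical {S : Type*} [MeasurableSpace S] [PseudoMetricSpace S]
    [OpensMeasurableSpace S] {N : ℕ} [NeZero N] :
    Continuous fun θ : Fin N → S => LevyProkhorov.ofMeasure (empirical θ) := by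
  have : LipschitzWith 1 fun θ : Fin N → S => LevyProkhorov.ofMeasure (empirical θ) := by
    intro θ θ'
    refine (edist_empirical_le fun i => dist_le_pi_dist θ θ' i).trans ?_
    rw [← edist_dist]
    simp
  exact this.continuous

namespace DecisionProblem

variable {dx da J : ℕ} (M : DecisionProblem dx da J)

variable {μ₀ : ProbabilityMeasure (Param dx da J)}
  {Ω : Type*} [MeasurableSpace Ω] {P : Measure Ω} {θ₀ : ℕ → Ω → Param dx da J}
  {s : ℕ → Ω → Fin (J + 1) → M.states} {act : ℕ → Ω → Fin J → M.actions}

theorem ae_tendsto_average (hin : M.IsTrainingInput P μ₀ θ₀ s act) {f : Param dx da J → ℝ}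
    (hf : Measurable f) (hint : Integrable f (μ₀ : Measure (Param dx da J))) :
    ∀ᵐ ω ∂P, Tendsto (fun N : ℕ+ => (∑ i : Fin N, f (θ₀ i ω)) / (N : ℝ)) atTop
      (𝓝 (∫ θ, f θ ∂(μ₀ : Measure (Param dx da J)))) := by
  have h1 := strong_law_ae_real (μ := P) (fun i ω => f (θ₀ i ω))
    (by
      refine Integrable.comp_aemeasurable (g := f) ?_ (hin.measurable_param 0).aemeasurable
      rwa [hin.law_param])
    (fun i j hij => (hin.indep_param.indepFun hij).comp hf hf)
    (fun i => (hin.identDistrib M i).comp hf)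
  have h2 : ∫ ω, f (θ₀ 0 ω) ∂P = ∫ θ, f θ ∂(μ₀ : Measure (Param dx da J)) := by
    rw [← hin.law_param 0, integral_map (hin.measurable_param 0).aemeasurable
      hf.aestronglyMeasurable]
  filter_upwards [h1] with ω hω
  rw [h2] at hω
  refine (hω.comp tendsto_PNat_val_atTop_atTop).congr fun N => ?_
  simp only [Function.comp_apply]
  rw [← Fin.sum_univ_eq_sum_range (fun i => f (θ₀ i ω))]

/-- The finite intersections of a countable basis form a countable π-system of open sets. The strong
law holds on all of them simultaneously off one null set, and such a π-system determines weak
convergence. -/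
theorem ae_tendsto_empirical (hin : M.IsTrainingInput P μ₀ θ₀ s act) :
    ∀ᵐ ω ∂P, Tendsto (fun N : ℕ+ => LevyProkhorov.ofMeasure (empirical fun i : Fin N => θ₀ i ω))
      atTop (𝓝 (LevyProkhorov.ofMeasure μ₀)) := by
  set b := TopologicalSpace.countableBasis (Param dx da J) with hb
  have hbasis : TopologicalSpace.IsTopologicalBasis b :=
    TopologicalSpace.isBasis_countableBasis _
  set S : Set (Set (Param dx da J)) := (fun F => ⋂₀ F) '' {F | F.Finite ∧ F ⊆ b} with hS
  have hScount : S.Countable :=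
    (Set.countable_ofPred_finite_subset (TopologicalSpace.countable_countableBasis _)).image _
  have hSopen : ∀ t ∈ S, IsOpen t := by
    rintro _ ⟨F, ⟨hF, hFb⟩, rfl⟩
    exact hF.isOpen_sInter fun t ht => hbasis.isOpen (hFb ht)
  have hpi : IsPiSystem S := by
    rintro _ ⟨F, ⟨hF, hFb⟩, rfl⟩ _ ⟨G, ⟨hG, hGb⟩, rfl⟩ -
    exact ⟨F ∪ G, ⟨hF.union hG, union_subset hFb hGb⟩, sInter_union F G⟩
  have h1 : ∀ᵐ ω ∂P, ∀ t ∈ S, Tendsto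
      (fun N : ℕ+ => (∑ i : Fin N, t.indicator (fun _ => (1 : ℝ)) (θ₀ i ω)) / (N : ℝ)) atTop
      (𝓝 (∫ θ, t.indicator (fun _ => (1 : ℝ)) θ ∂(μ₀ : Measure (Param dx da J)))) := by
    rw [ae_ball_iff hScount]
    intro t ht
    have htm := (hSopen t ht).measurableSet
    exact M.ae_tendsto_average hin (measurable_const.indicator htm)
      ((integrable_const 1).indicator htm)
  filter_upwards [h1] with ω hω
  refine (LevyProkhorov.continuous_ofMeasure_probabilityMeasure.tendsto μ₀).comp ?_
  refine hpi.tendsto_probabilityMeasure_of_tendsto_of_mem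
    (fun t ht => (hSopen t ht).measurableSet) (fun u hu x hx => ?_) (fun t ht => ?_)
  · obtain ⟨t, htb, hxt, htu⟩ := hbasis.exists_subset_of_mem_open hx hu
    exact ⟨t, ⟨{t}, ⟨finite_singleton t, by simpa using htb⟩, by simp⟩,
      (hbasis.isOpen htb).mem_nhds hxt, htu⟩
  · have htm := (hSopen t ht).measurableSet
    rw [← NNReal.tendsto_coe]
    have h2 := hω t ht
    rw [integral_indicator htm] at h2
    simp only [integral_const, MeasurableSet.univ, measureReal_restrict_apply, univ_inter,
      smul_eq_mul, mul_one] at h2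
    refine h2.congr fun N => ?_
    change _ = ((empirical fun i : Fin N => θ₀ i ω : Measure (Param dx da J)) t).toReal
    rw [empirical_apply _ htm, ENNReal.toReal_mul, ENNReal.toReal_sum]
    · simp only [ENNReal.toReal_inv, ENNReal.toReal_natCast]
      rw [div_eq_inv_mul]
      congr 1
      refine Finset.sum_congr rfl fun i _ => ?_
      by_cases hi : θ₀ i ω ∈ t <;> simp [hi]
    · intro i _
      by_cases hi : θ₀ i ω ∈ t <;> simp [hi]

end DecisionProblem

end QLearn


namespace QLearn

/-! ### Elementary estimates for a single hidden unit -/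

theorem abs_sub_le_of_deriv_bound {τ : ℝ → ℝ} (hd : Differentiable ℝ τ) {B : ℝ}
    (hB : ∀ u, |deriv τ u| ≤ B) (u v : ℝ) : |τ u - τ v| ≤ B * |u - v| :=
  Convex.norm_image_sub_le_of_norm_deriv_le (s := univ) (fun x _ => hd x) (fun x _ => hB x)
    convex_univ (mem_univ v) (mem_univ u)

theorem abs_taylor_le {τ : ℝ → ℝ} (hd : Differentiable ℝ τ) {B : ℝ}
    (hl : ∀ u v, |deriv τ u - deriv τ v| ≤ B * |u - v|) (hB : 0 ≤ B) (u v : ℝ) :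
    |τ v - τ u - deriv τ u * (v - u)| ≤ B * |v - u| * |v - u| := by
  have hd' : ∀ x, HasDerivAt (fun x => τ x - deriv τ u * x) (deriv τ x - deriv τ u) x := fun x => by
    exact ((hd x).hasDerivAt.sub ((hasDerivAt_id x).const_mul (deriv τ u))).congr_deriv (by simp)
  have h := Convex.norm_image_sub_le_of_norm_hasDerivWithin_le (s := uIcc u v)
    (f := fun x => τ x - deriv τ u * x) (C := B * |v - u|)
    (fun x _ => (hd' x).hasDerivWithinAt) (fun x hx => (hl x u).trans
      (mul_le_mul_of_nonneg_left (abs_sub_left_of_mem_uIcc hx) hB)) (convex_uIcc u v) left_mem_uIcc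
      right_mem_uIcc
  rw [Real.norm_eq_abs, Real.norm_eq_abs] at h
  convert h using 2
  ring

section Unit

variable {E : Type*} [NormedAddCommGroup E] [InnerProductSpace ℝ E]

theorem abs_comp_inner_sub_le {τ : ℝ → ℝ} {B Z : ℝ} (hB : 0 ≤ B)
    (hl : ∀ u v, |τ u - τ v| ≤ B * |u - v|) {w w' ζ : E} (hζ : ‖ζ‖ ≤ Z) :
    |τ (inner ℝ w' ζ) - τ (inner ℝ w ζ)| ≤ B * Z * ‖w' - w‖ := by
  have h1 : |inner ℝ w' ζ - inner ℝ w ζ| ≤ ‖w' - w‖ * Z := by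
    rw [← inner_sub_left]
    exact (abs_real_inner_le_norm _ _).trans (by gcongr)
  calc _ ≤ B * |inner ℝ w' ζ - inner ℝ w ζ| := hl _ _
    _ ≤ B * (‖w' - w‖ * Z) := by gcongr
    _ = _ := by ring

theorem abs_mul_comp_inner_sub_le {τ : ℝ → ℝ} {B C Z : ℝ} (hb : ∀ u, |τ u| ≤ B)
    (hl : ∀ u v, |τ u - τ v| ≤ B * |u - v|) {c c' d : ℝ} {w w' ζ : E} (hζ : ‖ζ‖ ≤ Z)
    (hc : |c| ≤ C) (hcd : |c' - c| ≤ d) (hwd : ‖w' - w‖ ≤ d) :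
    |c' * τ (inner ℝ w' ζ) - c * τ (inner ℝ w ζ)| ≤ (B + C * B * Z) * d := by
  have hB : 0 ≤ B := (abs_nonneg _).trans (hb 0)
  have hC : 0 ≤ C := (abs_nonneg _).trans hc
  have hZ : 0 ≤ Z := (norm_nonneg _).trans hζ
  have h1 := abs_comp_inner_sub_le hB hl (w := w) (w' := w') hζ
  have h2 : c' * τ (inner ℝ w' ζ) - c * τ (inner ℝ w ζ)
      = (c' - c) * τ (inner ℝ w' ζ) + c * (τ (inner ℝ w' ζ) - τ (inner ℝ w ζ)) := by ring
  rw [h2]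
  refine (abs_add_le _ _).trans ?_
  rw [abs_mul, abs_mul]
  calc _ ≤ d * B + C * (B * Z * d) := by
        refine add_le_add (mul_le_mul hcd (hb _) (abs_nonneg _) ((abs_nonneg _).trans hcd)) ?_
        exact mul_le_mul hc (h1.trans (by gcongr)) (abs_nonneg _) hC
    _ = _ := by ring

/-- First-order expansion of a unit jointly in `(c, w)`. The remainder consists of the mixed term
`dc · dτ` and `c` times the Taylor remainder of `τ`, both quadratic in the displacement. -/
theorem abs_mul_comp_inner_taylor_le {τ : ℝ → ℝ} {B C Z : ℝ} (hd : Differentiable ℝ τ)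
    (hB : 0 ≤ B) (hl : ∀ u v, |τ u - τ v| ≤ B * |u - v|)
    (hl' : ∀ u v, |deriv τ u - deriv τ v| ≤ B * |u - v|)
    {c c' d : ℝ} {w w' ζ : E} (hζ : ‖ζ‖ ≤ Z)
    (hc : |c| ≤ C) (hcd : |c' - c| ≤ d) (hwd : ‖w' - w‖ ≤ d) :
    |c' * τ (inner ℝ w' ζ) - c * τ (inner ℝ w ζ)
      - ((c' - c) * τ (inner ℝ w ζ) + c * deriv τ (inner ℝ w ζ) * inner ℝ (w' - w) ζ)|
      ≤ (B * Z + C * B * Z ^ 2) * d ^ 2 := by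
  have hC : 0 ≤ C := (abs_nonneg _).trans hc
  have hZ : 0 ≤ Z := (norm_nonneg _).trans hζ
  have hd0 : 0 ≤ d := (abs_nonneg _).trans hcd
  have h1 := abs_comp_inner_sub_le hB hl (w := w) (w' := w') hζ
  have h2 := abs_taylor_le hd hl' hB (inner ℝ w ζ) (inner ℝ w' ζ)
  have h3 : |inner ℝ w' ζ - inner ℝ w ζ| ≤ d * Z := by
    rw [← inner_sub_left]
    exact (abs_real_inner_le_norm _ _).trans (by gcongr)
  have h4 : c' * τ (inner ℝ w' ζ) - c * τ (inner ℝ w ζ)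
      - ((c' - c) * τ (inner ℝ w ζ) + c * deriv τ (inner ℝ w ζ) * inner ℝ (w' - w) ζ)
      = (c' - c) * (τ (inner ℝ w' ζ) - τ (inner ℝ w ζ))
        + c * (τ (inner ℝ w' ζ) - τ (inner ℝ w ζ)
          - deriv τ (inner ℝ w ζ) * (inner ℝ w' ζ - inner ℝ w ζ)) := by
    rw [inner_sub_left]
    ring
  rw [h4]
  refine (abs_add_le _ _).trans ?_
  rw [abs_mul, abs_mul]
  calc _ ≤ d * (B * Z * d) + C * (B * (d * Z) * (d * Z)) := by
        refine add_le_add (mul_le_mul hcd (h1.trans (by gcongr)) (abs_nonneg _) hd0) ?_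
        refine mul_le_mul hc (h2.trans ?_) (abs_nonneg _) hC
        gcongr
    _ = _ := by ring

end Unit

theorem abs_mul_sub_mul_le {a a' b b' A B L L' d : ℝ} (ha : |a'| ≤ A) (hb : |b| ≤ B)
    (hda : |a' - a| ≤ L * d) (hdb : |b' - b| ≤ L' * d) :
    |a' * b' - a * b| ≤ (A * L' + B * L) * d := by
  have h : a' * b' - a * b = a' * (b' - b) + (a' - a) * b := by ring
  rw [h]
  refine (abs_add_le _ _).trans ?_
  rw [abs_mul, abs_mul]
  calc _ ≤ A * (L' * d) + (L * d) * B :=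
        add_le_add (mul_le_mul ha hdb (abs_nonneg _) ((abs_nonneg _).trans ha))
          (mul_le_mul hda hb (abs_nonneg _) ((abs_nonneg _).trans hda))
    _ = _ := by ring

namespace DecisionProblem

variable {dx da J : ℕ} (M : DecisionProblem dx da J)

/-- The kernel whose empirical average drives the network. -/
noncomputable def unitKernel (σ : ℝ → ℝ) (α : ℝ) (j j' : Fin J)
    (u v : EuclideanSpace ℝ (Fin dx ⊕ Fin da)) (θ : Param dx da J) : ℝ :=
  α * ((if j = j' then σ (inner ℝ θ.2 v) * σ (inner ℝ θ.2 u) else 0)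
    + (θ.1 j * deriv σ (inner ℝ θ.2 u)) * (θ.1 j' * deriv σ (inner ℝ θ.2 v)) * inner ℝ v u)

theorem exists_norm_pt_le : ∃ Z, 0 ≤ Z ∧ ∀ x a, ‖M.pt x a‖ ≤ Z := by
  obtain ⟨Z, hZ⟩ := (Set.finite_range fun p : M.states × M.actions => ‖M.pt p.1 p.2‖).bddAbove
  refine ⟨max Z 0, le_max_right _ _, fun x a => (hZ ⟨(x, a), rfl⟩).trans (le_max_left _ _)⟩

section Estimates

variable {M} {σ : ℝ → ℝ} {α B C Z R : ℝ}

/-- The kernel is quadratic in the output weights, so a Lipschitz bound needs both parameters in a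
bounded range of `c`; this is why the trajectory must be kept there. -/
theorem abs_unitKernel_sub_le (hb : ∀ u, |σ u| ≤ B) (hb' : ∀ u, |deriv σ u| ≤ B)
    (hl : ∀ u v, |σ u - σ v| ≤ B * |u - v|)
    (hl' : ∀ u v, |deriv σ u - deriv σ v| ≤ B * |u - v|) (hα : 0 ≤ α)
    (j j' : Fin J) {u v : EuclideanSpace ℝ (Fin dx ⊕ Fin da)} (hu : ‖u‖ ≤ Z) (hv : ‖v‖ ≤ Z)
    {θ θ' : Param dx da J} (hθ : ∀ j, |θ.1 j| ≤ C) (hθ' : ∀ j, |θ'.1 j| ≤ C) :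
    |unitKernel σ α j j' u v θ' - unitKernel σ α j j' u v θ|
      ≤ α * (2 * B ^ 2 * Z + 2 * C * B * (B + C * B * Z) * Z ^ 2) * ‖θ' - θ‖ := by
  have hB : 0 ≤ B := (abs_nonneg _).trans (hb 0)
  have hC : 0 ≤ C := (abs_nonneg _).trans (hθ j)
  have hZ : 0 ≤ Z := (norm_nonneg _).trans hu
  have hc : ∀ j, |θ'.1 j - θ.1 j| ≤ ‖θ' - θ‖ := fun j =>
    (norm_le_pi_norm (θ'.1 - θ.1) j).trans (norm_fst_le (θ' - θ))
  have hw : ‖θ'.2 - θ.2‖ ≤ ‖θ' - θ‖ := norm_snd_le (θ' - θ)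
  set d := ‖θ' - θ‖
  have h1 : |(if j = j' then σ (inner ℝ θ'.2 v) * σ (inner ℝ θ'.2 u) else 0)
      - (if j = j' then σ (inner ℝ θ.2 v) * σ (inner ℝ θ.2 u) else 0)| ≤ 2 * B ^ 2 * Z * d := by
    split_ifs
    · have := abs_mul_sub_mul_le (d := d) (hb (inner ℝ θ'.2 v)) (hb (inner ℝ θ.2 u))
        ((abs_comp_inner_sub_le hB hl (w := θ.2) (w' := θ'.2) hv).trans (by gcongr))
        ((abs_comp_inner_sub_le hB hl (w := θ.2) (w' := θ'.2) hu).trans (by gcongr))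
      refine this.trans (le_of_eq (by ring))
    · rw [sub_zero, abs_zero]
      positivity
  have hbd : ∀ (θ : Param dx da J), (∀ j, |θ.1 j| ≤ C) → ∀ j (x : ℝ),
      |θ.1 j * deriv σ x| ≤ C * B := fun θ hθ j x => by
    rw [abs_mul]
    exact mul_le_mul (hθ j) (hb' _) (abs_nonneg _) hC
  have h2 := abs_mul_sub_mul_le (d := d) (hbd θ' hθ' j (inner ℝ θ'.2 u))
    (hbd θ hθ j' (inner ℝ θ.2 v))
    (abs_mul_comp_inner_sub_le hb' hl' hu (hθ j) (hc j) hw)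
    (abs_mul_comp_inner_sub_le hb' hl' hv (hθ j') (hc j') hw)
  have h3 : |inner ℝ v u| ≤ Z ^ 2 := by
    refine (abs_real_inner_le_norm _ _).trans ?_
    rw [sq]
    gcongr
  simp only [unitKernel]
  rw [← mul_sub, abs_mul, abs_of_nonneg hα, mul_assoc α]
  refine mul_le_mul_of_nonneg_left ?_ hα
  rw [add_sub_add_comm, ← sub_mul]
  refine (abs_add_le _ _).trans ?_
  rw [abs_mul]
  calc _ ≤ 2 * B ^ 2 * Z * d
        + ((C * B * (B + C * B * Z) + C * B * (B + C * B * Z)) * d) * Z ^ 2 := by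
        refine add_le_add h1 (mul_le_mul h2 h3 (abs_nonneg _) (by positivity))
    _ = _ := by ring

/-- Size of one update of the parameters. -/
theorem norm_step_sub_le (hb : ∀ u, |σ u| ≤ B) (hb' : ∀ u, |deriv σ u| ≤ B) (hα : 0 ≤ α)
    (hpt : ∀ x a, ‖M.pt x a‖ ≤ Z) (hR0 : 0 ≤ R)
    (hR : ∀ (q : M.QValues) (e : M.Episode) (j : Fin J), |M.tdError q e.1 e.2 j| ≤ R * (1 + ‖q‖))
    {N : ℕ} (e : M.Episode) {θ : Fin N → Param dx da J} (hC : 0 ≤ C)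
    (hθ : ∀ i j, |(θ i).1 j| ≤ C) (i : Fin N) :
    ‖M.step σ (α / N) e.1 e.2 θ i - θ i‖
      ≤ α / N / √(N : ℝ) * ((R * B + J * (R * C * B * Z)) * (1 + ‖M.qNet σ θ‖)) := by
  have hB : 0 ≤ B := (abs_nonneg _).trans (hb 0)
  have hZ : 0 ≤ Z := (norm_nonneg _).trans (hpt (Classical.arbitrary _) (Classical.arbitrary _))
  set q := M.qNet σ θ with hq
  have hlr : 0 ≤ α / N / √(N : ℝ) := by positivity
  set l := α / N / √(N : ℝ) with hl
  have hq0 : 0 ≤ ‖q‖ := norm_nonneg _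
  rw [norm_prod_le_iff]
  constructor
  · refine (pi_norm_le_iff_of_nonneg (by positivity)).2 fun j => ?_
    simp only [step, Prod.fst_sub, Pi.sub_apply, add_sub_cancel_left, ← hq, ← hl,
      Real.norm_eq_abs, abs_mul, abs_of_nonneg hlr]
    rw [mul_assoc]
    refine mul_le_mul_of_nonneg_left ?_ hlr
    calc _ ≤ (R * (1 + ‖q‖)) * B :=
          mul_le_mul (hR q e j) (hb _) (abs_nonneg _) (by positivity)
      _ ≤ R * (1 + ‖q‖) * B + J * (R * C * B * Z) * (1 + ‖q‖) := by
          have : 0 ≤ J * (R * C * B * Z) * (1 + ‖q‖) := by positivity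
          linarith
      _ = _ := by ring
  · simp only [step, Prod.snd_sub, add_sub_cancel_left, ← hq, ← hl]
    rw [norm_smul, Real.norm_of_nonneg hlr]
    refine mul_le_mul_of_nonneg_left ?_ hlr
    calc _ ≤ ∑ j : Fin J, (R * (1 + ‖q‖)) * C * B * Z := by
          refine norm_sum_le_of_le _ fun j _ => ?_
          rw [norm_smul, Real.norm_eq_abs, abs_mul, abs_mul]
          have h1 := hR q e j
          have h2 := hθ i j
          have h3 := hb' (inner ℝ (θ i).2 (M.pt (e.1 j.castSucc) (e.2 j)))
          have h4 := hpt (e.1 j.castSucc) (e.2 j)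
          gcongr
      _ = J * (R * C * B * Z) * (1 + ‖q‖) := by
          rw [Finset.sum_const, Finset.card_univ, Fintype.card_fin, nsmul_eq_mul]
          ring
      _ ≤ (R * B + J * (R * C * B * Z)) * (1 + ‖q‖) := by
          have : 0 ≤ R * B := by positivity
          gcongr
          linarith

/-- `N` units under the prefactor `1/√N` cost a factor `√N`, which turns a unit displacement of
order `N^(-3/2)` into a network change of order `1/N`. -/
theorem norm_qNet_sub_le (hb : ∀ u, |σ u| ≤ B) (hl : ∀ u v, |σ u - σ v| ≤ B * |u - v|)
    (hpt : ∀ x a, ‖M.pt x a‖ ≤ Z) {N : ℕ} {θ θ' : Fin N → Param dx da J} (hC : 0 ≤ C)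
    (hθ : ∀ i j, |(θ i).1 j| ≤ C) {d : ℝ} (hd0 : 0 ≤ d) (hd : ∀ i, ‖θ' i - θ i‖ ≤ d) :
    ‖M.qNet σ θ' - M.qNet σ θ‖ ≤ √(N : ℝ) * ((B + C * B * Z) * d) := by
  have hB : 0 ≤ B := (abs_nonneg _).trans (hb 0)
  have hZ : 0 ≤ Z := (norm_nonneg _).trans (hpt (Classical.arbitrary _) (Classical.arbitrary _))
  refine M.norm_le_of_apply (by positivity) fun j x a => ?_
  simp only [Pi.sub_apply, qNet]
  rw [← mul_sub, ← Finset.sum_sub_distrib, abs_mul, abs_of_nonneg (by positivity)]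
  have h1 : |∑ i, ((θ' i).1 j * σ (inner ℝ (θ' i).2 (M.pt x a))
      - (θ i).1 j * σ (inner ℝ (θ i).2 (M.pt x a)))| ≤ N * ((B + C * B * Z) * d) := by
    refine (Finset.abs_sum_le_sum_abs _ _).trans ?_
    calc _ ≤ ∑ _i : Fin N, (B + C * B * Z) * d := by
          refine Finset.sum_le_sum fun i _ => ?_
          exact abs_mul_comp_inner_sub_le hb hl (hpt x a) (hθ i j)
            (((norm_le_pi_norm ((θ' i).1 - (θ i).1) j).trans
              (norm_fst_le (θ' i - θ i))).trans (hd i))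
            ((norm_snd_le (θ' i - θ i)).trans (hd i))
      _ = _ := by simp
  calc _ ≤ 1 / √(N : ℝ) * (N * ((B + C * B * Z) * d)) := by gcongr
    _ = N / √(N : ℝ) * ((B + C * B * Z) * d) := by ring
    _ = _ := by rw [Real.div_sqrt]

/-- The increment of the network in one step, up to second order. -/
theorem abs_qNet_step_sub_le (hσd : Differentiable ℝ σ) (hb : ∀ u, |σ u| ≤ B)
    (hl : ∀ u v, |σ u - σ v| ≤ B * |u - v|)
    (hl' : ∀ u v, |deriv σ u - deriv σ v| ≤ B * |u - v|)
    (hpt : ∀ x a, ‖M.pt x a‖ ≤ Z) {N : ℕ} (hN : 0 < N) (e : M.Episode)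
    {θ : Fin N → Param dx da J}
    (hθ : ∀ i j, |(θ i).1 j| ≤ C) {d : ℝ}
    (hd : ∀ i, ‖M.step σ (α / N) e.1 e.2 θ i - θ i‖ ≤ d) (j : Fin J) (x : M.states)
    (a : M.actions) :
    |M.qNet σ (M.step σ (α / N) e.1 e.2 θ) j x a - M.qNet σ θ j x a
      - 1 / N * ∑ j', M.tdError (M.qNet σ θ) e.1 e.2 j' * ((∑ i, unitKernel σ α j j' (M.pt x a)
        (M.pt (e.1 j'.castSucc) (e.2 j')) (θ i)) / N)|
      ≤ √(N : ℝ) * ((B * Z + C * B * Z ^ 2) * d ^ 2) := by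
  have hB : 0 ≤ B := (abs_nonneg _).trans (hb 0)
  have hNr : (0 : ℝ) < N := Nat.cast_pos.2 hN
  set θ' := M.step σ (α / N) e.1 e.2 θ with hθ'
  set q := M.qNet σ θ with hq
  set ζ := M.pt x a
  -- The linear part is exactly the kernel. The output weight of level `j` is updated only by the
  -- error at time `j`, hence the `if`; the shared hidden weight is updated by the errors at all
  -- times.
  have hlin : ∀ i, ((θ' i).1 j - (θ i).1 j) * σ (inner ℝ (θ i).2 ζ)
      + (θ i).1 j * deriv σ (inner ℝ (θ i).2 ζ) * inner ℝ ((θ' i).2 - (θ i).2) ζ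
      = 1 / N / √(N : ℝ) * ∑ j', M.tdError q e.1 e.2 j' * unitKernel σ α j j' ζ
        (M.pt (e.1 j'.castSucc) (e.2 j')) (θ i) := by
    intro i
    simp only [hθ', step, add_sub_cancel_left, ← hq, unitKernel]
    rw [real_inner_smul_left, sum_inner]
    simp_rw [real_inner_smul_left, mul_add]
    rw [Finset.sum_add_distrib, mul_add]
    congr 1
    · simp only [mul_ite, mul_zero, Finset.sum_ite_eq, Finset.mem_univ, if_true]
      ring
    · rw [Finset.mul_sum, Finset.mul_sum, Finset.mul_sum]
      refine Finset.sum_congr rfl fun j' _ => ?_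
      ring
  have hsum : M.qNet σ θ' j x a - q j x a
      - 1 / N * ∑ j', M.tdError q e.1 e.2 j' * ((∑ i, unitKernel σ α j j' ζ
        (M.pt (e.1 j'.castSucc) (e.2 j')) (θ i)) / N)
      = 1 / √(N : ℝ) * ∑ i, ((θ' i).1 j * σ (inner ℝ (θ' i).2 ζ) - (θ i).1 j * σ (inner ℝ (θ i).2 ζ)
        - (((θ' i).1 j - (θ i).1 j) * σ (inner ℝ (θ i).2 ζ)
          + (θ i).1 j * deriv σ (inner ℝ (θ i).2 ζ) * inner ℝ ((θ' i).2 - (θ i).2) ζ)) := by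
    rw [Finset.sum_sub_distrib, Finset.sum_sub_distrib]
    simp_rw [hlin]
    rw [← Finset.mul_sum, Finset.sum_comm]
    simp_rw [← Finset.mul_sum]
    have h5 : ∑ j', M.tdError q e.1 e.2 j' * ((∑ i, unitKernel σ α j j' ζ
        (M.pt (e.1 j'.castSucc) (e.2 j')) (θ i)) / N)
        = 1 / N * ∑ j', M.tdError q e.1 e.2 j' * ∑ i, unitKernel σ α j j' ζ
        (M.pt (e.1 j'.castSucc) (e.2 j')) (θ i) := by
      rw [Finset.mul_sum]
      exact Finset.sum_congr rfl fun _ _ => by ring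
    rw [h5, mul_sub, mul_sub]
    change _ = (M.qNet σ θ' j x a - q j x a) - _
    congr 1
    have h6 : √(N : ℝ) * √(N : ℝ) = N := Real.mul_self_sqrt hNr.le
    have h7 : (1 : ℝ) / N = 1 / √(N : ℝ) * (1 / √(N : ℝ)) := by
      rw [← h6]
      field_simp
      simp
    rw [← mul_assoc, ← mul_assoc]
    congr 1
    rw [div_div, mul_comm (N : ℝ), ← one_div_mul_one_div, ← mul_assoc, ← h7]
  rw [hsum, abs_mul, abs_of_nonneg (by positivity)]
  have h1 : ∀ i, |(θ' i).1 j * σ (inner ℝ (θ' i).2 ζ) - (θ i).1 j * σ (inner ℝ (θ i).2 ζ)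
        - (((θ' i).1 j - (θ i).1 j) * σ (inner ℝ (θ i).2 ζ)
          + (θ i).1 j * deriv σ (inner ℝ (θ i).2 ζ) * inner ℝ ((θ' i).2 - (θ i).2) ζ)|
      ≤ (B * Z + C * B * Z ^ 2) * d ^ 2 := fun i =>
    abs_mul_comp_inner_taylor_le hσd hB hl hl' (hpt x a) (hθ i j)
      (((norm_le_pi_norm ((θ' i).1 - (θ i).1) j).trans (norm_fst_le (θ' i - θ i))).trans (hd i))
      ((norm_snd_le (θ' i - θ i)).trans (hd i))
  calc _ ≤ 1 / √(N : ℝ) * (N * ((B * Z + C * B * Z ^ 2) * d ^ 2)) := by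
        gcongr
        refine (Finset.abs_sum_le_sum_abs _ _).trans ((Finset.sum_le_sum fun i _ => h1 i).trans ?_)
        simp
    _ = N / √(N : ℝ) * ((B * Z + C * B * Z ^ 2) * d ^ 2) := by ring
    _ = _ := by rw [Real.div_sqrt]

end Estimates

end DecisionProblem

end QLearn


namespace QLearn

/-! ### Deterministic control of the trained network up to `N T` updates -/

namespace DecisionProblem

variable {dx da J : ℕ} (M : DecisionProblem dx da J) {σ : ℝ → ℝ} {α : ℝ}
  {μ₀ : ProbabilityMeasure (Param dx da J)}

theorem continuous_unitKernel (hσ : IsC2b σ) (α : ℝ) (j j' : Fin J)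
    (u v : EuclideanSpace ℝ (Fin dx ⊕ Fin da)) : Continuous (unitKernel σ α j j' u v) := by
  have h1 := hσ.continuous
  have h2 := hσ.continuous_deriv
  unfold unitKernel
  split_ifs <;> fun_prop

theorem integrable_unitKernel (hσ : IsC2b σ) (hμ₀ : InitAssumption μ₀) (j j' : Fin J)
    (u v : EuclideanSpace ℝ (Fin dx ⊕ Fin da)) :
    Integrable (unitKernel σ α j j' u v) (μ₀ : Measure (Param dx da J)) := by
  refine Integrable.const_mul (Integrable.add ?_ ?_) α
  · split_ifs
    · exact integrable_sigma_mul_sigma hσ v u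
    · exact integrable_zero _ _ _
  · refine (integrable_output_mul_deriv hσ hμ₀ j j' v u).congr (ae_of_all _ fun θ => ?_)
    ring

/-- For `j ≠ j'` the mean carries the factor `E[C^j C^j'] = E[C^j] E[C^j'] = 0`, so in the limit the
shared hidden layer does not couple the time levels. -/
theorem integral_unitKernel (hσ : IsC2b σ) (hμ₀ : InitAssumption μ₀) (j j' : Fin J)
    (x : M.states) (a : M.actions) (x' : M.states) (a' : M.actions) :
    ∫ θ, unitKernel σ α j j' (M.pt x a) (M.pt x' a') θ ∂(μ₀ : Measure (Param dx da J))
      = if j = j' then M.tensorA σ α μ₀ j x a x' a' else 0 := by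
  have hc := hσ.continuous_deriv
  have h1 : ∀ i i', ∫ θ : Param dx da J, (θ.1 i * deriv σ (inner ℝ θ.2 (M.pt x a)))
      * (θ.1 i' * deriv σ (inner ℝ θ.2 (M.pt x' a'))) * inner ℝ (M.pt x' a') (M.pt x a)
        ∂(μ₀ : Measure (Param dx da J))
      = ∫ θ : Param dx da J, θ.1 i * θ.1 i' * deriv σ (inner ℝ θ.2 (M.pt x' a'))
        * deriv σ (inner ℝ θ.2 (M.pt x a)) * inner ℝ (M.pt x' a') (M.pt x a)
        ∂(μ₀ : Measure (Param dx da J)) := fun i i' =>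
    integral_congr_ae (ae_of_all _ fun θ => by ring)
  simp only [unitKernel]
  rw [integral_const_mul]
  split_ifs with hj
  · subst hj
    rw [integral_add (integrable_sigma_mul_sigma hσ _ _)
      ((integrable_output_mul_deriv hσ hμ₀ j j (M.pt x' a') (M.pt x a)).congr
        (ae_of_all _ fun θ => by ring)), h1, mul_add, tensorA]
    simp_rw [sq]
  · simp_rw [zero_add]
    have h2 := (hμ₀.indep_hidden.comp (φ := fun c : Fin J → ℝ => c j * c j')
      (ψ := fun w => deriv σ (inner ℝ w (M.pt x' a')) * deriv σ (inner ℝ w (M.pt x a))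
        * inner ℝ (M.pt x' a') (M.pt x a)) (by fun_prop)
      (Continuous.measurable (by fun_prop))).integral_fun_mul_eq_mul_integral
      (Continuous.aestronglyMeasurable (by fun_prop))
      (Continuous.aestronglyMeasurable (by fun_prop))
    have h3 := (hμ₀.indep_output.indepFun hj).integral_fun_mul_eq_mul_integral
      (Continuous.aestronglyMeasurable (by fun_prop))
      (Continuous.aestronglyMeasurable (by fun_prop))
    simp only [Function.comp_def] at h2
    rw [h3, hμ₀.mean_output, zero_mul, zero_mul] at h2
    refine mul_eq_zero_of_right _ (Eq.trans ?_ h2)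
    exact integral_congr_ae (ae_of_all _ fun θ => by ring)

theorem one_add_div_pow_le {D T : ℝ} (hD : 0 ≤ D) {N k : ℕ} (hN : 0 < N)
    (hk : (k : ℝ) ≤ N * T) : (1 + D / N) ^ k ≤ Real.exp (D * T) := by
  have hNr : (0 : ℝ) < N := Nat.cast_pos.2 hN
  calc (1 + D / N) ^ k ≤ Real.exp (D / N) ^ k := by
        gcongr
        linarith [Real.add_one_le_exp (D / N)]
    _ = Real.exp (k * (D / N)) := (Real.exp_nat_mul _ _).symm
    _ ≤ Real.exp (D * T) := by
        refine Real.exp_le_exp.2 ?_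
        calc k * (D / N) ≤ N * T * (D / N) := by gcongr
          _ = D * T := by field_simp

-- A bootstrap, with no probability in it. While output weights are bounded, a step multiplies `1 +
-- ‖q‖` by at most `1 + D₂ / N`, which compounds to a constant over `N T` steps; a bounded network
-- in turn keeps every unit within `D / √N` of its start, so the output weights do stay bounded. The
-- last clause expresses each network increment by the limiting drift, given that the initial kernel
-- averages are within `η` of their means.
set_option maxHeartbeats 1000000 in
theorem exists_trajectory_bound (hσ : IsC2b σ) (hα : 0 ≤ α) {C₀ L T : ℝ} (hC₀ : 0 ≤ C₀)
    (hL : 0 ≤ L) (hT : 0 ≤ T) :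
    ∃ Q D K : ℝ, ∃ N₀ : ℕ, 0 ≤ Q ∧ 0 ≤ D ∧ 0 ≤ K ∧ ∀ N : ℕ, N₀ ≤ N → 0 < N →
      ∀ (s : ℕ → Fin (J + 1) → M.states) (act : ℕ → Fin J → M.actions)
        (θ : Fin N → Param dx da J), (∀ i j, |(θ i).1 j| ≤ C₀) → ‖M.qNet σ θ‖ ≤ L →
      ∀ k : ℕ, (k : ℝ) ≤ N * T →
        ‖M.qNet σ (M.train σ (α / N) s act θ k)‖ ≤ Q ∧
        (∀ i, ‖M.train σ (α / N) s act θ k i - θ i‖ ≤ D / √(N : ℝ)) ∧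
        ∀ η : ℝ, 0 ≤ η → (∀ j j' x a x' a', |(∑ i, unitKernel σ α j j' (M.pt x a) (M.pt x' a') (θ i)) / N
            - (if j = j' then M.tensorA σ α μ₀ j x a x' a' else 0)| ≤ η) →
          ‖M.qNet σ (M.train σ (α / N) s act θ (k + 1)) - M.qNet σ (M.train σ (α / N) s act θ k)
            - (1 / N : ℝ) • M.episodeField σ α μ₀ (s k, act k)
              (M.qNet σ (M.train σ (α / N) s act θ k))‖ ≤ 1 / N * (K * (1 / √(N : ℝ) + η)) := by
  obtain ⟨B, hB⟩ := hσ.2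
  obtain ⟨Z, hZ, hpt⟩ := M.exists_norm_pt_le
  obtain ⟨R, hR0, hR⟩ := M.exists_abs_tdError_le
  have hb : ∀ u, |σ u| ≤ B := fun u => (hB u).1
  have hb' : ∀ u, |deriv σ u| ≤ B := fun u => (hB u).2.1
  have hB0 : 0 ≤ B := (abs_nonneg _).trans (hb 0)
  have hl := abs_sub_le_of_deriv_bound hσ.differentiable hb'
  have hl' := abs_sub_le_of_deriv_bound (hσ.contDiff_deriv.differentiable one_ne_zero)
    fun u => (hB u).2.2
  -- One unit of room for the output weights. All later constants are computed from `C`, and `D / √N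
  -- ≤ 1`, that is `N ≥ D²`, ensures that the room is never exhausted.
  set C := C₀ + 1 with hCdef
  have hC : 0 ≤ C := by positivity
  set D₁ := R * B + J * (R * C * B * Z) with hD₁
  have hD₁0 : 0 ≤ D₁ := by positivity
  set D₂ := α * ((B + C * B * Z) * D₁) with hD₂
  have hD₂0 : 0 ≤ D₂ := by positivity
  set Q := (1 + L) * Real.exp (D₂ * T) with hQ
  have hQ0 : 0 ≤ Q := by positivity
  set D := T * (α * (D₁ * (1 + Q))) with hD
  have hD0 : 0 ≤ D := by positivity
  set Λ := α * (2 * B ^ 2 * Z + 2 * C * B * (B + C * B * Z) * Z ^ 2) with hΛ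
  have hΛ0 : 0 ≤ Λ := by positivity
  set K₂ := B * Z + C * B * Z ^ 2 with hK₂
  have hK₂0 : 0 ≤ K₂ := by positivity
  set K := K₂ * (α * (D₁ * (1 + Q))) ^ 2 + J * (R * (1 + Q) * (Λ * D + 1)) with hK
  refine ⟨Q, D, K, ⌈D ^ 2⌉₊, hQ0, hD0, by positivity, fun N hN₀ hN s act θ hθ hq => ?_⟩
  have hNr : (0 : ℝ) < N := Nat.cast_pos.2 hN
  have hsq : 0 < √(N : ℝ) := Real.sqrt_pos.2 hNr
  have hmul : √(N : ℝ) * √(N : ℝ) = N := Real.mul_self_sqrt hNr.le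
  have hDN : D / √(N : ℝ) ≤ 1 := by
    rw [div_le_one hsq]
    exact Real.le_sqrt_of_sq_le ((Nat.le_ceil _).trans (Nat.cast_le.2 hN₀))
  set l := α / N / √(N : ℝ) with hldef
  have hl0 : 0 ≤ l := by positivity
  have hsl : √(N : ℝ) * l = α / N := by
    rw [hldef]
    field_simp
  set τ := M.train σ (α / N) s act θ with hτ
  have hstep : ∀ k, τ (k + 1) = M.step σ (α / N) (s k) (act k) (τ k) := fun k => rfl
  have hdisp : ∀ k : ℕ, (k : ℝ) ≤ N * T → k * (l * (D₁ * (1 + Q))) ≤ D / √(N : ℝ) := by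
    intro k hk
    calc k * (l * (D₁ * (1 + Q))) ≤ N * T * (l * (D₁ * (1 + Q))) := by gcongr
      _ = D / √(N : ℝ) := by rw [hldef, hD]; field_simp
  have hout : ∀ k : ℕ, (k : ℝ) ≤ N * T → (∀ i, ‖τ k i - θ i‖ ≤ k * (l * (D₁ * (1 + Q)))) →
      ∀ i j, |(τ k i).1 j| ≤ C := by
    intro k hk h i j
    have h1 : |(τ k i).1 j - (θ i).1 j| ≤ 1 :=
      ((norm_le_pi_norm ((τ k i).1 - (θ i).1) j).trans (norm_fst_le (τ k i - θ i))).trans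
        ((h i).trans ((hdisp k hk).trans hDN))
    have h2 := abs_sub_abs_le_abs_sub ((τ k i).1 j) ((θ i).1 j)
    linarith [hθ i j]
  have hQk : ∀ k : ℕ, (k : ℝ) ≤ N * T →
      1 + ‖M.qNet σ (τ k)‖ ≤ (1 + L) * (1 + D₂ / N) ^ k → ‖M.qNet σ (τ k)‖ ≤ Q := by
    intro k hk h
    have h1 := one_add_div_pow_le hD₂0 hN hk
    have h2 : (1 + L) * (1 + D₂ / N) ^ k ≤ Q := by
      rw [hQ]
      gcongr
    linarith
  -- Both bounds must travel in one induction: the network bound uses the output bound that follows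
  -- from the displacement, and the displacement bound uses the network bound.
  have hinv : ∀ k : ℕ, (k : ℝ) ≤ N * T → 1 + ‖M.qNet σ (τ k)‖ ≤ (1 + L) * (1 + D₂ / N) ^ k ∧
      ∀ i, ‖τ k i - θ i‖ ≤ k * (l * (D₁ * (1 + Q))) := by
    intro k
    induction k with
    | zero =>
      intro _
      refine ⟨?_, fun i => ?_⟩
      · simpa [hτ, train] using hq
      · simp [hτ, train]
    | succ k ih =>
      intro hk
      have hk' : (k : ℝ) ≤ N * T := by
        push_cast at hk
        linarith
      obtain ⟨ih1, ih2⟩ := ih hk'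
      have hCk := hout k hk' ih2
      have hs := norm_step_sub_le hb hb' hα hpt hR0 hR (s k, act k) hC hCk
      simp only [← hstep] at hs
      have hqs := norm_qNet_sub_le hb hl hpt hC hCk (θ' := τ (k + 1)) (by positivity) hs
      constructor
      · have h1 : √(N : ℝ) * ((B + C * B * Z) * (l * (D₁ * (1 + ‖M.qNet σ (τ k)‖))))
            = D₂ / N * (1 + ‖M.qNet σ (τ k)‖) := by
          calc _ = (√(N : ℝ) * l) * ((B + C * B * Z) * D₁ * (1 + ‖M.qNet σ (τ k)‖)) := by ring
            _ = _ := by rw [hsl, hD₂]; ring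
        rw [h1] at hqs
        have h2 := norm_sub_norm_le (M.qNet σ (τ (k + 1))) (M.qNet σ (τ k))
        calc 1 + ‖M.qNet σ (τ (k + 1))‖ ≤ (1 + D₂ / N) * (1 + ‖M.qNet σ (τ k)‖) := by linarith
          _ ≤ (1 + D₂ / N) * ((1 + L) * (1 + D₂ / N) ^ k) := by gcongr
          _ = _ := by ring
      · intro i
        have h2 := norm_sub_le_norm_sub_add_norm_sub (τ (k + 1) i) (τ k i) (θ i)
        have h3 : l * (D₁ * (1 + ‖M.qNet σ (τ k)‖)) ≤ l * (D₁ * (1 + Q)) := by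
          gcongr
          exact hQk k hk' ih1
        have h4 := hs i
        have h5 := ih2 i
        push_cast
        linarith
  intro k hk
  obtain ⟨h1, h2⟩ := hinv k hk
  have hqk := hQk k hk h1
  have hCk := hout k hk h2
  refine ⟨hqk, fun i => (h2 i).trans (hdisp k hk), fun η hη0 hη => ?_⟩
  have hd : ∀ i, ‖M.step σ (α / N) (s k) (act k) (τ k) i - τ k i‖ ≤ l * (D₁ * (1 + Q)) := by
    intro i
    refine (norm_step_sub_le hb hb' hα hpt hR0 hR (s k, act k) hC hCk i).trans ?_
    gcongr
  set q := M.qNet σ (τ k) with hqdef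
  refine M.norm_le_of_apply (by positivity) fun j x a => ?_
  have h3 := abs_qNet_step_sub_le hσ.differentiable hb hl hl' hpt hN (s k, act k) hCk hd j x a
  have h4 : √(N : ℝ) * (K₂ * (l * (D₁ * (1 + Q))) ^ 2)
      ≤ 1 / N * (K₂ * (α * (D₁ * (1 + Q))) ^ 2 * (1 / √(N : ℝ))) := by
    have h5 : √(N : ℝ) * l ^ 2 ≤ 1 / N * (α ^ 2 * (1 / √(N : ℝ))) := by
      have h6 : √(N : ℝ) * l ^ 2 = α / N * l := by rw [← hsl]; ring
      rw [h6, hldef]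
      have h7 : (1 : ℝ) ≤ N := Nat.one_le_cast.2 hN
      calc α / N * (α / N / √(N : ℝ)) = 1 / N * (α ^ 2 * (1 / √(N : ℝ))) * (1 / N) := by ring
        _ ≤ 1 / N * (α ^ 2 * (1 / √(N : ℝ))) * 1 := by
            gcongr
            rw [div_le_one hNr]
            exact h7
        _ = _ := mul_one _
    calc _ = (√(N : ℝ) * l ^ 2) * (K₂ * (D₁ * (1 + Q)) ^ 2) := by ring
      _ ≤ 1 / N * (α ^ 2 * (1 / √(N : ℝ))) * (K₂ * (D₁ * (1 + Q)) ^ 2) := by gcongr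
      _ = _ := by ring
  have h5 : ∀ j' : Fin J, |(∑ i, unitKernel σ α j j' (M.pt x a)
      (M.pt (s k j'.castSucc) (act k j')) (τ k i)) / N
      - (if j = j' then M.tensorA σ α μ₀ j x a (s k j'.castSucc) (act k j') else 0)|
      ≤ Λ * (D / √(N : ℝ)) + η := by
    intro j'
    -- Kernel averages along training are compared with those at initialisation, where `hη` speaks.
    have h6 : |(∑ i, unitKernel σ α j j' (M.pt x a)
      (M.pt (s k j'.castSucc) (act k j')) (τ k i)) / N - (∑ i, unitKernel σ α j j' (M.pt x a)
      (M.pt (s k j'.castSucc) (act k j')) (θ i)) / N| ≤ Λ * (D / √(N : ℝ)) := by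
      rw [← sub_div, ← Finset.sum_sub_distrib, abs_div, abs_of_pos hNr, div_le_iff₀ hNr]
      refine (Finset.abs_sum_le_sum_abs _ _).trans ?_
      calc _ ≤ ∑ _i : Fin N, Λ * (D / √(N : ℝ)) := by
            refine Finset.sum_le_sum fun i _ => ?_
            refine (abs_unitKernel_sub_le hb hb' hl hl' hα j j' (hpt _ _) (hpt _ _)
              (fun j => (hθ i j).trans (by rw [hCdef]; linarith)) (hCk i)).trans ?_
            gcongr
            exact (h2 i).trans (hdisp k hk)
        _ = _ := by
            simp
            ring
    have h7 := hη j j' x a (s k j'.castSucc) (act k j')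
    exact (abs_sub_le _ _ _).trans (add_le_add h6 h7)
  have h6 : M.episodeField σ α μ₀ (s k, act k) q j x a = ∑ j', M.tdError q (s k) (act k) j'
      * (if j = j' then M.tensorA σ α μ₀ j x a (s k j'.castSucc) (act k j') else 0) := by
    simp [episodeField]
  simp only [Pi.sub_apply, Pi.smul_apply, smul_eq_mul]
  have h7 : |1 / (N : ℝ) * ∑ j', M.tdError q (s k) (act k) j' * ((∑ i, unitKernel σ α j j'
        (M.pt x a) (M.pt (s k j'.castSucc) (act k j')) (τ k i)) / N)
      - 1 / N * M.episodeField σ α μ₀ (s k, act k) q j x a|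
      ≤ 1 / N * (J * (R * (1 + Q) * (Λ * (D / √(N : ℝ)) + η))) := by
    rw [h6, ← mul_sub, ← Finset.sum_sub_distrib, abs_mul, abs_of_nonneg (by positivity)]
    gcongr
    refine (Finset.abs_sum_le_sum_abs _ _).trans ?_
    calc _ ≤ ∑ _j : Fin J, R * (1 + Q) * (Λ * (D / √(N : ℝ)) + η) := by
          refine Finset.sum_le_sum fun j' _ => ?_
          rw [← mul_sub, abs_mul]
          refine mul_le_mul ((hR q (s k, act k) j').trans ?_) (h5 j') (abs_nonneg _)
            (by positivity)
          gcongr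
      _ = _ := by simp
  have h34 := h3.trans h4
  clear_value K₂ Λ D₁ D
  have h8 := abs_sub_le (M.qNet σ (τ (k + 1)) j x a - q j x a) (1 / (N : ℝ) *
    ∑ j', M.tdError q (s k) (act k) j' * ((∑ i, unitKernel σ α j j'
        (M.pt x a) (M.pt (s k j'.castSucc) (act k j')) (τ k i)) / N))
    (1 / N * M.episodeField σ α μ₀ (s k, act k) q j x a)
  refine h8.trans ((add_le_add h34 h7).trans ?_)
  rw [← mul_add]
  refine mul_le_mul_of_nonneg_left ?_ (by positivity)
  -- `h9`–`h11` are the surplus cross terms created by bounding everything by the single product `K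
  -- * (1 / √N + η)`.
  have h9 : 0 ≤ K₂ * (α * (D₁ * (1 + Q))) ^ 2 * η := by positivity
  have h10 : 0 ≤ J * (R * (1 + Q) * (Λ * D * η)) := by positivity
  have h11 : 0 ≤ J * (R * (1 + Q) * (1 / √(N : ℝ))) := by positivity
  have h12 : K * (1 / √(N : ℝ) + η) = K₂ * (α * (D₁ * (1 + Q))) ^ 2 * (1 / √(N : ℝ))
      + J * (R * (1 + Q) * (Λ * (D / √(N : ℝ)) + η)) + K₂ * (α * (D₁ * (1 + Q))) ^ 2 * η
      + J * (R * (1 + Q) * (Λ * D * η)) + J * (R * (1 + Q) * (1 / √(N : ℝ))) := by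
    rw [hK]
    ring
  linarith

end DecisionProblem

end QLearn


namespace QLearn

/-! ### Sums of centred innovations -/

section Innovation

variable {Ω A B : Type*} [MeasurableSpace Ω] [MeasurableSpace A] [MeasurableSpace B]
  {P : Measure Ω}

/-- The sequence `x`, with the terms from index `k` on erased. -/
noncomputable def truncate [Inhabited B] (k : ℕ) (x : ℕ → B) : ℕ → B :=
  fun l => if l < k then x l else default

theorem truncate_truncate {B : Type*} [Inhabited B] {l k : ℕ} (h : l ≤ k) (x : ℕ → B) :
    truncate l (truncate k x) = truncate l x := by
  funext m
  unfold truncate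
  split_ifs <;> first | rfl | omega

theorem measurable_truncate [Inhabited B] (k : ℕ) :
    Measurable (truncate k : (ℕ → B) → ℕ → B) := by
  refine measurable_pi_lambda _ fun l => ?_
  unfold truncate
  split_ifs
  · exact measurable_pi_apply l
  · exact measurable_const

/-- Both hypotheses say that the joint law is a product; reassociating the triple product moves `X`
to the other side. -/
theorem indepFun_prodMk_left_of_indepFun {C : Type*} [MeasurableSpace C] [IsProbabilityMeasure P]
    {U : Ω → A} {X : Ω → B} {Y : Ω → C} (hU : Measurable U) (hX : Measurable X)
    (hY : Measurable Y) (hXY : IndepFun X Y P) (h : IndepFun U (fun ω => (X ω, Y ω)) P) :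
    IndepFun (fun ω => (U ω, X ω)) Y P := by
  have hUX : IndepFun U X P := h.comp measurable_id measurable_fst
  have := Measure.isProbabilityMeasure_map (μ := P) hU.aemeasurable
  have := Measure.isProbabilityMeasure_map (μ := P) hX.aemeasurable
  have := Measure.isProbabilityMeasure_map (μ := P) hY.aemeasurable
  rw [indepFun_iff_map_prod_eq_prod_map_map (by fun_prop) (by fun_prop)] at *
  rw [hXY] at h
  rw [hUX]
  have h1 := Measure.prodAssoc_prod (μ := P.map U) (ν := P.map X) (τ := P.map Y)
  rw [← h] at h1
  have h2 := congrArg (Measure.map (MeasurableEquiv.prodAssoc (α := A) (β := B) (γ := C)).symm) h1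
  rw [Measure.map_map (MeasurableEquiv.measurable _) (MeasurableEquiv.measurable _),
    Measure.map_map (MeasurableEquiv.measurable _) (by fun_prop)] at h2
  simpa [Function.comp_def, MeasurableEquiv.prodAssoc, Measure.map_id'] using h2.symm

/-- The past is encoded as a full sequence with the future erased, so all times share one state
space; it replaces a filtration, and this independence replaces conditional expectation. -/
theorem indepFun_prodMk_truncate [Inhabited B] [IsProbabilityMeasure P] {U : Ω → A}
    {ξ : ℕ → Ω → B} (hU : Measurable U) (hξ : ∀ k, Measurable (ξ k)) (hind : iIndepFun ξ P)
    (hUξ : IndepFun U (fun ω k => ξ k ω) P) (k : ℕ) :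
    IndepFun (fun ω => (U ω, truncate k fun l => ξ l ω)) (ξ k) P := by
  have hm : Measurable fun ω l => ξ l ω := measurable_pi_lambda _ hξ
  refine indepFun_prodMk_left_of_indepFun hU ((measurable_truncate k).comp hm) (hξ k) ?_ ?_
  · have h1 := hind.indepFun_finset (Finset.range k) {k} (by simp) hξ
    have hφ : Measurable fun (y : Finset.range k → B) (l : ℕ) =>
        if h : l ∈ Finset.range k then y ⟨l, h⟩ else default := by
      refine measurable_pi_lambda _ fun l => ?_
      split_ifs
      · exact measurable_pi_apply _
      · exact measurable_const
    have hψ : Measurable fun y : ({k} : Finset ℕ) → B => y ⟨k, by simp⟩ := measurable_pi_apply _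
    refine (h1.comp hφ hψ).congr (ae_of_all _ fun ω => ?_) (ae_of_all _ fun ω => rfl)
    funext l
    simp [truncate]
  · exact hUξ.comp (φ := id) (ψ := fun x : ℕ → B => (truncate k x, x k)) measurable_id
      ((measurable_truncate k).prodMk (measurable_pi_apply k))

variable [Fintype B] [MeasurableSingletonClass B] [Inhabited B]

/-- A function of the new variable `ξ k` and of the past that is centred in `ξ k` is orthogonal to
every bounded function of the past. -/
theorem integral_past_mul_innovation [IsProbabilityMeasure P] {U : Ω → A}
    {ξ : ℕ → Ω → B} (hU : Measurable U) (hξ : ∀ k, Measurable (ξ k)) (hind : iIndepFun ξ P)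
    (hUξ : IndepFun U (fun ω k => ξ k ω) P) (k : ℕ) {p : B → ℝ}
    (hp : ∀ v, P.real {ω | ξ k ω = v} = p v) {f : A × (ℕ → B) → ℝ} (hf : Measurable f)
    {R : ℝ} (hfR : ∀ z, |f z| ≤ R) {D : A × (ℕ → B) → B → ℝ} (hD : ∀ v, Measurable fun z => D z v)
    {K : ℝ} (hDK : ∀ z v, |D z v| ≤ K) (hD0 : ∀ z, ∑ v, p v * D z v = 0) :
    ∫ ω, f (U ω, truncate k fun l => ξ l ω) * D (U ω, truncate k fun l => ξ l ω) (ξ k ω) ∂P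
      = 0 := by
  classical
  set X : Ω → A × (ℕ → B) := fun ω => (U ω, truncate k fun l => ξ l ω) with hXdef
  have hX : Measurable X := hU.prodMk ((measurable_truncate k).comp (measurable_pi_lambda _ hξ))
  have hI : IndepFun X (ξ k) P := indepFun_prodMk_truncate hU hξ hind hUξ k
  have hint : ∀ v, Integrable (fun ω => f (X ω) * D (X ω) v) P := fun v =>
    Integrable.of_bound ((hf.mul (hD v)).comp hX).aestronglyMeasurable (R * K)
      (ae_of_all _ fun ω => by
        rw [Real.norm_eq_abs, abs_mul]
        exact mul_le_mul (hfR _) (hDK _ _) (abs_nonneg _) ((abs_nonneg _).trans (hfR (X ω))))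
  have hmv : ∀ v, MeasurableSet {ω | ξ k ω = v} := fun v => hξ k (measurableSet_singleton v)
  have h1 : ∀ v, ∫ ω, f (X ω) * D (X ω) v * ({v} : Set B).indicator 1 (ξ k ω) ∂P
      = (∫ ω, f (X ω) * D (X ω) v ∂P) * p v := by
    intro v
    have h2 : IndepFun (fun ω => f (X ω) * D (X ω) v)
        (fun ω => ({v} : Set B).indicator (1 : B → ℝ) (ξ k ω)) P :=
      hI.comp (φ := fun z => f z * D z v) (ψ := ({v} : Set B).indicator (1 : B → ℝ))
        (hf.mul (hD v)) (measurable_one.indicator (measurableSet_singleton v))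
    rw [h2.integral_fun_mul_eq_mul_integral (hint v).aestronglyMeasurable
      ((measurable_one.indicator (measurableSet_singleton v)).comp (hξ k)).aestronglyMeasurable]
    congr 1
    have h3 : (fun ω => ({v} : Set B).indicator (1 : B → ℝ) (ξ k ω))
        = {ω | ξ k ω = v}.indicator 1 := by
      funext ω
      simp [Set.indicator_apply]
    rw [h3, integral_indicator_one (hmv v), hp v]
  -- `ξ k` takes finitely many values: summing over them separates the past from the indicators of
  -- `ξ k = v`, and independence turns these into the weights `p v`.
  have h4 : ∀ ω, f (X ω) * D (X ω) (ξ k ω)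
      = ∑ v, f (X ω) * D (X ω) v * ({v} : Set B).indicator 1 (ξ k ω) := by
    intro ω
    rw [Finset.sum_eq_single (ξ k ω)] <;> simp +contextual [eq_comm]
  change ∫ ω, f (X ω) * D (X ω) (ξ k ω) ∂P = 0
  simp only [h4]
  rw [integral_finsetSum]
  · simp only [h1]
    have h5 : ∀ v, (∫ ω, f (X ω) * D (X ω) v ∂P) * p v
        = ∫ ω, f (X ω) * (p v * D (X ω) v) ∂P := by
      intro v
      rw [← integral_mul_const]
      exact integral_congr_ae (ae_of_all _ fun ω => by ring)
    simp only [h5]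
    rw [← integral_finsetSum]
    · simp [← Finset.mul_sum, hD0]
    · intro v _
      refine ((hint v).mul_const (p v)).congr (ae_of_all _ fun ω => ?_)
      ring
  · intro v _
    exact (hint v).mul_bdd (c := 1)
      ((measurable_one.indicator (measurableSet_singleton v)).comp (hξ k)).aestronglyMeasurable
      (ae_of_all _ fun ω => by
        by_cases h : ξ k ω = v <;> simp [h])

/-- Each new term is orthogonal to the sum of the earlier ones, so second moments add. -/
theorem integral_sq_sum_innovation_le [IsProbabilityMeasure P] {U : Ω → A}
    {ξ : ℕ → Ω → B} (hU : Measurable U) (hξ : ∀ k, Measurable (ξ k)) (hind : iIndepFun ξ P)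
    (hUξ : IndepFun U (fun ω k => ξ k ω) P) {p : B → ℝ}
    (hp : ∀ k v, P.real {ω | ξ k ω = v} = p v)
    {D : ℕ → A × (ℕ → B) → B → ℝ} (hD : ∀ k v, Measurable fun z => D k z v)
    {K : ℝ} (hDK : ∀ k z v, |D k z v| ≤ K) (hD0 : ∀ k z, ∑ v, p v * D k z v = 0) (n : ℕ) :
    ∫ ω, (∑ k ∈ Finset.range n, D k (U ω, truncate k fun l => ξ l ω) (ξ k ω)) ^ 2 ∂P
      ≤ n * K ^ 2 := by
  have hDm : ∀ k, Measurable fun q : (A × (ℕ → B)) × B => D k q.1 q.2 := fun k =>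
    measurable_from_prod_countable_left (hD k)
  have hdm : ∀ k, Measurable fun ω => D k (U ω, truncate k fun l => ξ l ω) (ξ k ω) := fun k =>
    (hDm k).comp ((hU.prodMk ((measurable_truncate k).comp (measurable_pi_lambda _ hξ))).prodMk
      (hξ k))
  have hSb : ∀ n ω, |∑ k ∈ Finset.range n, D k (U ω, truncate k fun l => ξ l ω) (ξ k ω)|
      ≤ n * K := fun n ω =>
    (Finset.abs_sum_le_sum_abs _ _).trans
      ((Finset.sum_le_sum fun k _ => hDK k _ _).trans (by simp))
  have hint : ∀ {f : Ω → ℝ} {R : ℝ}, Measurable f → (∀ ω, |f ω| ≤ R) → Integrable f P :=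
    fun hf hR => Integrable.of_bound hf.aestronglyMeasurable _ (ae_of_all _ hR)
  have hsq : ∀ {x R : ℝ}, |x| ≤ R → x ^ 2 ≤ R ^ 2 := fun {x R} h =>
    sq_le_sq' (abs_le.1 h).1 (abs_le.1 h).2
  induction n with
  | zero => simp
  | succ n ih =>
    set S : Ω → ℝ := fun ω =>
      ∑ k ∈ Finset.range n, D k (U ω, truncate k fun l => ξ l ω) (ξ k ω) with hS
    have hSm : Measurable S := Finset.measurable_sum _ fun k _ => hdm k
    have hcross : ∫ ω, S ω * D n (U ω, truncate n fun l => ξ l ω) (ξ n ω) ∂P = 0 := by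
      -- The partial sum up to `n` is a function of the past at `n`: shorter truncations and the
      -- values `ξ k`, `k < n`, can be recovered from the sequence truncated at `n`.
      have h := integral_past_mul_innovation hU hξ hind hUξ n (hp n)
        (f := fun z => ∑ k ∈ Finset.range n, D k (z.1, truncate k z.2) (z.2 k)) ?_ (R := n * K)
        ?_ (hD n) (hDK n) (hD0 n)
      · rw [← h]
        refine integral_congr_ae (ae_of_all _ fun ω => congrArg (· * _) ?_)
        simp only [hS]
        refine Finset.sum_congr rfl fun k hk => ?_
        have hk' := Finset.mem_range.1 hk
        rw [truncate_truncate hk'.le]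
        simp [truncate, hk']
      · refine Finset.measurable_sum _ fun k _ => ?_
        have h : Measurable fun z : A × (ℕ → B) => ((z.1, truncate k z.2), z.2 k) :=
          (measurable_fst.prodMk ((measurable_truncate k).comp measurable_snd)).prodMk
            ((measurable_pi_apply k).comp measurable_snd)
        exact (hDm k).comp h
      · intro z
        exact (Finset.abs_sum_le_sum_abs _ _).trans
          ((Finset.sum_le_sum fun k _ => hDK k _ _).trans (by simp))
    have hexp : ∀ ω, (∑ k ∈ Finset.range (n + 1), D k (U ω, truncate k fun l => ξ l ω) (ξ k ω)) ^ 2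
        = S ω ^ 2 + 2 * (S ω * D n (U ω, truncate n fun l => ξ l ω) (ξ n ω))
          + D n (U ω, truncate n fun l => ξ l ω) (ξ n ω) ^ 2 := by
      intro ω
      rw [Finset.sum_range_succ]
      ring
    have i1 : Integrable (fun ω => S ω ^ 2) P := hint (R := (n * K) ^ 2) (hSm.pow_const 2)
      fun ω => by rw [abs_pow]; exact pow_le_pow_left₀ (abs_nonneg _) (hSb n ω) 2
    have i2 : Integrable (fun ω => 2 * (S ω * D n (U ω, truncate n fun l => ξ l ω) (ξ n ω))) P :=
      (hint (R := n * K * K) (hSm.mul (hdm n)) fun ω => by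
        rw [Pi.mul_apply, abs_mul]
        exact mul_le_mul (hSb n ω) (hDK _ _ _) (abs_nonneg _)
          ((abs_nonneg _).trans (hSb n ω))).const_mul 2
    have i3 : Integrable (fun ω => D n (U ω, truncate n fun l => ξ l ω) (ξ n ω) ^ 2) P :=
      hint (R := K ^ 2) ((hdm n).pow_const 2)
        fun ω => by rw [abs_pow]; exact pow_le_pow_left₀ (abs_nonneg _) (hDK _ _ _) 2
    simp only [hexp]
    rw [integral_add (i1.fun_add i2) i3, integral_add i1 i2, integral_const_mul, hcross]
    have h3 : ∫ ω, D n (U ω, truncate n fun l => ξ l ω) (ξ n ω) ^ 2 ∂P ≤ K ^ 2 := by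
      refine (integral_mono i3 (integrable_const (K ^ 2)) fun ω => hsq (hDK _ _ _)).trans ?_
      simp
    push_cast
    linarith

end Innovation

/-! ### A maximal inequality for slowly varying sequences -/

section Maximal

variable {Ω : Type*} [MeasurableSpace Ω] {P : Measure Ω}

/-- Increments are at most `K`, so once `|S|` reaches `a` it stays above `a / 2` for the next `a /
(2 K)` steps. The sum of squares is then at least of order `a³ / K`, and Markov's inequality for
that sum uses only second moments at fixed times. -/
theorem measureReal_exists_le_abs_le [IsProbabilityMeasure P] {S : ℕ → Ω → ℝ}
    (hS : ∀ k, Measurable (S k)) {K : ℝ} (hK : 0 < K) (h0 : ∀ ω, S 0 ω = 0)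
    (hlip : ∀ k ω, |S (k + 1) ω - S k ω| ≤ K) (hsq : ∀ k, ∫ ω, S k ω ^ 2 ∂P ≤ k * K ^ 2)
    (n : ℕ) {a : ℝ} (ha : 0 < a) :
    P.real {ω | ∃ k ≤ n, a ≤ |S k ω|} ≤ 8 * K ^ 3 * (n + a / (2 * K) + 1) ^ 2 / a ^ 3 := by
  set H : ℕ := ⌊a / (2 * K)⌋₊ with hH
  have ha2 : 0 ≤ a / (2 * K) := by positivity
  have hH1 : (H : ℝ) ≤ a / (2 * K) := Nat.floor_le ha2
  have hH2 : a / (2 * K) < H + 1 := Nat.lt_floor_add_one _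
  have hlip' : ∀ ω k m, |S (k + m) ω - S k ω| ≤ m * K := by
    intro ω k m
    induction m with
    | zero => simp
    | succ m ih =>
      have := hlip (k + m) ω
      have h3 := abs_sub_le (S (k + (m + 1)) ω) (S (k + m) ω) (S k ω)
      push_cast
      rw [← add_assoc] at h3 ⊢
      linarith
  have hb : ∀ k ω, |S k ω| ≤ k * K := by
    intro k ω
    have := hlip' ω 0 k
    simpa [h0] using this
  have hint : ∀ k, Integrable (fun ω => S k ω ^ 2) P := fun k =>
    Integrable.of_bound ((hS k).pow_const 2).aestronglyMeasurable ((k * K) ^ 2)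
      (ae_of_all _ fun ω => by
        rw [Real.norm_eq_abs, abs_pow]
        exact pow_le_pow_left₀ (abs_nonneg _) (hb k ω) 2)
  set Y : Ω → ℝ := fun ω => ∑ m ∈ Finset.range (n + H + 1), S m ω ^ 2 with hY
  have hYint : Integrable Y P := integrable_finsetSum _ fun m _ => hint m
  have hYle : ∫ ω, Y ω ∂P ≤ (n + H + 1) ^ 2 * K ^ 2 := by
    rw [hY, integral_finsetSum _ fun m _ => hint m]
    calc ∑ m ∈ Finset.range (n + H + 1), ∫ ω, S m ω ^ 2 ∂P
        ≤ ∑ m ∈ Finset.range (n + H + 1), ((n + H + 1 : ℕ) : ℝ) * K ^ 2 := by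
          refine Finset.sum_le_sum fun m hm => (hsq m).trans ?_
          have : (m : ℝ) ≤ ((n + H + 1 : ℕ) : ℝ) := by
            exact_mod_cast (Finset.mem_range.1 hm).le
          gcongr
      _ = (n + H + 1) ^ 2 * K ^ 2 := by
          simp
          ring
  have hsub : {ω | ∃ k ≤ n, a ≤ |S k ω|} ⊆ {ω | a ^ 3 / (8 * K) ≤ Y ω} := by
    rintro ω ⟨k, hk, hka⟩
    have h1 : ∀ m ∈ Finset.range (H + 1), (a / 2) ^ 2 ≤ S (k + m) ω ^ 2 := by
      intro m hm
      have hm' : (m : ℝ) ≤ a / (2 * K) :=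
        le_trans (by exact_mod_cast Nat.lt_succ_iff.1 (Finset.mem_range.1 hm)) hH1
      have hmK : m * K ≤ a / 2 := by
        calc m * K ≤ a / (2 * K) * K := by gcongr
          _ = a / 2 := by field_simp
      have h2 := hlip' ω k m
      have h3 : a / 2 ≤ |S (k + m) ω| := by
        have := abs_sub_abs_le_abs_sub (S k ω) (S (k + m) ω)
        rw [abs_sub_comm] at this
        linarith
      rw [← sq_abs (S (k + m) ω)]
      exact pow_le_pow_left₀ (by positivity) h3 2
    have h2 : (H + 1) * (a / 2) ^ 2 ≤ ∑ m ∈ Finset.range (H + 1), S (k + m) ω ^ 2 := by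
      refine le_trans (le_of_eq ?_) (Finset.sum_le_sum h1)
      simp
    have h3 : ∑ m ∈ Finset.range (H + 1), S (k + m) ω ^ 2 ≤ Y ω := by
      have h4 : ∑ m ∈ Finset.range (H + 1), S (k + m) ω ^ 2
          = ∑ m ∈ Finset.Ico k (k + (H + 1)), S m ω ^ 2 := by
        rw [Finset.sum_Ico_eq_sum_range]
        simp
      rw [h4]
      refine Finset.sum_le_sum_of_subset_of_nonneg ?_ fun m _ _ => sq_nonneg _
      intro m hm
      rw [Finset.mem_Ico] at hm
      rw [Finset.mem_range]
      omega
    refine le_trans ?_ (h2.trans h3)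
    calc a ^ 3 / (8 * K) = a / (2 * K) * (a / 2) ^ 2 := by field_simp; ring
      _ ≤ (H + 1) * (a / 2) ^ 2 := by gcongr
  have hmk := mul_meas_ge_le_integral_of_nonneg (μ := P) (f := Y)
    (ae_of_all _ fun ω => Finset.sum_nonneg fun m _ => sq_nonneg _) hYint (a ^ 3 / (8 * K))
  have hle : P.real {ω | ∃ k ≤ n, a ≤ |S k ω|} ≤ P.real {ω | a ^ 3 / (8 * K) ≤ Y ω} :=
    measureReal_mono hsub
  have h5 : a ^ 3 / (8 * K) * P.real {ω | ∃ k ≤ n, a ≤ |S k ω|}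
      ≤ (n + a / (2 * K) + 1) ^ 2 * K ^ 2 := by
    calc a ^ 3 / (8 * K) * P.real {ω | ∃ k ≤ n, a ≤ |S k ω|}
        ≤ a ^ 3 / (8 * K) * P.real {ω | a ^ 3 / (8 * K) ≤ Y ω} := by gcongr
      _ ≤ (n + H + 1) ^ 2 * K ^ 2 := hmk.trans hYle
      _ ≤ _ := by gcongr
  rw [le_div_iff₀ (by positivity)]
  have h6 : 8 * K * (a ^ 3 / (8 * K) * P.real {ω | ∃ k ≤ n, a ≤ |S k ω|})
      = P.real {ω | ∃ k ≤ n, a ≤ |S k ω|} * a ^ 3 := by field_simp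
  rw [← h6]
  calc _ ≤ 8 * K * ((n + a / (2 * K) + 1) ^ 2 * K ^ 2) := by gcongr
    _ = _ := by ring

/-- Partial sums of innovations, one sequence for each `N`, are `o(N)` uniformly on `[0, N T]`. -/
theorem tendsto_measure_exists_le_abs [IsProbabilityMeasure P] {S : ℕ+ → ℕ → Ω → ℝ}
    (hS : ∀ N k, Measurable (S N k)) {K : ℝ} (hK : 0 < K) (h0 : ∀ N ω, S N 0 ω = 0)
    (hlip : ∀ N k ω, |S N (k + 1) ω - S N k ω| ≤ K)
    (hsq : ∀ N k, ∫ ω, S N k ω ^ 2 ∂P ≤ k * K ^ 2) {T : ℝ} (hT : 0 ≤ T) {ε : ℝ} (hε : 0 < ε) :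
    Tendsto (fun N : ℕ+ => P {ω | ∃ k : ℕ, (k : ℝ) ≤ N * T ∧ N * ε ≤ |S N k ω|}) atTop (𝓝 0) := by
  have hN : Tendsto (fun N : ℕ+ => ((N : ℕ) : ℝ)) atTop atTop :=
    tendsto_natCast_atTop_atTop.comp tendsto_PNat_val_atTop_atTop
  -- With `n ≤ N T` and `a = N ε` the maximal bound is of order `N² / N³`, that is at most `c / N`.
  set c : ℝ := 8 * K ^ 3 * (T + ε / (2 * K) + 1) ^ 2 / ε ^ 3 with hc
  have hlim : Tendsto (fun N : ℕ+ => ENNReal.ofReal (c / (N : ℕ))) atTop (𝓝 0) := by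
    rw [← ENNReal.ofReal_zero]
    exact (ENNReal.continuous_ofReal.tendsto 0).comp (hN.const_div_atTop c)
  refine tendsto_of_tendsto_of_tendsto_of_le_of_le tendsto_const_nhds hlim (fun _ => bot_le)
    fun N => ?_
  have hNpos : (0 : ℝ) < (N : ℕ) := by exact_mod_cast N.pos
  have hN1 : (1 : ℝ) ≤ (N : ℕ) := by exact_mod_cast N.pos
  have hset : {ω | ∃ k : ℕ, (k : ℝ) ≤ N * T ∧ N * ε ≤ |S N k ω|}
      = {ω | ∃ k ≤ ⌊(N : ℕ) * T⌋₊, (N : ℕ) * ε ≤ |S N k ω|} := by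
    ext ω
    simp only [Set.mem_ofPred_eq]
    refine exists_congr fun k => and_congr_left fun _ => ?_
    exact (Nat.le_floor_iff (by positivity)).symm
  have h := measureReal_exists_le_abs_le (hS N) hK (h0 N) (hlip N) (hsq N) ⌊(N : ℕ) * T⌋₊
    (a := (N : ℕ) * ε) (by positivity)
  change P _ ≤ _
  rw [hset, ← ofReal_measureReal]
  refine ENNReal.ofReal_le_ofReal (h.trans ?_)
  rw [hc, div_div, div_le_div_iff₀ (by positivity) (by positivity)]
  have hfl : (⌊(N : ℕ) * T⌋₊ : ℝ) ≤ (N : ℕ) * T := Nat.floor_le (by positivity)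
  have h7 : (⌊(N : ℕ) * T⌋₊ : ℝ) + (N : ℕ) * ε / (2 * K) + 1
      ≤ (N : ℕ) * (T + ε / (2 * K) + 1) := by
    have : (N : ℕ) * (T + ε / (2 * K) + 1)
        = (N : ℕ) * T + (N : ℕ) * ε / (2 * K) + (N : ℕ) := by ring
    rw [this]
    linarith
  have h8 : ((⌊(N : ℕ) * T⌋₊ : ℝ) + (N : ℕ) * ε / (2 * K) + 1) ^ 2
      ≤ ((N : ℕ) * (T + ε / (2 * K) + 1)) ^ 2 :=
    pow_le_pow_left₀ (by positivity) h7 2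
  calc _ ≤ 8 * K ^ 3 * ((N : ℕ) * (T + ε / (2 * K) + 1)) ^ 2 * (ε ^ 3 * (N : ℕ)) := by gcongr
    _ = _ := by ring

theorem tendsto_measure_exists_le_abs_sum_innovation {A B : Type*} [MeasurableSpace A]
    [MeasurableSpace B] [Fintype B] [MeasurableSingletonClass B] [Inhabited B]
    [IsProbabilityMeasure P] {U : Ω → A}
    {ξ : ℕ → Ω → B} (hU : Measurable U) (hξ : ∀ k, Measurable (ξ k)) (hind : iIndepFun ξ P)
    (hUξ : IndepFun U (fun ω k => ξ k ω) P) {p : B → ℝ}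
    (hp : ∀ k v, P.real {ω | ξ k ω = v} = p v)
    {D : ℕ+ → ℕ → A × (ℕ → B) → B → ℝ} (hD : ∀ N k v, Measurable fun z => D N k z v)
    {K : ℝ} (hK : 0 < K) (hDK : ∀ N k z v, |D N k z v| ≤ K)
    (hD0 : ∀ N k z, ∑ v, p v * D N k z v = 0) {T : ℝ} (hT : 0 ≤ T) {ε : ℝ} (hε : 0 < ε) :
    Tendsto (fun N : ℕ+ => P {ω | ∃ k : ℕ, (k : ℝ) ≤ N * T ∧
      N * ε ≤ |∑ l ∈ Finset.range k, D N l (U ω, truncate l fun l => ξ l ω) (ξ l ω)|})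
      atTop (𝓝 0) := by
  refine tendsto_measure_exists_le_abs (fun N n => ?_) hK (fun N ω => by simp)
    (fun N k ω => ?_) (fun N k => ?_) hT hε
  · refine Finset.measurable_sum _ fun k _ => ?_
    have h1 : Measurable fun p : (A × (ℕ → B)) × B => D N k p.1 p.2 :=
      measurable_from_prod_countable_left (hD N k)
    exact h1.comp ((hU.prodMk ((measurable_truncate k).comp (measurable_pi_lambda _ hξ))).prodMk
      (hξ k))
  · rw [Finset.sum_range_succ, add_sub_cancel_left]
    exact hDK _ _ _ _
  · exact integral_sq_sum_innovation_le hU hξ hind hUξ hp (hD N) (hDK N) (hD0 N) k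

end Maximal

end QLearn


namespace QLearn

namespace DecisionProblem

variable {dx da J : ℕ} (M : DecisionProblem dx da J) {σ : ℝ → ℝ} {α : ℝ}
  {μ₀ : ProbabilityMeasure (Param dx da J)}

/-! ### The trained network as a function of the initial parameters and of the episodes -/

theorem continuous_qNet (hσ : Continuous σ) (N : ℕ) :
    Continuous fun θ : Fin N → Param dx da J => M.qNet σ θ := by
  unfold qNet
  fun_prop

theorem continuous_tdError (s : Fin (J + 1) → M.states) (act : Fin J → M.actions) (j : Fin J) :
    Continuous fun q : M.QValues => M.tdError q s act j :=
  (LipschitzWith.of_dist_le_mul (K := 2) fun q q' => by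
    rw [dist_eq_norm, Real.norm_eq_abs, dist_eq_norm]
    exact M.abs_tdError_sub_le q q' s act j).continuous

theorem continuous_step (hσ : IsC2b σ) (lr : ℝ) (N : ℕ) (s : Fin (J + 1) → M.states)
    (act : Fin J → M.actions) :
    Continuous fun θ : Fin N → Param dx da J => M.step σ lr s act θ := by
  have h1 := hσ.continuous
  have h2 := hσ.continuous_deriv
  have h3 := fun j => (M.continuous_tdError s act j).comp (M.continuous_qNet h1 N)
  simp only [Function.comp_def] at h3
  unfold step
  fun_prop

theorem train_congr (lr : ℝ) {N : ℕ} {x y : ℕ → M.Episode} {k : ℕ} (h : ∀ l < k, x l = y l)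
    (θ : Fin N → Param dx da J) :
    M.train σ lr (fun l => (x l).1) (fun l => (x l).2) θ k
      = M.train σ lr (fun l => (y l).1) (fun l => (y l).2) θ k := by
  induction k with
  | zero => rfl
  | succ k ih =>
    simp only [train]
    rw [ih fun l hl => h l (by omega), h k (by omega)]

theorem measurable_train (hσ : IsC2b σ) (lr : ℝ) (N k : ℕ) :
    Measurable fun z : (ℕ → Param dx da J) × (ℕ → M.Episode) =>
      M.train σ lr (fun l => (z.2 l).1) (fun l => (z.2 l).2) (fun i : Fin N => z.1 i) k := by
  induction k with
  | zero =>
    simp only [train]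
    fun_prop
  | succ k ih =>
    have h1 : Measurable fun q : (Fin N → Param dx da J) × M.Episode =>
        M.step σ lr q.2.1 q.2.2 q.1 :=
      measurable_from_prod_countable_left fun e =>
        (M.continuous_step hσ lr N e.1 e.2).measurable
    have h2 : Measurable fun z : (ℕ → Param dx da J) × (ℕ → M.Episode) => z.2 k :=
      (measurable_pi_apply k).comp measurable_snd
    exact h1.comp (ih.prodMk h2)

noncomputable section

variable (σ α μ₀) in
/-- The centred contribution of one episode to the drift, cut off where `q` is large. -/
def noise (Q : ℝ) (q : M.QValues) (e : M.Episode) : M.QValues :=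
  if ‖q‖ ≤ Q then M.episodeField σ α μ₀ e q - M.vectorField σ α μ₀ q else 0

theorem sum_episodeProb_smul_noise (Q : ℝ) (q : M.QValues) :
    ∑ e, M.episodeProb e • M.noise σ α μ₀ Q q e = 0 := by
  unfold noise
  split_ifs
  · simp only [smul_sub, Finset.sum_sub_distrib, M.sum_episodeProb_smul_episodeField,
      ← Finset.sum_smul, M.sum_episodeProb, one_smul, sub_self]
  · simp

theorem measurable_noise (Q : ℝ) (e : M.Episode) :
    Measurable fun q => M.noise σ α μ₀ Q q e := by
  obtain ⟨K, hK⟩ := M.exists_lipschitzWith_episodeField σ α μ₀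
  refine Measurable.ite (measurableSet_le measurable_norm measurable_const) ?_ measurable_const
  exact ((hK e).continuous.sub (M.lipschitzWith_vectorField σ α μ₀ hK).continuous).measurable

variable (σ α μ₀) in
theorem exists_norm_noise_le (Q : ℝ) :
    ∃ K, 0 < K ∧ ∀ q e, ‖M.noise σ α μ₀ Q q e‖ ≤ K := by
  obtain ⟨K, hK⟩ := M.exists_lipschitzWith_episodeField σ α μ₀
  obtain ⟨R, hR⟩ : ∃ R, ∀ e, ‖M.episodeField σ α μ₀ e 0‖ ≤ R :=
    (Set.finite_range fun e => ‖M.episodeField σ α μ₀ e 0‖).bddAbove.imp fun R hR e => hR ⟨e, rfl⟩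
  have hF := M.lipschitzWith_vectorField σ α μ₀ hK
  set b := R + ‖M.vectorField σ α μ₀ 0‖ + 2 * (K * |Q|) with hb
  refine ⟨|b| + 1, by positivity, fun q e => ?_⟩
  unfold noise
  split_ifs with hq
  · have h1 := (hK e).norm_sub_le q 0
    have h2 := hF.norm_sub_le q 0
    rw [sub_zero] at h1 h2
    have h3 : K * ‖q‖ ≤ K * |Q| := by gcongr; exact hq.trans (le_abs_self Q)
    have h4 := norm_sub_norm_le (M.episodeField σ α μ₀ e q) (M.episodeField σ α μ₀ e 0)
    have h5 := norm_sub_norm_le (M.vectorField σ α μ₀ q) (M.vectorField σ α μ₀ 0)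
    have h6 := norm_sub_le (M.episodeField σ α μ₀ e q) (M.vectorField σ α μ₀ q)
    have h7 := le_abs_self b
    have h8 := hR e
    linarith
  · rw [norm_zero]
    positivity

variable (σ) in
/-- The network after `k` updates, as a function of the initial parameters and the episodes. -/
def trainedNet (lr : ℝ) (N k : ℕ) (z : (ℕ → Param dx da J) × (ℕ → M.Episode)) : M.QValues :=
  M.qNet σ (M.train σ lr (fun l => (z.2 l).1) (fun l => (z.2 l).2) (fun i : Fin N => z.1 i) k)

theorem measurable_trainedNet (hσ : IsC2b σ) (lr : ℝ) (N k : ℕ) :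
    Measurable (M.trainedNet σ lr N k) :=
  (M.continuous_qNet hσ.continuous N).measurable.comp (M.measurable_train hσ lr N k)

/-- Adaptedness: the network after `k` updates has seen only the episodes before `k`. -/
theorem trainedNet_truncate [Inhabited M.Episode] (lr : ℝ) (N k : ℕ) (u : ℕ → Param dx da J)
    (x : ℕ → M.Episode) : M.trainedNet σ lr N k (u, truncate k x) = M.trainedNet σ lr N k (u, x) := by
  exact congrArg (M.qNet σ)
    (M.train_congr lr (x := truncate k x) (y := x) (fun m hm => by simp [truncate, hm]) _)

variable {Ω : Type*} [MeasurableSpace Ω] {P : Measure Ω} {θ₀ : ℕ → Ω → Param dx da J}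
  {s : ℕ → Ω → Fin (J + 1) → M.states} {act : ℕ → Ω → Fin J → M.actions}

theorem IsTrainingInput.measureReal_episode (hin : M.IsTrainingInput P μ₀ θ₀ s act) (k : ℕ)
    (v : M.Episode) : P.real {ω | (s k ω, act k ω) = v} = M.episodeProb v := by
  have h := hin.law_episode k v.1 v.2
  have h2 : {ω | (s k ω, act k ω) = v} = {ω | s k ω = v.1 ∧ act k ω = v.2} := by
    ext ω
    simp [Prod.ext_iff]
  rw [measureReal_def, h2, h]
  exact ENNReal.toReal_ofReal (M.episodeProb_nonneg v)

/-- The innovation estimate needs a bound valid everywhere, while the network is bounded only on a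
good event; the cutoff in `noise` supplies the former and is inactive on the latter. -/
theorem tendsto_measure_noise_apply [Inhabited M.Episode] [IsProbabilityMeasure P] (hσ : IsC2b σ)
    (hin : M.IsTrainingInput P μ₀ θ₀ s act) (Q : ℝ) {T : ℝ} (hT : 0 ≤ T) {ε : ℝ} (hε : 0 < ε)
    (j : Fin J) (x : M.states) (a : M.actions) :
    Tendsto (fun N : ℕ+ => P {ω | ∃ k : ℕ, (k : ℝ) ≤ N * T ∧
      N * ε ≤ |∑ l ∈ Finset.range k, M.noise σ α μ₀ Q (M.trainedNet σ (α / N) N l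
        (fun i => θ₀ i ω, truncate l fun k => (s k ω, act k ω))) (s l ω, act l ω) j x a|})
      atTop (𝓝 0) := by
  obtain ⟨K, hK0, hK⟩ := M.exists_norm_noise_le σ α μ₀ Q
  refine tendsto_measure_exists_le_abs_sum_innovation
    (D := fun N l z e => M.noise σ α μ₀ Q (M.trainedNet σ (α / N) N l z) e j x a)
    (measurable_pi_lambda _ hin.measurable_param)
    (fun k => (hin.measurable_states k).prodMk (hin.measurable_actions k)) hin.indep_episode
    hin.indep (hin.measureReal_episode M) (fun N k v => ?_) hK0
    (fun N k z v => (M.norm_apply_le _ _ _ _).trans (hK _ _)) (fun N k z => ?_) hT hε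
  · exact (M.evalCLM j x a).continuous.measurable.comp
      ((M.measurable_noise Q v).comp (M.measurable_trainedNet hσ (α / N) N k))
  · have h := congrArg (M.evalCLM j x a) (M.sum_episodeProb_smul_noise (σ := σ) (α := α)
      (μ₀ := μ₀) Q (M.trainedNet σ (α / N) N k z))
    rw [map_sum, map_zero] at h
    simp only [map_smul] at h
    exact h

/-- The accumulated noise is negligible, uniformly over `k ≤ N T`. -/
theorem tendsto_measure_noise [IsProbabilityMeasure P] (hσ : IsC2b σ)
    (hin : M.IsTrainingInput P μ₀ θ₀ s act) (Q : ℝ) {T : ℝ} (hT : 0 ≤ T) {ε : ℝ} (hε : 0 < ε) :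
    Tendsto (fun N : ℕ+ => P {ω | ∃ k : ℕ, (k : ℝ) ≤ N * T ∧
      N * ε ≤ ‖∑ l ∈ Finset.range k, M.noise σ α μ₀ Q (M.trainedNet σ (α / N) N l
        (fun i => θ₀ i ω, fun k => (s k ω, act k ω))) (s l ω, act l ω)‖}) atTop (𝓝 0) := by
  have : Inhabited M.Episode := Classical.inhabited_of_nonempty inferInstance
  have hsum := tendsto_finsetSum Finset.univ
    fun (i : Fin J × M.states × M.actions) (_ : i ∈ Finset.univ) =>
      M.tendsto_measure_noise_apply (α := α) hσ hin Q hT hε i.1 i.2.1 i.2.2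
  rw [Finset.sum_const_zero] at hsum
  refine tendsto_of_tendsto_of_tendsto_of_le_of_le tendsto_const_nhds hsum (fun _ => bot_le)
    fun N => ?_
  refine (measure_mono ?_).trans (measure_iUnion_fintype_le P _)
  rintro ω ⟨k, hk, hkε⟩
  by_contra hcon
  simp only [mem_iUnion, Set.mem_ofPred_eq, not_exists, not_and, not_le,
    trainedNet_truncate] at hcon
  have hNε : 0 < (N : ℕ) * ε := mul_pos (by exact_mod_cast N.pos) hε
  refine absurd hkε (not_le.2 ?_)
  rw [pi_norm_lt_iff hNε]
  intro j
  rw [pi_norm_lt_iff hNε]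
  intro x
  rw [pi_norm_lt_iff hNε]
  intro a
  refine lt_of_le_of_lt (le_of_eq ?_) (hcon (j, x, a) k hk)
  rw [Real.norm_eq_abs]
  simp only [Finset.sum_apply]

end

end DecisionProblem

end QLearn


namespace QLearn

/-! ### Convergence in distribution of nearby random elements -/

/-- Weak convergence is tested on bounded Lipschitz functions, whose integrals under `X i` and `Y i`
differ by a Lipschitz term on the event of closeness and by the oscillation times a small
probability off it. -/
theorem tendstoInDistribution_of_tendsto_measure_edist {ι Ω Ω' E : Type*} [MeasurableSpace Ω]
    [MeasurableSpace Ω'] [PseudoEMetricSpace E] [MeasurableSpace E] [BorelSpace E]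
    {P : Measure Ω} [IsProbabilityMeasure P] {P' : Measure Ω'} [IsProbabilityMeasure P']
    {l : Filter ι} [l.IsCountablyGenerated] {X Y : ι → Ω → E} {Z : Ω' → E}
    (hX : ∀ i, AEMeasurable (X i) P) (hY : TendstoInDistribution Y l Z (fun _ => P) P')
    (h : ∀ ε : ℝ, 0 < ε → Tendsto (fun i => P {ω | ENNReal.ofReal ε ≤ edist (X i ω) (Y i ω)}) l
      (𝓝 0)) :
    TendstoInDistribution X l Z (fun _ => P) P' := by
  refine ⟨hX, hY.aemeasurable_limit, ?_⟩
  have hYt := tendsto_iff_forall_lipschitz_integral_tendsto.1 hY.tendsto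
  refine tendsto_iff_forall_lipschitz_integral_tendsto.2 ?_
  intro f hfb hfl
  refine (hYt f hfb hfl).congr_dist ?_
  obtain ⟨C, hC⟩ := hfb
  obtain ⟨L, hL⟩ := hfl
  have hfm : Measurable f := hL.continuous.measurable
  have hYm := hY.forall_aemeasurable
  have hint : ∀ {W : Ω → E}, AEMeasurable W P → Integrable (fun ω => f (W ω)) P := by
    intro W hW
    obtain ⟨ω₀⟩ := P.nonempty_of_neZero
    refine Integrable.of_bound (hfm.comp_aemeasurable hW).aestronglyMeasurable
      (C + |f (W ω₀)|) (ae_of_all _ fun ω => ?_)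
    have h1 := hC (W ω) (W ω₀)
    rw [Real.dist_eq] at h1
    rw [Real.norm_eq_abs]
    have h2 := abs_sub_abs_le_abs_sub (f (W ω)) (f (W ω₀))
    linarith
  have hC0 : 0 ≤ C := by
    obtain ⟨ω₀⟩ := P'.nonempty_of_neZero
    exact dist_nonneg.trans (hC (Z ω₀) (Z ω₀))
  rw [Metric.tendsto_nhds]
  intro δ hδ
  set ε : ℝ := δ / (2 * (L + 1)) with hε
  have hLnn : (0 : ℝ) ≤ L := L.2
  have hεpos : 0 < ε := by positivity
  have hbad := (ENNReal.tendsto_nhds_zero.1 (h ε hεpos)) (ENNReal.ofReal (δ / (4 * (C + 1))))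
    (ENNReal.ofReal_pos.2 (by positivity))
  filter_upwards [hbad] with i hi
  simp only [Real.dist_eq, sub_zero, abs_abs]
  simp only [ProbabilityMeasure.coe_mk]
  rw [integral_map (hYm i) hfm.aestronglyMeasurable, integral_map (hX i) hfm.aestronglyMeasurable,
    ← integral_sub (hint (hYm i)) (hint (hX i))]
  set S := {ω | ENNReal.ofReal ε ≤ edist (X i ω) (Y i ω)} with hS
  -- `S` is not known to be measurable, since the space is not assumed separable; its measurable
  -- hull has the same measure.
  have hle : ∀ ω, |f (Y i ω) - f (X i ω)| ≤ L * ε + (toMeasurable P S).indicator (fun _ => C) ω := by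
    intro ω
    rw [← Real.dist_eq]
    by_cases hω : ω ∈ S
    · rw [indicator_of_mem (subset_toMeasurable P S hω)]
      have := hC (Y i ω) (X i ω)
      have : 0 ≤ L * ε := by positivity
      linarith
    · have h1 : edist (Y i ω) (X i ω) ≤ ENNReal.ofReal ε := by
        rw [edist_comm]
        exact (not_le.1 hω).le
      have h2 : edist (f (Y i ω)) (f (X i ω)) ≤ ENNReal.ofReal (L * ε) := by
        refine (hL (Y i ω) (X i ω)).trans ?_
        rw [ENNReal.ofReal_mul hLnn, ENNReal.ofReal_coe_nnreal]
        gcongr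
      rw [edist_dist, ENNReal.ofReal_le_ofReal_iff (by positivity)] at h2
      have h3 : 0 ≤ (toMeasurable P S).indicator (fun _ => C) ω := indicator_nonneg (fun _ _ => hC0) ω
      linarith
  have hm := measurableSet_toMeasurable P S
  have h4 : |∫ ω, (f (Y i ω) - f (X i ω)) ∂P| ≤ L * ε + P.real S * C := by
    refine abs_integral_le_integral_abs.trans ((integral_mono_ae
      ((hint (hYm i)).sub (hint (hX i))).abs
      ((integrable_const (L * ε)).add ((integrable_const C).indicator hm))
      (ae_of_all _ hle)).trans (le_of_eq ?_))
    simp only [Pi.add_apply]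
    rw [integral_add (integrable_const _) ((integrable_const C).indicator hm),
      integral_indicator_const _ hm, integral_const]
    simp [measureReal_def, measure_toMeasurable]
  have h5 : P.real S ≤ δ / (4 * (C + 1)) := ENNReal.toReal_le_of_le_ofReal (by positivity) hi
  have h6 : P.real S * C ≤ δ / 4 := by
    calc P.real S * C ≤ δ / (4 * (C + 1)) * (C + 1) := by gcongr; linarith
      _ = δ / 4 := by field_simp
  have h7 : L * ε ≤ δ / 2 := by
    calc L * ε ≤ (L + 1) * ε := by gcongr; linarith
      _ = δ / 2 := by rw [hε]; field_simp
  linarith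

/-- The limit law gives small mass to the closed set `n ≤ ‖x‖` for large `n`, and the portmanteau
theorem transfers this to the sequence. -/
theorem exists_eventually_measure_norm_ge_le {ι Ω Ω' E : Type*} [MeasurableSpace Ω]
    [MeasurableSpace Ω'] [NormedAddCommGroup E] [MeasurableSpace E] [BorelSpace E]
    {P : Measure Ω} [IsProbabilityMeasure P] {P' : Measure Ω'} [IsProbabilityMeasure P']
    {l : Filter ι} {Y : ι → Ω → E} {Z : Ω' → E}
    (hY : TendstoInDistribution Y l Z (fun _ => P) P') {δ : ℝ≥0∞} (hδ : 0 < δ) :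
    ∃ L : ℝ, 0 ≤ L ∧ ∀ᶠ i in l, P {ω | L ≤ ‖Y i ω‖} ≤ δ := by
  have := Measure.isProbabilityMeasure_map (μ := P') hY.aemeasurable_limit
  have hanti : Antitone fun n : ℕ => {x : E | (n : ℝ) ≤ ‖x‖} := by
    intro m n hmn x hx
    exact le_trans (b := (n : ℝ)) (by exact_mod_cast hmn) hx
  have hcl : ∀ r : ℝ, IsClosed {x : E | r ≤ ‖x‖} := fun r => isClosed_le continuous_const
    continuous_norm
  have h0 : Tendsto (fun n : ℕ => P'.map Z {x : E | (n : ℝ) ≤ ‖x‖}) atTop (𝓝 0) := by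
    have h := tendsto_measure_iInter_atTop (μ := P'.map Z)
      (fun n : ℕ => (hcl n).measurableSet.nullMeasurableSet) hanti ⟨0, measure_ne_top _ _⟩
    have he : ⋂ n : ℕ, {x : E | (n : ℝ) ≤ ‖x‖} = ∅ := by
      refine Set.eq_empty_of_forall_notMem fun x hx => ?_
      obtain ⟨n, hn⟩ := exists_nat_gt ‖x‖
      exact absurd (Set.mem_iInter.1 hx n) (not_le.2 hn)
    rwa [he, measure_empty] at h
  obtain ⟨n, hn⟩ := (h0.eventually_lt_const hδ).exists
  refine ⟨n, n.cast_nonneg, ?_⟩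
  have hlim := ProbabilityMeasure.limsup_measure_closed_le_of_tendsto hY.tendsto (hcl n)
  have hev := eventually_lt_of_limsup_lt (lt_of_le_of_lt hlim hn)
  filter_upwards [hev] with i hi
  refine le_trans (le_of_eq ?_) hi.le
  rw [ProbabilityMeasure.coe_mk, Measure.map_apply_of_aemeasurable (hY.forall_aemeasurable i)
    (hcl n).measurableSet]
  rfl

/-! ### The uniform distance dominates the Skorokhod distance -/

theorem Skorokhod.edist_le {T : ℝ} {E : Type*} [PseudoEMetricSpace E] {f g : Skorokhod T E}
    {c : ℝ≥0∞} (h : ∀ t, edist (f t) (g t) ≤ c) : edist f g ≤ c := by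
  refine iInf_le_of_le (OrderIso.refl _) (max_le ?_ (iSup_le fun t => h t))
  simp

theorem isCadlag_of_continuous {T : ℝ} {E : Type*} [TopologicalSpace E] {f : Icc (0 : ℝ) T → E}
    (hf : Continuous f) : IsCadlag f := fun t =>
  ⟨hf.continuousWithinAt, f t, hf.continuousAt.tendsto.mono_left nhdsWithin_le_nhds⟩

/-! ### Discrete approximation of a flow -/

theorem le_exp_mul_of_le_succ {a : ℕ → ℝ} {κ b : ℝ} (hκ : 0 ≤ κ) (hb : 0 ≤ b) (h0 : a 0 ≤ 0)
    {n : ℕ} (h : ∀ k < n, a (k + 1) ≤ (1 + κ) * a k + b) :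
    ∀ k ≤ n, a k ≤ k * b * Real.exp (κ * k) := by
  intro k hk
  induction k with
  | zero => simpa using h0
  | succ k ih =>
    have h1 := h k (by omega)
    have h2 := ih (by omega)
    have h3 : 1 + κ ≤ Real.exp κ := by
      rw [add_comm]
      exact Real.add_one_le_exp κ
    have h4 : Real.exp (κ * (k + 1 : ℕ)) = Real.exp κ * Real.exp (κ * k) := by
      rw [← Real.exp_add]
      push_cast
      ring_nf
    have h5 : 1 ≤ Real.exp (κ * (k + 1 : ℕ)) := Real.one_le_exp (by positivity)
    calc a (k + 1) ≤ (1 + κ) * a k + b := h1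
      _ ≤ (1 + κ) * (k * b * Real.exp (κ * k)) + b := by gcongr
      _ ≤ Real.exp κ * (k * b * Real.exp (κ * k)) + b := by gcongr
      _ = k * b * Real.exp (κ * (k + 1 : ℕ)) + b * 1 := by rw [h4]; ring
      _ ≤ k * b * Real.exp (κ * (k + 1 : ℕ)) + b * Real.exp (κ * (k + 1 : ℕ)) := by gcongr
      _ = _ := by push_cast; ring

section Flow

variable {V : Type*} [NormedAddCommGroup V] [NormedSpace ℝ V] [CompleteSpace V] {F : V → V} {K : ℝ≥0}

/-- A perturbed Euler scheme with step `1 / N` follows the flow. -/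
theorem norm_euler_sub_flow_le (hF : LipschitzWith K F) {g : V} {h : ℝ → V}
    (hc : ContinuousOn h (Ici 0)) (hi : ∀ t, 0 ≤ t → h t = g + ∫ u in (0 : ℝ)..t, F (h u))
    {T R : ℝ} (hT : 0 ≤ T) (hR : ∀ u ∈ Icc 0 T, ‖h u‖ ≤ R) {N : ℕ} (hN : 0 < N)
    {q z : ℕ → V} (hq0 : q 0 = g) {ε ρ : ℝ} (hρ : 0 ≤ ρ)
    (hz : ∀ k : ℕ, (k : ℝ) ≤ N * T → ‖∑ l ∈ Finset.range k, z l‖ ≤ N * ε)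
    (hq : ∀ k : ℕ, ((k + 1 : ℕ) : ℝ) ≤ N * T →
      ‖q (k + 1) - q k - (1 / N : ℝ) • (F (q k) + z k)‖ ≤ 1 / N * ρ) :
    ∀ t, 0 ≤ t → t ≤ T → ‖q ⌊(N : ℝ) * t⌋₊ - h t‖
      ≤ T * (K * ε + ρ + K * (‖F 0‖ + K * R) / N) * Real.exp (K * T) + ε
        + (‖F 0‖ + K * R) / N := by
  have hN' : (0 : ℝ) < N := Nat.cast_pos.2 hN
  set B := ‖F 0‖ + K * R with hB
  have hR0 : 0 ≤ R := (norm_nonneg _).trans (hR 0 ⟨le_rfl, hT⟩)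
  have hB0 : 0 ≤ B := by positivity
  -- Individual `z l` are not small, only their sums are. Subtracting the accumulated noise `m k`
  -- from `q k` leaves a recursion in which the noise enters only through `‖m k‖ ≤ ε`.
  set m : ℕ → V := fun k => (1 / N : ℝ) • ∑ l ∈ Finset.range k, z l with hm
  have hmε : ∀ k : ℕ, (k : ℝ) ≤ N * T → ‖m k‖ ≤ ε := by
    intro k hk
    rw [hm, norm_smul, Real.norm_of_nonneg (by positivity)]
    calc 1 / (N : ℝ) * ‖∑ l ∈ Finset.range k, z l‖ ≤ 1 / N * (N * ε) := by
          gcongr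
          exact hz k hk
      _ = ε := by field_simp
  have hε0 : 0 ≤ ε := (norm_nonneg _).trans (hmε 0 (by simp; positivity))
  have hmem : ∀ k : ℕ, (k : ℝ) ≤ N * T → (k : ℝ) / N ≤ T := by
    intro k hk
    rw [div_le_iff₀ hN']
    linarith
  set a : ℕ → ℝ := fun k => ‖q k - m k - h (k / N)‖ with ha
  have hh0 : h 0 = g := by simpa using hi 0 le_rfl
  have ha0 : a 0 ≤ 0 := by simp [ha, hm, hq0, hh0]
  have hdev : ∀ k : ℕ, (k : ℝ) ≤ N * T → ‖q k - h (k / N)‖ ≤ a k + ε := by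
    intro k hk
    have h1 : q k - h (k / N) = (q k - m k - h (k / N)) + m k := by abel
    rw [h1]
    exact (norm_add_le _ _).trans (add_le_add le_rfl (hmε k hk))
  have hrec : ∀ k < ⌊(N : ℝ) * T⌋₊,
      a (k + 1) ≤ (1 + K / N) * a k + (K * ε + ρ + K * B / N) / N := by
    intro k hk
    have hk1 : ((k + 1 : ℕ) : ℝ) ≤ N * T := (Nat.le_floor_iff (by positivity)).1 hk
    have hk0 : (k : ℝ) ≤ N * T := le_trans (by push_cast; linarith) hk1
    have hstep : ((k + 1 : ℕ) : ℝ) / N - k / N = 1 / N := by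
      push_cast
      ring
    have hle : (k : ℝ) / N ≤ ((k + 1 : ℕ) : ℝ) / N := by
      have : (0 : ℝ) ≤ 1 / N := by positivity
      linarith
    have he := (norm_sub_le_of_integral_eq hF hc hi (s := (k : ℝ) / N)
      (t := ((k + 1 : ℕ) : ℝ) / N) (by positivity) hle (R := R) (fun u hu =>
        hR u ⟨le_trans (by positivity) hu.1, hu.2.trans (hmem _ hk1)⟩)).2
    rw [hstep] at he
    -- Previous error, Lipschitz difference of drifts, residual of the scheme, and local truncation
    -- error of the flow.
    have hd : q (k + 1) - m (k + 1) - h ((k + 1 : ℕ) / N)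
        = (q k - m k - h (k / N)) + (1 / N : ℝ) • (F (q k) - F (h (k / N)))
          + (q (k + 1) - q k - (1 / N : ℝ) • (F (q k) + z k))
          - (h ((k + 1 : ℕ) / N) - h (k / N) - (1 / N : ℝ) • F (h (k / N))) := by
      simp only [hm, Finset.sum_range_succ, smul_add, smul_sub]
      abel
    have hFl : ‖(1 / N : ℝ) • (F (q k) - F (h (k / N)))‖ ≤ 1 / N * (K * (a k + ε)) := by
      rw [norm_smul, Real.norm_of_nonneg (by positivity)]
      gcongr
      exact (hF.norm_sub_le _ _).trans (by gcongr; exact hdev k hk0)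
    calc a (k + 1) = ‖q (k + 1) - m (k + 1) - h ((k + 1 : ℕ) / N)‖ := rfl
      _ ≤ a k + 1 / N * (K * (a k + ε)) + 1 / N * ρ + K * (B * (1 / N)) * (1 / N) := by
          rw [hd]
          refine (norm_sub_le _ _).trans (add_le_add ((norm_add_le _ _).trans
            (add_le_add ((norm_add_le _ _).trans (add_le_add le_rfl hFl)) (hq k hk1))) he)
      _ = _ := by
          field_simp
          ring
  have hak : ∀ k : ℕ, (k : ℝ) ≤ N * T →
      a k ≤ T * (K * ε + ρ + K * B / N) * Real.exp (K * T) := by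
    intro k hk
    have h1 := le_exp_mul_of_le_succ (κ := K / N) (b := (K * ε + ρ + K * B / N) / N)
      (by positivity) (by positivity) ha0 hrec k ((Nat.le_floor_iff (by positivity)).2 hk)
    calc a k ≤ _ := h1
      _ = (k / N) * (K * ε + ρ + K * B / N) * Real.exp (K * (k / N)) := by
          congr 1
          · ring
          · congr 1
            ring
      _ ≤ _ := by
          have := hmem k hk
          gcongr
  intro t ht0 htT
  set k := ⌊(N : ℝ) * t⌋₊ with hk
  have hkt : (k : ℝ) ≤ N * t := Nat.floor_le (by positivity)
  have hkt' : N * t < k + 1 := Nat.lt_floor_add_one _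
  have hkT : (k : ℝ) ≤ N * T := hkt.trans (by gcongr)
  have hknt : (k : ℝ) / N ≤ t := by
    rw [div_le_iff₀ hN']
    linarith
  have hgap : t - k / N ≤ 1 / N := by
    rw [sub_le_iff_le_add, ← add_div, le_div_iff₀ hN']
    linarith
  have h1 := (norm_sub_le_of_integral_eq hF hc hi (s := (k : ℝ) / N) (t := t) (by positivity) hknt
    (R := R) (fun u hu => hR u ⟨le_trans (by positivity) hu.1, hu.2.trans htT⟩)).1
  have h2 : B * (t - k / N) ≤ B / N := by
    calc B * (t - k / N) ≤ B * (1 / N) := by gcongr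
      _ = B / N := by ring
  have h3 : q k - h t = (q k - h (k / N)) - (h t - h (k / N)) := by abel
  rw [h3]
  refine (norm_sub_le _ _).trans (add_le_add ((hdev k hkT).trans ?_) (h1.trans h2))
  linarith [hak k hkT]

end Flow

end QLearn


/-! ### Coupling of the trained process with the limit flow, and the main theorem -/

namespace QLearn

theorem tendsto_measure_le_of_ae_tendsto {Ω : Type*} [MeasurableSpace Ω] {P : Measure Ω}
    [IsFiniteMeasure P] {f : ℕ+ → Ω → ℝ≥0∞} (hf : ∀ N, Measurable (f N))
    (h : ∀ᵐ ω ∂P, Tendsto (fun N => f N ω) atTop (𝓝 0)) {c : ℝ≥0∞} (hc : 0 < c) :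
    Tendsto (fun N => P {ω | c ≤ f N ω}) atTop (𝓝 0) := by
  have h1 := tendsto_measure_of_ae_tendsto_indicator_of_isFiniteMeasure (μ := P) (A := ∅)
    (As := fun N => {ω | c ≤ f N ω}) atTop MeasurableSet.empty
    (fun N => measurableSet_le measurable_const (hf N)) ?_
  · rwa [measure_empty] at h1
  · filter_upwards [h] with ω hω
    filter_upwards [hω.eventually_lt_const hc] with N hN
    simpa using hN

/-- A finite sequence, read on the time scale `t ↦ ⌊N t⌋`, as a càdlàg path. -/
noncomputable def floorPath {E : Type*} [TopologicalSpace E] (T : ℝ) (N m : ℕ)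
    (e : Fin (m + 1) → E) : Skorokhod T E :=
  ⟨fun t => e (Fin.ofNat (m + 1) ⌊(N : ℝ) * t⌋₊),
    isCadlag_comp_floor (fun k => e (Fin.ofNat (m + 1) k)) N⟩

theorem continuous_floorPath {E : Type*} [PseudoEMetricSpace E] (T : ℝ) (N m : ℕ) :
    Continuous (floorPath T N m : (Fin (m + 1) → E) → Skorokhod T E) := by
  have : LipschitzWith 1 (floorPath T N m : (Fin (m + 1) → E) → Skorokhod T E) := by
    intro e e'
    rw [ENNReal.coe_one, one_mul]
    exact Skorokhod.edist_le fun t => edist_le_pi_edist e e' _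
  exact this.continuous

namespace DecisionProblem

variable {dx da J : ℕ} (M : DecisionProblem dx da J) {σ : ℝ → ℝ} {α : ℝ}
  {μ₀ : ProbabilityMeasure (Param dx da J)}
  {Ω : Type*} [MeasurableSpace Ω] {P : Measure Ω} {θ₀ : ℕ → Ω → Param dx da J}
  {s : ℕ → Ω → Fin (J + 1) → M.states} {act : ℕ → Ω → Fin J → M.actions}

/-- The path depends on finitely many parameter vectors, through a map that is continuous into the
Skorokhod space. Measurability is needed only for these parameters, so no description of the Borel
sets of the path space is used. -/
theorem measurable_scaledPath (hσ : IsC2b σ) (hin : M.IsTrainingInput P μ₀ θ₀ s act) (T : ℝ)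
    (N : ℕ) [NeZero N] : Measurable (M.scaledPath σ α T θ₀ s act N) := by
  set m := ⌊(N : ℝ) * T⌋₊ with hm
  have h1 : Continuous fun (y : Fin (m + 1) → Fin N → Param dx da J) (k : Fin (m + 1)) =>
      ((LevyProkhorov.ofMeasure (empirical (y k)), M.qNet σ (y k)) : M.PathState) :=
    continuous_pi fun k => (continuous_empirical.comp (continuous_apply k)).prodMk
      ((M.continuous_qNet hσ.continuous N).comp (continuous_apply k))
  have h2 : Measurable fun ω => ((fun i => θ₀ i ω, fun k => (s k ω, act k ω)) :
      (ℕ → Param dx da J) × (ℕ → M.Episode)) :=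
    (measurable_pi_lambda _ hin.measurable_param).prodMk (measurable_pi_lambda _ fun k =>
      (hin.measurable_states k).prodMk (hin.measurable_actions k))
  have h3 : Measurable fun ω (k : Fin (m + 1)) => M.train σ (α / N) (fun k => s k ω)
      (fun k => act k ω) (fun i : Fin N => θ₀ i ω) k :=
    measurable_pi_lambda _ fun k => (M.measurable_train hσ (α / N) N k).comp h2
  have h4 := ((continuous_floorPath T N m).comp h1).measurable.comp h3
  convert h4 using 1
  funext ω
  refine Subtype.ext (funext fun t => ?_)
  have ht : ⌊(N : ℝ) * t⌋₊ % (m + 1) = ⌊(N : ℝ) * t⌋₊ :=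
    Nat.mod_eq_of_lt (Nat.lt_succ_of_le (Nat.floor_mono (by gcongr; exact t.2.2)))
  simp only [scaledPath, Function.comp_apply, floorPath, Fin.val_ofNat, ht]

/-- The limit process, as a function of the initial value. -/
noncomputable def limitPath (μ₀ : ProbabilityMeasure (Param dx da J)) (T : ℝ)
    {h : ℝ → M.QValues} (hh : ContinuousOn h (Ici 0)) : Skorokhod T M.PathState :=
  ⟨fun t => (LevyProkhorov.ofMeasure μ₀, h t), isCadlag_of_continuous
    (continuous_const.prodMk (hh.comp_continuous continuous_subtype_val fun t => t.2.1))⟩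

theorem continuous_limitPath {h : M.QValues → ℝ → M.QValues}
    (hh : ∀ g, ContinuousOn (h g) (Ici 0) ∧
      ∀ t, 0 ≤ t → h g t = g + ∫ u in (0 : ℝ)..t, M.vectorField σ α μ₀ (h g u))
    (T : ℝ) :
    Continuous fun g => M.limitPath μ₀ T (hh g).1 := by
  obtain ⟨K', hK'⟩ := M.exists_lipschitzWith_episodeField σ α μ₀
  have hF := M.lipschitzWith_vectorField σ α μ₀ hK'
  have : LipschitzWith (Real.toNNReal (Real.exp (K' * T)))
      fun g => M.limitPath μ₀ T (hh g).1 := by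
    intro g g'
    refine Skorokhod.edist_le fun t => ?_
    simp only [limitPath, Prod.edist_eq, edist_self, zero_le, sup_of_le_right]
    have h1 := dist_le_of_integral_eq hF (hh g).1 (hh g).2 (hh g').1 (hh g').2 t.2.1
    have h2 : dist g g' * Real.exp (K' * t) ≤ Real.exp (K' * T) * dist g g' := by
      rw [mul_comm]
      gcongr
      exact t.2.2
    rw [edist_dist, edist_dist]
    refine (ENNReal.ofReal_le_ofReal (h1.trans h2)).trans ?_
    rw [ENNReal.ofReal_mul (Real.exp_pos _).le]
    rfl
  exact this.continuous

/-- On an event that has large probability, the rescaled process stays close to the limit process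
that starts from the same initial value. -/
theorem exists_edist_scaledPath_le {Ω : Type*} {θ₀ : ℕ → Ω → Param dx da J}
    {s : ℕ → Ω → Fin (J + 1) → M.states} {act : ℕ → Ω → Fin J → M.actions}
    {h : M.QValues → ℝ → M.QValues}
    (hh : ∀ g, ContinuousOn (h g) (Ici 0) ∧
      ∀ t, 0 ≤ t → h g t = g + ∫ u in (0 : ℝ)..t, M.vectorField σ α μ₀ (h g u))
    (hσ : IsC2b σ) (hα : 0 ≤ α) {C₀ L T : ℝ} (hC₀ : 0 ≤ C₀)
    (hL : 0 ≤ L) (hT : 0 ≤ T) {ε : ℝ} (hε : 0 < ε) :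
    ∃ Q η : ℝ, 0 < η ∧ ∀ᶠ N : ℕ+ in atTop, ∀ ω,
      (∀ i j, |(θ₀ i ω).1 j| ≤ C₀) → ‖M.qNet σ (fun i : Fin N => θ₀ i ω)‖ ≤ L →
      (∀ j j' x a x' a', |(∑ i : Fin N, unitKernel σ α j j' (M.pt x a) (M.pt x' a') (θ₀ i ω)) / N
        - (if j = j' then M.tensorA σ α μ₀ j x a x' a' else 0)| ≤ η) →
      edist (LevyProkhorov.ofMeasure (empirical fun i : Fin N => θ₀ i ω))
        (LevyProkhorov.ofMeasure μ₀) ≤ ENNReal.ofReal η →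
      (∀ k : ℕ, (k : ℝ) ≤ N * T → ‖∑ l ∈ Finset.range k, M.noise σ α μ₀ Q
        (M.trainedNet σ (α / N) N l (fun i => θ₀ i ω, fun k => (s k ω, act k ω)))
          (s l ω, act l ω)‖ ≤ N * η) →
      edist (M.scaledPath σ α T θ₀ s act N ω)
        (M.limitPath μ₀ T (hh (M.qNet σ fun i : Fin N => θ₀ i ω)).1) ≤ ENNReal.ofReal ε := by
  obtain ⟨Q, D, K, N₀, hQ, hD, hK, hbound⟩ :=
    M.exists_trajectory_bound (μ₀ := μ₀) hσ hα hC₀ hL hT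
  obtain ⟨K', hK'⟩ := M.exists_lipschitzWith_episodeField σ α μ₀
  have hF := M.lipschitzWith_vectorField σ α μ₀ hK'
  set F := M.vectorField σ α μ₀ with hFdef
  -- One radius for all initial values of norm at most `L`: growth of the solution from `0`, plus
  -- the Grönwall distance to it.
  set R := gronwallBound ‖(0 : M.QValues)‖ K' ‖F 0‖ T + L * Real.exp (K' * T) with hR
  have hRb : ∀ g, ‖g‖ ≤ L → ∀ u ∈ Icc 0 T, ‖h g u‖ ≤ R := by
    intro g hg u hu
    have h1 := norm_le_of_integral_eq hF (hh 0).1 (hh 0).2 u hu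
    have h2 := dist_le_of_integral_eq hF (hh g).1 (hh g).2 (hh 0).1 (hh 0).2 hu.1
    rw [dist_zero_right, dist_eq_norm] at h2
    have h3 : ‖g‖ * Real.exp (K' * u) ≤ L * Real.exp (K' * T) := by
      gcongr
      exact hu.2
    have h4 := norm_sub_norm_le (h g u) (h 0 u)
    linarith
  have hR0 : 0 ≤ R := (norm_nonneg _).trans (hRb 0 (by simpa using hL) 0 ⟨le_rfl, hT⟩)
  set B := ‖F 0‖ + K' * R with hB
  have hB0 : 0 ≤ B := by positivity
  set X := Real.exp (K' * T) with hX
  have hX0 : 0 < X := Real.exp_pos _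
  -- `A` is the total coefficient of `η` in the Euler estimate, so `η = ε / (2 A)` costs `ε / 2`;
  -- the two terms that vanish as `N → ∞` get `ε / 4` each.
  set A := T * (K' + K) * X + 1 with hA
  have hA1 : 1 ≤ A := by
    have : 0 ≤ T * (K' + K) * X := by positivity
    linarith
  set η := ε / (2 * A) with hη
  have hη0 : 0 < η := by positivity
  have hηε : η ≤ ε / 2 := by
    rw [hη, div_le_div_iff₀ (by positivity) (by positivity)]
    nlinarith
  have hAη : A * η = ε / 2 := by
    rw [hη]
    field_simp
  have hN : Tendsto (fun N : ℕ+ => ((N : ℕ) : ℝ)) atTop atTop :=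
    tendsto_natCast_atTop_atTop.comp tendsto_PNat_val_atTop_atTop
  have hlim1 : Tendsto (fun N : ℕ+ => D / √((N : ℕ) : ℝ)) atTop (𝓝 0) :=
    (Real.tendsto_sqrt_atTop.comp hN).const_div_atTop D
  have hlim2 : Tendsto (fun N : ℕ+ => T * K * X / √((N : ℕ) : ℝ)) atTop (𝓝 0) :=
    (Real.tendsto_sqrt_atTop.comp hN).const_div_atTop _
  have hlim3 : Tendsto (fun N : ℕ+ => (T * K' * B * X + B) / ((N : ℕ) : ℝ)) atTop (𝓝 0) :=
    hN.const_div_atTop _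
  refine ⟨Q, η, hη0, ?_⟩
  filter_upwards [hlim1.eventually_lt_const (half_pos hε),
    hlim2.eventually_lt_const (show 0 < ε / 4 by positivity),
    hlim3.eventually_lt_const (show 0 < ε / 4 by positivity),
    tendsto_PNat_val_atTop_atTop.eventually_ge_atTop N₀]
    with N e1 e2 e3 hN₀ ω hC hq0 hker hLP hnoise
  have hNpos : (0 : ℝ) < (N : ℕ) := Nat.cast_pos.2 N.pos
  have htraj := hbound N hN₀ N.pos (fun k => s k ω) (fun k => act k ω) (fun i => θ₀ i ω)
    (fun i j => hC i j) hq0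
  set g := M.qNet σ fun i : Fin N => θ₀ i ω with hg
  set q : ℕ → M.QValues := fun k => M.trainedNet σ (α / N) N k
    (fun i => θ₀ i ω, fun k => (s k ω, act k ω)) with hq
  have heuler := norm_euler_sub_flow_le hF (hh g).1 (hh g).2 hT (hRb g hq0) N.pos
    (q := q) (z := fun l => M.noise σ α μ₀ Q (q l) (s l ω, act l ω)) rfl
    (ε := η) (ρ := K * (1 / √((N : ℕ) : ℝ) + η)) (by positivity) hnoise (fun k hk => by
      have hk0 : (k : ℝ) ≤ N * T := le_trans (by push_cast; linarith) hk
      obtain ⟨t1, -, t3⟩ := htraj k hk0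
      -- Along this trajectory `‖q k‖ ≤ Q`, so the cutoff is inactive and mean drift plus noise is
      -- the contribution of the actual episode.
      have hadd : F (q k) + M.noise σ α μ₀ Q (q k) (s k ω, act k ω)
          = M.episodeField σ α μ₀ (s k ω, act k ω) (q k) := by
        have hqk : ‖q k‖ ≤ Q := t1
        rw [noise, if_pos hqk]
        exact add_sub_cancel _ _
      rw [hadd]
      exact t3 η hη0.le hker)
  refine Skorokhod.edist_le fun t => ?_
  have htN : (⌊((N : ℕ) : ℝ) * t⌋₊ : ℝ) ≤ (N : ℕ) * T :=
    (Nat.floor_le (mul_nonneg hNpos.le t.2.1)).trans (by gcongr; exact t.2.2)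
  refine max_le ?_ ?_
  · refine (edist_triangle _ (LevyProkhorov.ofMeasure (empirical fun i : Fin N => θ₀ i ω)) _).trans
      ((add_le_add (edist_empirical_le (δ := D / √((N : ℕ) : ℝ)) fun i => ?_) hLP).trans ?_)
    · rw [dist_eq_norm]
      exact (htraj _ htN).2.1 i
    · rw [← ENNReal.ofReal_add (by positivity) hη0.le]
      exact ENNReal.ofReal_le_ofReal (by linarith)
  · have h1 := heuler t t.2.1 t.2.2
    have h2 : T * (K' * η + K * (1 / √((N : ℕ) : ℝ) + η) + K' * B / (N : ℕ)) * X + η + B / (N : ℕ)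
        = A * η + T * K * X / √((N : ℕ) : ℝ) + (T * K' * B * X + B) / (N : ℕ) := by
      rw [hA]
      ring
    have h3 : dist (q ⌊((N : ℕ) : ℝ) * t⌋₊) (h g t) ≤ ε := by
      rw [dist_eq_norm]
      linarith
    rw [← edist_le_ofReal hε.le] at h3
    exact h3

/-- The comparison process is the limit flow started from the random initial network of size `N`. It
converges in law by `continuous_limitPath`, and the trained process is within `ε / 2` of it off an
event of small probability. -/
theorem tendstoInDistribution_scaledPath {h : M.QValues → ℝ → M.QValues}
    (hh : ∀ g, ContinuousOn (h g) (Ici 0) ∧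
      ∀ t, 0 ≤ t → h g t = g + ∫ u in (0 : ℝ)..t, M.vectorField σ α μ₀ (h g u))
    [IsProbabilityMeasure P] (hσ : IsC2b σ) (hα : 0 ≤ α)
    (hμ₀ : InitAssumption μ₀) (hin : M.IsTrainingInput P μ₀ θ₀ s act) {𝒢 : Measure M.QValues}
    [IsProbabilityMeasure 𝒢]
    (h𝒢 : TendstoInDistribution (fun (N : ℕ+) ω => M.qNet σ (fun i : Fin N => θ₀ i ω)) atTop id
      (fun _ => P) 𝒢) {T : ℝ} (hT : 0 ≤ T) :
    TendstoInDistribution (fun (N : ℕ+) ω => M.scaledPath σ α T θ₀ s act N ω) atTop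
      (fun g => M.limitPath μ₀ T (hh g).1) (fun _ => P) 𝒢 := by
  refine tendstoInDistribution_of_tendsto_measure_edist
    (fun N => (M.measurable_scaledPath hσ hin T N).aemeasurable)
    (h𝒢.continuous_comp (M.continuous_limitPath hh T)) fun ε hε => ?_
  rw [ENNReal.tendsto_nhds_zero]
  intro δ hδ
  obtain ⟨L, hL, hLev⟩ := exists_eventually_measure_norm_ge_le h𝒢 (ENNReal.half_pos hδ.ne')
  obtain ⟨B, hB⟩ := hμ₀.bounded
  have hCae : ∀ᵐ ω ∂P, ∀ i j, |(θ₀ i ω).1 j| ≤ max B 0 := by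
    rw [ae_all_iff]
    intro i
    have h1 : ∀ᵐ θ ∂(P.map (θ₀ i)), ∀ j, |θ.1 j| ≤ B := by
      rw [hin.law_param i]
      exact hB
    filter_upwards [ae_of_ae_map (hin.measurable_param i).aemeasurable h1] with ω hω j
    exact (hω j).trans (le_max_left _ _)
  obtain ⟨Q, η, hη, hev⟩ := M.exists_edist_scaledPath_le (θ₀ := θ₀) (s := s) (act := act) hh hσ hα
    (le_max_right B 0) hL hT (half_pos hε)
  have hnoise := M.tendsto_measure_noise (α := α) hσ hin Q hT hη
  have hLP : Tendsto (fun N : ℕ+ => P {ω | ENNReal.ofReal η ≤ edist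
      (LevyProkhorov.ofMeasure (empirical fun i : Fin N => θ₀ i ω))
      (LevyProkhorov.ofMeasure μ₀)}) atTop (𝓝 0) := by
    refine tendsto_measure_le_of_ae_tendsto (fun N => ?_) ?_ (ENNReal.ofReal_pos.2 hη)
    · have h1 : Continuous fun θ : Fin N → Param dx da J =>
          edist (LevyProkhorov.ofMeasure (empirical θ)) (LevyProkhorov.ofMeasure μ₀) :=
        continuous_empirical.edist continuous_const
      exact h1.measurable.comp (measurable_pi_lambda _ fun i => hin.measurable_param i)
    · filter_upwards [M.ae_tendsto_empirical hin] with ω hω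
      exact tendsto_iff_edist_tendsto_0.1 hω
  have hker : ∀ i : (Fin J × M.states × M.actions) × (Fin J × M.states × M.actions),
      Tendsto (fun N : ℕ+ => P {ω | ENNReal.ofReal η ≤ ENNReal.ofReal
        |(∑ n : Fin N, unitKernel σ α i.1.1 i.2.1 (M.pt i.1.2.1 i.1.2.2) (M.pt i.2.2.1 i.2.2.2)
          (θ₀ n ω)) / N - (if i.1.1 = i.2.1 then
            M.tensorA σ α μ₀ i.1.1 i.1.2.1 i.1.2.2 i.2.2.1 i.2.2.2 else 0)|}) atTop (𝓝 0) := by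
    intro i
    have hc := continuous_unitKernel hσ α i.1.1 i.2.1 (M.pt i.1.2.1 i.1.2.2)
      (M.pt i.2.2.1 i.2.2.2)
    refine tendsto_measure_le_of_ae_tendsto (fun N => ?_) ?_ (ENNReal.ofReal_pos.2 hη)
    · have h1 := fun n : Fin N => hc.measurable.comp (hin.measurable_param n)
      simp only [Function.comp_def] at h1
      refine ENNReal.measurable_ofReal.comp (measurable_abs.comp ?_)
      exact ((Finset.measurable_sum _ fun n _ => h1 n).div_const _).sub_const _
    · filter_upwards [M.ae_tendsto_average hin hc.measurable (integrable_unitKernel hσ hμ₀ i.1.1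
        i.2.1 (M.pt i.1.2.1 i.1.2.2) (M.pt i.2.2.1 i.2.2.2))] with ω hω
      rw [M.integral_unitKernel hσ hμ₀] at hω
      have h1 := (hω.sub_const (if i.1.1 = i.2.1 then
        M.tensorA σ α μ₀ i.1.1 i.1.2.1 i.1.2.2 i.2.2.1 i.2.2.2 else 0)).abs
      rw [sub_self, abs_zero] at h1
      rw [← ENNReal.ofReal_zero]
      exact (ENNReal.continuous_ofReal.tendsto 0).comp h1
  have hkersum := tendsto_finsetSum Finset.univ fun i (_ : i ∈ Finset.univ) => hker i
  rw [Finset.sum_const_zero] at hkersum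
  have hsum := (hnoise.add hLP).add hkersum
  rw [add_zero, add_zero] at hsum
  filter_upwards [hLev, hev, ENNReal.tendsto_nhds_zero.1 hsum _ (ENNReal.half_pos hδ.ne')]
    with N h1 h2 h3
  refine le_trans ?_ (le_of_le_of_eq (add_le_add h1 h3) (ENNReal.add_halves δ))
  -- Union bound over four bad events: large initial network, large accumulated noise, empirical
  -- measure far from `μ₀`, some kernel average far from its mean. The bound on the output weights
  -- holds almost surely and costs nothing.
  refine le_trans ?_ (add_le_add le_rfl (add_le_add le_rfl (measure_iUnion_fintype_le P _)))
  refine le_trans ?_ (add_le_add le_rfl (add_le_add (measure_union_le _ _) le_rfl))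
  refine le_trans ?_ (add_le_add le_rfl (measure_union_le _ _))
  refine le_trans ?_ (measure_union_le _ _)
  generalize hU : (_ ∪ _ : Set Ω) = U
  refine measure_mono_ae ?_
  filter_upwards [hCae] with ω hω hbad
  change ω ∈ U
  by_contra hcon
  rw [← hU] at hcon
  simp only [mem_union, mem_iUnion, Set.mem_ofPred_eq, not_or, not_exists, not_and, not_le] at hcon
  obtain ⟨c1, ⟨c2, c3⟩, c4⟩ := hcon
  have h4 := h2 ω hω c1.le (fun j j' x a x' a' => by
    have := c4 ((j, x, a), (j', x', a'))
    exact ((ENNReal.ofReal_lt_ofReal_iff hη).1 this).le) c3.le (fun k hk => (c2 k hk).le)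
  have h5 : ENNReal.ofReal ε ≤ ENNReal.ofReal (ε / 2) := le_trans hbad h4
  rw [ENNReal.ofReal_le_ofReal_iff (by positivity)] at h5
  linarith

end DecisionProblem

end QLearn


theorem mainTheorem2 {dx da J : ℕ} (M : QLearn.DecisionProblem dx da J)
    (hπ : ∀ j : ℕ, j ≤ J → ∀ x a, 0 < M.visitProb j x a)
    (σ : ℝ → ℝ) (hσ : QLearn.IsC2b σ) (α : ℝ) (hα : 0 < α)
    (μ₀ : ProbabilityMeasure (QLearn.Param dx da J)) (hμ₀ : QLearn.InitAssumption μ₀)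
    {Ω : Type*} [MeasurableSpace Ω] (P : Measure Ω) [IsProbabilityMeasure P]
    (θ₀ : ℕ → Ω → QLearn.Param dx da J) (s : ℕ → Ω → Fin (J + 1) → M.states)
    (act : ℕ → Ω → Fin J → M.actions) (hin : M.IsTrainingInput P μ₀ θ₀ s act) :
    ∃ (𝒢 : Measure M.QValues) (_ : IsGaussian 𝒢) (h : M.QValues → ℝ → M.QValues),
      -- the law of the initial value is the mean-zero Gaussian law of the central limit theorem
      (∀ j x a, ∫ g, g j x a ∂𝒢 = 0) ∧
      (∀ j x a j' x' a', ∫ g, g j x a * g j' x' a' ∂𝒢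
        = ∫ θ, (θ.1 j * σ (inner ℝ θ.2 (M.pt x a))) * (θ.1 j' * σ (inner ℝ θ.2 (M.pt x' a')))
            ∂(μ₀ : Measure (QLearn.Param dx da J))) ∧
      -- `h g` is the solution of the limit ODE that starts from `g`
      (∀ g, M.IsLimitSolution σ α μ₀ g (h g) ∧
        ∀ h', M.IsLimitSolution σ α μ₀ g h' → ∀ t, 0 ≤ t → h' t = h g t) ∧
      -- convergence in distribution in the Skorokhod space to `(μ_t, h_t)`, with `μ_t = μ₀`
      (∀ T : ℝ, 0 < T → ∃ Z : M.QValues → QLearn.Skorokhod T M.PathState,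
        (∀ g (t : Icc (0 : ℝ) T), Z g t = (LevyProkhorov.ofMeasure μ₀, h g t)) ∧
        TendstoInDistribution (fun (N : ℕ+) ω => M.scaledPath σ α T θ₀ s act N ω) atTop Z
          (fun _ => P) 𝒢) ∧
      -- convergence to the solution of the Bellman equation
      (QLearn.PosDefAssumption M σ μ₀ → ∀ g,
        Tendsto (fun t => ⨆ i : Fin (J + 1) × M.states × M.actions,
          |M.withTerminal (h g t) i.1 i.2.1 i.2.2 - M.bellmanValue i.1 i.2.1 i.2.2|)
          atTop (𝓝 0)) := by
  obtain ⟨𝒢, h𝒢, hmean, hcov, hlim⟩ := M.exists_gaussian_limit hσ hμ₀ hin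
  obtain ⟨K, hK⟩ := M.exists_lipschitzWith_episodeField σ α μ₀
  have hF := M.lipschitzWith_vectorField σ α μ₀ hK
  choose h hc hi using fun g => QLearn.exists_global_solution hF g
  have hh : ∀ g, ContinuousOn (h g) (Ici 0) ∧
      ∀ t, 0 ≤ t → h g t = g + ∫ u in (0 : ℝ)..t, M.vectorField σ α μ₀ (h g u) :=
    fun g => ⟨(hc g).continuousOn, hi g⟩
  have hsol : ∀ g, M.IsLimitSolution σ α μ₀ g (h g) := fun g =>
    (M.isLimitSolution_iff σ α μ₀ g (h g)).2 (hh g)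
  refine ⟨𝒢, h𝒢, h, hmean, hcov, fun g => ⟨hsol g, fun h' hh' t ht => ?_⟩, fun T hT => ?_,
    fun hpd g => M.tendsto_iSup_abs_sub_bellmanValue α hπ hσ hα hμ₀ hpd (hsol g)⟩
  · obtain ⟨hc', hi'⟩ := (M.isLimitSolution_iff σ α μ₀ g h').1 hh'
    have h1 := QLearn.dist_le_of_integral_eq hF hc' hi' (hh g).1 (hh g).2 ht
    rw [dist_self, zero_mul] at h1
    exact dist_le_zero.1 h1
  · exact ⟨fun g => M.limitPath μ₀ T (hh g).1, fun g t => rfl,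
      M.tendstoInDistribution_scaledPath hh hσ hα.le hμ₀ hin hlim hT.le⟩
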